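/- **Setting.** We consider systems $\nu\alpha.\,D_0\mid\dots\mid D_n$ of devices $D_i=\langle M_i\blacktriangleright C_i\rangle$ (a memory and parallel commands), with the set $\alpha$ of channels established between devices. Each nonce $k$ gives a key pair $(k^+,k^-)$. Memories map variables to values (integers, public keys, arrays, randomised ciphers $\{v\}^n_L$ of values and $\{\mathrm{prin}(k^+,k^-,L)\}^n_{L'}$ of principals, readable with any one secret key of the set of public keys in the index, and an error value), principal names to principals $\mathrm{prin}(k^+,k^-,L)$ and key names to public keys. Rights $R$ are $\bot$ (no restriction) or a finite set of key names $k$ and of $\mathrm{pub}(p)$ for principal names $p$; $M(R)$ is the set of public keys denoted by such a set. Commands are: test of equality, declaration $\mathbf{new}\;x:S_R=e$, assignment to a variable or an array element, naming of a public key, parallel composition, replication, opening of a public channel, or of a secure channel $\mathrm{Chan}(S_{R_1})_{R_2}$ authenticated by the keys of both ends, output, input, atomic execution $\mathbf{synchronised}\{G\};C$, creation of a principal $\mathbf{newPrin}\;p(RS)$ (with a fresh key and with rights $L=M(RS)$), decryption, and registration of an encapsulated principal. Bound names are replaced by fresh locations (or channels) on execution. Run-time errors do not block: erroneous expressions give the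 error value, an array assignment with a bad index does nothing, and an unsuccessful decryption or registration takes its else-branch. Write $R_1\subseteq R_2$ if $R_2=\bot$ or if both are sets with syntactic inclusion, and $\cap$ for syntactic intersection with neutral element $\bot$. The information-flow type system $pc;\Gamma_P;\Gamma_K;\Gamma_C;\Gamma\vdash C$ requires: $R_1\subseteq pc\cap R_2$ for $\mathbf{new}\;x:S_{R_1}=e$ and $x:=e$ with $x:S_{R_1}$, $e:S_{R_2}$ (and for $\mathbf{new}$ that $R_1$ is $\bot$ or contains $\mathrm{pub}(p)$ for some $p$ in scope); $RS\subseteq R$ for the encryption of $e:S_R$ with the keys $RS$, the result being public; $RS\subseteq R_2\cap pc$ and $\mathrm{pub}(p)\in RS$ for the decryption by $p$ of a cipher of rights $R_2$ into a variable with rights $RS$; branches of tests and decryptions are typed with $pc$ intersected with the rights of the tested expressions; public channels carry only public data and are opened with $pc=\bot$; a secure channel with the key $k$ opened as $p$ needs $\{\mathrm{pub}(p),k\}\subseteq R_1\subseteq R_2\subseteq pc$, and the sequel is typed with $pc:=R_2$; output of $e:S_{R_3}$ needs $R_1\subseteq R_3$, and output and input need $pc=R_2$; naming a key, creating and registering a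 principal need $pc=\bot$; $\mathbf{synchronised}\{G\};C$ is typed as $G\{C/\mathbf{nop}\}$. A declared name must be new to the context. A *valid initial system* $P=A\mid D_1\mid\dots\mid D_n$ ($A$ has identifier $0$) has no established channel; all memories are finite and contain only public keys and principals $\mathrm{prin}(k^+,k^-,\{\})$; no principal occurs on two devices; for each $i\ge1$ the single command of $D_i$ is typable with $pc=\bot$ in the context given by the principal and key names of its memory. The command of $A$ is untyped and may also use attacker expressions: encryption, decryption with a bare secret key, changing the rights of a principal, extracting $k^+$, $k^-$ and the rights from a principal, the $j$-th attacker-generated principal, tuples, projections and integer operations. Keys generated later are fresh, and honest principals of $P$ do not use the keys generated by the attacker. *Allowed devices.* Let $P=P_0\to P_1\to\dots\to P_m=P'$ be a sequence $T$ of reductions and $L$ a set of public keys. Starting from $(I,L):=(\emptyset,L)$, go through the reductions from the last to the first; whenever a reduction creates a principal $\mathrm{prin}(k^+,k^-,L')$ on a device $i\neq0$ and $k^+\in L$, replace $(I,L)$ by $(I\cup\{i\},\,L'\cup(L\setminus\{k^+\}))$. Let $(I_0,L_0)$ be the result and $I'$ the set of $i\ge1$ such that $D_i$ has initially a principal $\mathrm{prin}(k^+,k^-,\{\})$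 with $k^+\in L_0$. Then $\mathrm{dev}(L,T)=I_0\cup I'$; it is *safe* if every $k^+\in L_0$ belongs to such an initial principal of some $D_i$, $i\ge 1$. *Open systems* $K\models Q$ consist of the attacker's knowledge $K$ (a map from variables to values, principals and keys) and a system $Q$. They have the internal reductions of $Q$ and labelled ones: the attacker opens, under an attacker-channel name $a$, a public channel of type $S$ with a device; or a secure channel, for which it must give attacker expressions over $K$ that evaluate to the secret key of the key demanded by the device, to the public key of the device's principal and to the two rights of the channel; it sends the value $K(f)$ of an attacker expression $f$ on $a$ (label $\mathrm{in}(a,f)$); or it receives a value on $a$, which is stored in $K$ under a fresh variable $m$ (label $\mathrm{out}(a,m)$). $K_1$ and $K_2$ are *statically equivalent* if they have the same variables and, for all attacker expressions $f,g$, $K_1(f)=K_1(g)$ iff $K_2(f)=K_2(g)$. *Labelled bisimilarity* $\approx_l$ is the largest symmetric relation on open systems such that related systems have statically equivalent knowledge, each internal reduction of one is matched by finitely many (possibly no) internal reductions of the other, and each reduction with label $l$ of one by a reduction with label $l$ of the other, preceded and followed by internal ones, the results being related again. For a set $I$ of identifiers, $Q_{|I}$ is the system of the devices of $Q$ with identifier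 in $I$, in which each established channel that does not have both ends in $I$ is replaced by an attacker channel, by a fixed injection. **Theorem.** Let $P=A\mid D_1\mid\dots\mid D_n$ be a valid initial system, let $T$ be a sequence of reductions $P\to^*P'$, and suppose that for some $1\le i\le n$ the device $i$ of $P'$ is $\langle M\blacktriangleright (\mathbf{new}\;x:S_R=E;\,C)\mid C'\rangle$ with a set $R$ of rights. Let $L=M(R)$, let $D_H=\mathrm{dev}(L,T)$, and let $K$ be the (disjoint) union of the memories of the devices of $P'$ with identifier not in $D_H$, which include the attacker. Let $Q$ be obtained from $P'$ by executing this declaration, which creates the location $y$ of $x$; for an arbitrary value $v$, let $Q_{i:x=v}$ be $Q$ with the additional parallel command $y:=v$ on the device $i$. If $D_H$ is safe, then $$(K\models Q_{|D_H})\;\approx_l\;(K\models (Q_{i:x=v})_{|D_H}).$$ -/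

import Mathlib

namespace CloudTypes

/-! ## Names, keys, values

Variable, principal, key and channel names, as well as memory locations, are natural numbers, in
separate name spaces (the syntax always says which one is meant). -/

/-- The nonces from which key pairs `(k⁺, k⁻)` are generated. The keys `att i` form the fixed
sequence of keys that the attacker generates by itself; `hon n` are all the other keys. -/
inductive Key where
  | hon (n : ℕ)
  | att (n : ℕ)
  deriving DecidableEq

/-- Random seeds of ciphers; the attacker has its own supply of seeds. -/
inductive Nonce where
  | hon (n : ℕ)
  | att (n : ℕ)
  deriving DecidableEq

/-- Values. `pub k` is `k⁺`; `enc v n L` is the cipher of the value `v` with seed `n` for the set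
`L` of public keys; `encPrin k L n L'` is the encapsulation, with seed `n` and for the keys `L'`,
of the principal value `prin(k⁺, k⁻, L)`; `nav` is the error value `NotAValue`. A set of public keys
is represented by the set of the underlying keys. -/
inductive Val where
  | int (i : ℤ)
  | pub (k : Key)
  | enc (v : Val) (n : Nonce) (L : Finset Key)
  | encPrin (k : Key) (L : Finset Key) (n : Nonce) (L' : Finset Key)
  | arr (l : List Val)
  | nav

/-- What the attacker can compute: values, principal values `prin(k⁺, k⁻, L)`, secret keys `k⁻`. -/
inductive Term where
  | val (v : Val)
  | prin (k : Key) (L : Finset Key)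
  | sec (k : Key)

namespace Val

/-- `v₁ ⊕ v₂` for a partial operation on integers; run-time errors give `nav`. -/
def binop (o : ℤ → ℤ → Option ℤ) : Val → Val → Val
  | int a, int b => match o a b with
    | some c => int c
    | none => nav
  | _, _ => nav

/-- The element of an array at an index; run-time errors give `nav`. -/
def index : Val → Val → Val
  | arr l, int i => if 0 ≤ i then (l[i.toNat]?).getD nav else nav
  | _, _ => nav

/-- `setIndex w i v` is the array `w` with element `i` replaced by `v`; it is `w` itself if `w` is
not an array or `i` is not one of its indices. -/
def setIndex : Val → Val → Val → Val
  | arr l, int i, v => if 0 ≤ i then arr (l.set i.toNat v) else arr l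
  | w, _, _ => w

/-- Append an element in front of an array. -/
def cons : Val → Val → Val
  | v, arr l => arr (v :: l)
  | _, _ => nav

/-- The key of a public-key value. -/
def key? : Val → Option Key
  | pub k => some k
  | _ => none

/-- An array of public keys, read as the set of these keys. -/
def keys? : Val → Option (Finset Key)
  | arr l => (l.mapM key?).map List.toFinset
  | _ => none

end Val

/-! ## Extended expressions of the attacker -/

/-- Extended expressions over a type `V` of variables: those that an untyped device can compute.
The tuple `{f₁, …, fₙ}` is `cons f₁ (… (cons fₙ nil))`. The seed of an encryption is named
explicitly, as element `s` of the attacker's own supply of seeds (as `freshprin` does for keys), so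
that an attacker may draw a fresh seed each time, or reuse one. -/
inductive AExpr (V : Type) where
  | var (m : V)
  | int (i : ℤ)
  | op (o : ℤ → ℤ → Option ℤ) (f g : AExpr V)
  | encr (f r : AExpr V) (s : ℕ)
  | decr (f g : AExpr V)
  | alter (f r : AExpr V)
  | freshprin (f : AExpr V)
  | pub (f : AExpr V)
  | sec (f : AExpr V)
  | rights (f : AExpr V)
  | nil
  | cons (f g : AExpr V)
  | elem (f g : AExpr V)

namespace Term

/-- A term that is used as a value: secrets that are not wrapped in a cipher are no values. -/
def toVal : Term → Val
  | val v => v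
  | _ => .nav

/-- A term that is used as a set of public keys. -/
def keys? : Term → Option (Finset Key)
  | val v => v.keys?
  | _ => none

/-- Encryption of a value or of a principal. -/
def encr (t r : Term) (s : ℕ) : Term :=
  match t, r.keys? with
  | val v, some L => val (.enc v (.att s) L)
  | prin k L', some L => val (.encPrin k L' (.att s) L)
  | _, _ => val .nav

/-- Decryption of a cipher with one secret key. -/
def decr : Term → Term → Term
  | val (.enc v _ L), sec k => if k ∈ L then val v else val .nav
  | val (.encPrin k' L' _ L), sec k => if k ∈ L then prin k' L' else val .nav
  | _, _ => val .nav

/-- The same principal with other rights. -/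
def alter (t r : Term) : Term :=
  match t, r.keys? with
  | prin k _, some L => prin k L
  | _, _ => val .nav

/-- The `i`-th principal generated by the attacker. -/
def freshprin : Term → Term
  | val (.int i) => if 0 ≤ i then prin (.att i.toNat) ∅ else val .nav
  | _ => val .nav

/-- The public key of a principal. -/
def pubOf : Term → Term
  | prin k _ => val (.pub k)
  | _ => val .nav

/-- The secret key of a principal. -/
def secOf : Term → Term
  | prin k _ => sec k
  | _ => val .nav

/-- The rights of a principal, as an array of public keys. -/
noncomputable def rightsOf : Term → Term
  | prin _ L => val (.arr (L.toList.map Val.pub))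
  | _ => val .nav

/-- A binary operation on values, extended to terms. -/
def lift₂ (h : Val → Val → Val) : Term → Term → Term
  | val v, val w => val (h v w)
  | _, _ => val .nav

end Term

/-- Evaluation of an extended expression; it is defined when all its variables are. -/
noncomputable def AExpr.eval {V : Type} (K : V → Option Term) : AExpr V → Option Term
  | var m => K m
  | int i => some (.val (.int i))
  | op o f g => (f.eval K).bind fun s => (g.eval K).map fun t => Term.lift₂ (Val.binop o) s t
  | encr f r n => (f.eval K).bind fun s => (r.eval K).map fun t => Term.encr s t n
  | decr f g => (f.eval K).bind fun s => (g.eval K).map fun t => Term.decr s t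
  | alter f r => (f.eval K).bind fun s => (r.eval K).map fun t => Term.alter s t
  | freshprin f => (f.eval K).map Term.freshprin
  | pub f => (f.eval K).map Term.pubOf
  | sec f => (f.eval K).map Term.secOf
  | rights f => (f.eval K).map Term.rightsOf
  | nil => some (.val (.arr []))
  | cons f g => (f.eval K).bind fun s => (g.eval K).map fun t => Term.lift₂ Val.cons s t
  | elem f g => (f.eval K).bind fun s => (g.eval K).map fun t => Term.lift₂ Val.index s t

/-! ## Syntax of the language -/

/-- Pure types. -/
inductive Ty where
  | pubKey
  | privKey
  | int
  | cipher (S : Ty)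
  | array (S : Ty)
  deriving DecidableEq

/-- Elements of a set of rights: a public key name `k`, or `pub(p)` for a principal name `p`. -/
inductive KeyRef where
  | key (k : ℕ)
  | pub (p : ℕ)
  deriving DecidableEq

/-- Sets `RS` of rights. -/
abbrev RSet := Finset KeyRef

/-- Rights `R`: either `⊥` (no restriction, here `none`) or a set of rights. -/
abbrev Rights := Option RSet

/-- `R₁ ⊆ R₂`, i.e. `R₁` is at least as confidential as `R₂`: syntactic inclusion, and everything
is below `⊥`. -/
def Rights.Sub (R₁ R₂ : Rights) : Prop :=
  match R₂ with
  | none => True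
  | some s₂ => ∃ s₁, R₁ = some s₁ ∧ s₁ ⊆ s₂

/-- Syntactic intersection of rights, with `⊥` as neutral element. -/
def Rights.inter : Rights → Rights → Rights
  | none, R => R
  | R, none => R
  | some s, some t => some (s ∩ t)

/-- The names which an extended expression may use in the code of a device. -/
inductive NameRef where
  | var (x : ℕ)
  | prin (p : ℕ)
  | key (k : ℕ)

/-- Expressions. The last form is reserved to untyped devices: no typing rule applies to it. -/
inductive Expr where
  | var (x : ℕ)
  | int (i : ℤ)
  | pub (p : ℕ)
  | release (p : ℕ)
  | enc (e : Expr) (RS : RSet)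
  | op (o : ℤ → ℤ → Option ℤ) (e₁ e₂ : Expr)
  | arr (es : List Expr)
  | elem (x : ℕ) (e : Expr)
  | ext (f : AExpr NameRef)

/-- Commands `G` which may stand inside `synchronised{G}`. -/
inductive SCmd where
  | nop
  | cond (e₁ e₂ : Expr) (G₁ G₂ : SCmd)
  | new (x : ℕ) (S : Ty) (R : Rights) (e : Expr) (G : SCmd)
  | assign (x : ℕ) (e : Expr) (G : SCmd)
  | assignArr (x : ℕ) (e₁ e₂ : Expr) (G : SCmd)
  | decrypt (p : ℕ) (e : Expr) (x : ℕ) (S : Ty) (RS : RSet) (G₁ G₂ : SCmd)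
  | register (p₂ : ℕ) (e : Expr) (p₁ : ℕ) (G₁ G₂ : SCmd)
  | par (G₁ G₂ : SCmd)

/-- The two ends of a connection: `connect` is the client, `accept` the server. -/
inductive Role where
  | client
  | server
  deriving DecidableEq

/-- Commands.
* `openPub r c S C` is `connect c : Chan(S_⊥)_⊥; C`, resp. `accept …`;
* `openPriv r c S R R' k p C` is `connect c : Chan(S_R)_R' to k as p; C`, resp. `accept … from …`;
* `decrypt p e x S RS C₁ C₂` decrypts `e` as `p` into a new variable `x : S_RS`;
* `register p₂ e p₁ C₁ C₂` registers, as `p₂`, the principal encapsulated in `e` under the new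
  name `p₁`. -/
inductive Cmd where
  | nop
  | cond (e₁ e₂ : Expr) (C₁ C₂ : Cmd)
  | new (x : ℕ) (S : Ty) (R : Rights) (e : Expr) (C : Cmd)
  | assign (x : ℕ) (e : Expr) (C : Cmd)
  | assignArr (x : ℕ) (e₁ e₂ : Expr) (C : Cmd)
  | letKey (k : ℕ) (e : Expr) (C : Cmd)
  | par (C₁ C₂ : Cmd)
  | bang (C : Cmd)
  | openPub (r : Role) (c : ℕ) (S : Ty) (C : Cmd)
  | openPriv (r : Role) (c : ℕ) (S : Ty) (R R' : Rights) (k p : ℕ) (C : Cmd)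
  | output (e : Expr) (c : ℕ) (C : Cmd)
  | input (c x : ℕ) (C : Cmd)
  | sync (G : SCmd) (C : Cmd)
  | newPrin (p : ℕ) (RS : RSet) (C : Cmd)
  | decrypt (p : ℕ) (e : Expr) (x : ℕ) (S : Ty) (RS : RSet) (C₁ C₂ : Cmd)
  | register (p₂ : ℕ) (e : Expr) (p₁ : ℕ) (C₁ C₂ : Cmd)

/-- `G{C / nop}`. -/
def SCmd.plug : SCmd → Cmd → Cmd
  | .nop, C => C
  | .cond e₁ e₂ G₁ G₂, C => .cond e₁ e₂ (G₁.plug C) (G₂.plug C)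
  | .new x S R e G, C => .new x S R e (G.plug C)
  | .assign x e G, C => .assign x e (G.plug C)
  | .assignArr x e₁ e₂ G, C => .assignArr x e₁ e₂ (G.plug C)
  | .decrypt p e x S RS G₁ G₂, C => .decrypt p e x S RS (G₁.plug C) (G₂.plug C)
  | .register p₂ e p₁ G₁ G₂, C => .register p₂ e p₁ (G₁.plug C) (G₂.plug C)
  | .par G₁ G₂, C => .par (G₁.plug C) (G₂.plug C)

/-! ## Type system -/

/-- Typing contexts `Γ_P; Γ_K; Γ_C; Γ`: the principal names and the key names that are in scope, the
types `Chan(S_R₁)_R₂` of channel names (as `(S, R₁, R₂)`), and the types `S_R` of variables. -/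
structure Ctx where
  prin : Set ℕ
  key : Set ℕ
  chan : ℕ → Option (Ty × Rights × Rights)
  var : ℕ → Option (Ty × Rights)

namespace Ctx

def addPrin (Γ : Ctx) (p : ℕ) : Ctx := { Γ with prin := insert p Γ.prin }

def addKey (Γ : Ctx) (k : ℕ) : Ctx := { Γ with key := insert k Γ.key }

def addChan (Γ : Ctx) (c : ℕ) (S : Ty) (R₁ R₂ : Rights) : Ctx :=
  { Γ with chan := Function.update Γ.chan c (some (S, R₁, R₂)) }

def addVar (Γ : Ctx) (x : ℕ) (S : Ty) (R : Rights) : Ctx :=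
  { Γ with var := Function.update Γ.var x (some (S, R)) }

/-- Well-formed rights: all the names in them are in scope. -/
def WfRights (Γ : Ctx) : Rights → Prop
  | none => True
  | some RS => ∀ r ∈ RS, match r with
    | .key k => k ∈ Γ.key
    | .pub p => p ∈ Γ.prin

end Ctx

/-- `Γ ⊢ e : S_R`. -/
inductive HasType (Γ : Ctx) : Expr → Ty → Rights → Prop
  | var {x S R} : Γ.var x = some (S, R) → HasType Γ (.var x) S R
  | int {i} : HasType Γ (.int i) .int none
  | pub {p} : p ∈ Γ.prin → HasType Γ (.pub p) .pubKey none
  | release {p} : p ∈ Γ.prin → HasType Γ (.release p) .privKey none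
  | enc {e RS S R} : Γ.WfRights (some RS) → HasType Γ e S R → Rights.Sub (some RS) R →
      HasType Γ (.enc e RS) (.cipher S) none
  | op {o e₁ e₂ R₁ R₂} : HasType Γ e₁ .int R₁ → HasType Γ e₂ .int R₂ →
      HasType Γ (.op o e₁ e₂) .int (R₁.inter R₂)
  | arrNil {S R} : HasType Γ (.arr []) (.array S) R
  | arrCons {e es S R} : HasType Γ e S R → HasType Γ (.arr es) (.array S) R →
      HasType Γ (.arr (e :: es)) (.array S) R
  | elem {x e S R₁ R₂} : Γ.var x = some (.array S, R₁) → HasType Γ e .int R₂ →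
      HasType Γ (.elem x e) S (R₁.inter R₂)

/-- `pc; Γ ⊢ C`. A declared name must be new to the context: names are never declared twice. -/
inductive WellTyped : Rights → Ctx → Cmd → Prop
  | nop {pc Γ} : WellTyped pc Γ .nop
  | cond {pc Γ e₁ e₂ C₁ C₂ S R₁ R₂} :
      HasType Γ e₁ S R₁ → HasType Γ e₂ S R₂ →
      WellTyped ((pc.inter R₁).inter R₂) Γ C₁ → WellTyped ((pc.inter R₁).inter R₂) Γ C₂ →
      WellTyped pc Γ (.cond e₁ e₂ C₁ C₂)
  | new {pc Γ x S R₁ R₂ e C} :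
      Γ.var x = none → Γ.WfRights R₁ → HasType Γ e S R₂ → Rights.Sub R₁ (pc.inter R₂) →
      (∀ RS, R₁ = some RS → ∃ p ∈ Γ.prin, KeyRef.pub p ∈ RS) →
      WellTyped pc (Γ.addVar x S R₁) C → WellTyped pc Γ (.new x S R₁ e C)
  | assign {pc Γ x e C S R₁ R₂} :
      HasType Γ (.var x) S R₁ → HasType Γ e S R₂ → Rights.Sub R₁ (pc.inter R₂) →
      WellTyped pc Γ C → WellTyped pc Γ (.assign x e C)
  | assignArr {pc Γ x e₁ e₂ C S R₁ R₂ R₃} :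
      HasType Γ e₁ .int R₁ → HasType Γ e₂ S R₂ → HasType Γ (.var x) (.array S) R₃ →
      Rights.Sub R₃ ((pc.inter R₁).inter R₂) →
      WellTyped pc Γ C → WellTyped pc Γ (.assignArr x e₁ e₂ C)
  | letKey {Γ k e C} :
      k ∉ Γ.key → HasType Γ e .pubKey none →
      WellTyped none (Γ.addKey k) C → WellTyped none Γ (.letKey k e C)
  | par {pc Γ C₁ C₂} : WellTyped pc Γ C₁ → WellTyped pc Γ C₂ → WellTyped pc Γ (.par C₁ C₂)
  | bang {pc Γ C} : WellTyped pc Γ C → WellTyped pc Γ (.bang C)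
  | openPub {Γ r c S C} :
      Γ.chan c = none → WellTyped none (Γ.addChan c S none none) C →
      WellTyped none Γ (.openPub r c S C)
  | openPriv {pc Γ r c S R₁ R₂ k p C} :
      Γ.chan c = none → (r = .client → Γ.WfRights R₁ ∧ Γ.WfRights R₂) →
      p ∈ Γ.prin → k ∈ Γ.key →
      Rights.Sub (some {.pub p, .key k}) R₁ → Rights.Sub R₁ R₂ → Rights.Sub R₂ pc →
      WellTyped R₂ (Γ.addChan c S R₁ R₂) C →
      WellTyped pc Γ (.openPriv r c S R₁ R₂ k p C)
  | output {pc Γ e c C S R₁ R₃} :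
      HasType Γ e S R₃ → Γ.chan c = some (S, R₁, pc) → Rights.Sub R₁ R₃ →
      WellTyped pc Γ C → WellTyped pc Γ (.output e c C)
  | input {pc Γ c x C S R₁} :
      Γ.var x = none → Γ.chan c = some (S, R₁, pc) →
      WellTyped pc (Γ.addVar x S R₁) C → WellTyped pc Γ (.input c x C)
  | sync {pc Γ G C} : WellTyped pc Γ (G.plug C) → WellTyped pc Γ (.sync G C)
  | newPrin {Γ p RS C} :
      p ∉ Γ.prin → Γ.WfRights (some RS) →
      WellTyped none (Γ.addPrin p) C → WellTyped none Γ (.newPrin p RS C)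
  | decrypt {pc Γ p e x S RS R₂ C₁ C₂} :
      Γ.var x = none → Γ.WfRights (some RS) → KeyRef.pub p ∈ RS → p ∈ Γ.prin →
      HasType Γ e (.cipher S) R₂ → Rights.Sub (some RS) (R₂.inter pc) →
      WellTyped (pc.inter R₂) (Γ.addVar x S (some RS)) C₁ → WellTyped (pc.inter R₂) Γ C₂ →
      WellTyped pc Γ (.decrypt p e x S RS C₁ C₂)
  | register {Γ p₂ e p₁ C₁ C₂} :
      p₁ ∉ Γ.prin → p₂ ∈ Γ.prin → HasType Γ e .privKey none →
      WellTyped none (Γ.addPrin p₁) C₁ → WellTyped none Γ C₂ →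
      WellTyped none Γ (.register p₂ e p₁ C₁ C₂)

/-! ## Memories, environments, evaluation of expressions -/

/-- Memories: locations of variables, of principals `prin(k⁺, k⁻, L)` (as `(k, L)`) and of public
keys. -/
structure Mem where
  var : ℕ → Option Val
  prin : ℕ → Option (Key × Finset Key)
  key : ℕ → Option Key

namespace Mem

def setVar (M : Mem) (y : ℕ) (v : Val) : Mem :=
  { M with var := Function.update M.var y (some v) }

def setPrin (M : Mem) (l : ℕ) (k : Key) (L : Finset Key) : Mem :=
  { M with prin := Function.update M.prin l (some (k, L)) }

def setKey (M : Mem) (l : ℕ) (k : Key) : Mem :=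
  { M with key := Function.update M.key l (some k) }

def IsFinite (M : Mem) : Prop :=
  {y | (M.var y).isSome}.Finite ∧ {l | (M.prin l).isSome}.Finite ∧ {l | (M.key l).isSome}.Finite

end Mem

/-- Active channels. `est id i j` is the `id`-th channel established between the devices `i`
(client) and `j` (server); `att a` is an attacker-channel name. -/
inductive Chan where
  | est (id i j : ℕ)
  | att (a : ℕ)
  deriving DecidableEq

/-- The substitution that has been applied so far to the code of a thread: it sends the names which
the thread has declared to the fresh locations, resp. active channels, which replace them. A thread
`C` that has undergone the substitution `σ` is kept as the pair `(σ, C)`. -/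
structure Env where
  var : ℕ → Option ℕ
  prin : ℕ → Option ℕ
  key : ℕ → Option ℕ
  chan : ℕ → Option Chan

namespace Env

def setVar (σ : Env) (x y : ℕ) : Env := { σ with var := Function.update σ.var x (some y) }

def setPrin (σ : Env) (p l : ℕ) : Env := { σ with prin := Function.update σ.prin p (some l) }

def setKey (σ : Env) (k l : ℕ) : Env := { σ with key := Function.update σ.key k (some l) }

def setChan (σ : Env) (c : ℕ) (ch : Chan) : Env :=
  { σ with chan := Function.update σ.chan c (some ch) }

/-- In an initial device, the code refers to the locations of the memory directly. -/
def start (M : Mem) : Env where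
  var x := (M.var x).map fun _ => x
  prin p := (M.prin p).map fun _ => p
  key k := (M.key k).map fun _ => k
  chan _ := none

/-- The content of a variable name. -/
def varVal (σ : Env) (M : Mem) (x : ℕ) : Option Val := (σ.var x).bind M.var

/-- The principal value of a principal name. -/
def prinVal (σ : Env) (M : Mem) (p : ℕ) : Option (Key × Finset Key) := (σ.prin p).bind M.prin

/-- The key of a key name. -/
def keyVal (σ : Env) (M : Mem) (k : ℕ) : Option Key := (σ.key k).bind M.key

/-- The values which an extended expression of an untyped device can use. -/
def nameVal (σ : Env) (M : Mem) : NameRef → Option Term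
  | .var x => (σ.varVal M x).map .val
  | .prin p => (σ.prinVal M p).map fun q => .prin q.1 q.2
  | .key k => (σ.keyVal M k).map fun k' => .val (.pub k')

end Env

/-- The key denoted by an element of a set of rights. -/
def KeyRef.eval (σ : Env) (M : Mem) : KeyRef → Option Key
  | .key k => σ.keyVal M k
  | .pub p => (σ.prinVal M p).map Prod.fst

/-- `M(RS)`, a set of keys; it is defined when all the names in `RS` are. -/
def evalRS (σ : Env) (M : Mem) (RS : RSet) : Option (Finset Key) :=
  if none ∈ RS.image (KeyRef.eval σ M) then none
  else some (Finset.eraseNone (RS.image (KeyRef.eval σ M)))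

/-- `M(R)`, where the value of `⊥` is `⊥` (the inner `none`). -/
def evalRights (σ : Env) (M : Mem) : Rights → Option (Option (Finset Key))
  | none => some none
  | some RS => (evalRS σ M RS).map some

/-- `Eval σ M U e v U'`: in the memory `M`, the expression `e` (under the substitution `σ`) evaluates
to `v`. The seeds that are drawn are fresh for the set `U` of seeds used so far, and `U'` is the set
of used seeds afterwards. -/
inductive Eval (σ : Env) (M : Mem) : Finset ℕ → Expr → Val → Finset ℕ → Prop
  | var {U x v} : σ.varVal M x = some v → Eval σ M U (.var x) v U
  | int {U i} : Eval σ M U (.int i) (.int i) U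
  | pub {U p k L} : σ.prinVal M p = some (k, L) → Eval σ M U (.pub p) (.pub k) U
  | release {U p k L n} : σ.prinVal M p = some (k, L) → L ≠ ∅ → n ∉ U →
      Eval σ M U (.release p) (.encPrin k L (.hon n) L) (insert n U)
  | releaseErr {U p k} : σ.prinVal M p = some (k, ∅) → Eval σ M U (.release p) .nav U
  | enc {U U' e v RS L n} : Eval σ M U e v U' → evalRS σ M RS = some L → n ∉ U' →
      Eval σ M U (.enc e RS) (.enc v (.hon n) L) (insert n U')
  | op {U U₁ U₂ o e₁ e₂ v₁ v₂} : Eval σ M U e₁ v₁ U₁ → Eval σ M U₁ e₂ v₂ U₂ →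
      Eval σ M U (.op o e₁ e₂) (v₁.binop o v₂) U₂
  | arrNil {U} : Eval σ M U (.arr []) (.arr []) U
  | arrCons {U U₁ U₂ e es v vs} : Eval σ M U e v U₁ → Eval σ M U₁ (.arr es) (.arr vs) U₂ →
      Eval σ M U (.arr (e :: es)) (.arr (v :: vs)) U₂
  | elem {U U' x e w v} : σ.varVal M x = some w → Eval σ M U e v U' →
      Eval σ M U (.elem x e) (w.index v) U'
  | ext {U f t} : f.eval (σ.nameVal M) = some t → Eval σ M U (.ext f) t.toVal U

/-! ## Reduction of a single thread -/

/-- The elementary commands that may also stand inside `synchronised`, without continuations. -/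
inductive Act where
  | cond (e₁ e₂ : Expr)
  | new (x : ℕ) (S : Ty) (R : Rights) (e : Expr)
  | assign (x : ℕ) (e : Expr)
  | assignArr (x : ℕ) (e₁ e₂ : Expr)
  | decrypt (p : ℕ) (e : Expr) (x : ℕ) (S : Ty) (RS : RSet)
  | register (p₂ : ℕ) (e : Expr) (p₁ : ℕ)

/-- The success of a decryption with the key `k` into a variable whose rights evaluate to `L'`. -/
def DecOk (k : Key) (L' : Finset Key) (w v : Val) : Prop :=
  ∃ n L, w = .enc v n L ∧ k ∈ L ∧ L' ⊆ L

/-- The success of a registration with the key `k`: `w` encapsulates the principal `(k₁, L₁)`. -/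
def RegOk (k : Key) (w : Val) (k₁ : Key) (L₁ : Finset Key) : Prop :=
  ∃ n, w = .encPrin k₁ L₁ n L₁ ∧ k ∈ L₁

/-- Execution of an elementary command, from the used seeds `U`, the substitution `σ` and the memory
`M` to `U'`, `σ'` and `M'`; the Boolean tells which continuation is taken (`true` for the first). A
run-time error never blocks a decryption or a registration (the second continuation is taken) or an
assignment to an array (nothing is assigned). -/
inductive ActStep : Finset ℕ → Env → Mem → Act → Finset ℕ → Env → Mem → Bool → Prop
  | condTrue {U U₁ U₂ σ M e₁ e₂ v} : Eval σ M U e₁ v U₁ → Eval σ M U₁ e₂ v U₂ →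
      ActStep U σ M (.cond e₁ e₂) U₂ σ M true
  | condFalse {U U₁ U₂ σ M e₁ e₂ v₁ v₂} : Eval σ M U e₁ v₁ U₁ → Eval σ M U₁ e₂ v₂ U₂ → v₁ ≠ v₂ →
      ActStep U σ M (.cond e₁ e₂) U₂ σ M false
  | new {U U' σ M x S R e v y} : Eval σ M U e v U' → M.var y = none →
      ActStep U σ M (.new x S R e) U' (σ.setVar x y) (M.setVar y v) true
  | assign {U U' σ M x e v y} : Eval σ M U e v U' → σ.var x = some y → (M.var y).isSome →
      ActStep U σ M (.assign x e) U' σ (M.setVar y v) true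
  | assignArr {U U₁ U₂ σ M x e₁ e₂ v₁ v₂ y w} : Eval σ M U e₁ v₁ U₁ → Eval σ M U₁ e₂ v₂ U₂ →
      σ.var x = some y → M.var y = some w →
      ActStep U σ M (.assignArr x e₁ e₂) U₂ σ (M.setVar y (w.setIndex v₁ v₂)) true
  | decTrue {U U' σ M p e x S RS k L L' w v y} : σ.prinVal M p = some (k, L) → Eval σ M U e w U' →
      evalRS σ M RS = some L' → DecOk k L' w v → M.var y = none →
      ActStep U σ M (.decrypt p e x S RS) U' (σ.setVar x y) (M.setVar y v) true
  | decFalse {U U' σ M p e x S RS k L L' w} : σ.prinVal M p = some (k, L) → Eval σ M U e w U' →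
      evalRS σ M RS = some L' → (∀ v, ¬ DecOk k L' w v) →
      ActStep U σ M (.decrypt p e x S RS) U' σ M false
  | regTrue {U U' σ M p₂ e p₁ k L w k₁ L₁ l} : σ.prinVal M p₂ = some (k, L) → Eval σ M U e w U' →
      RegOk k w k₁ L₁ → M.prin l = none →
      ActStep U σ M (.register p₂ e p₁) U' (σ.setPrin p₁ l) (M.setPrin l k₁ L₁) true
  | regFalse {U U' σ M p₂ e p₁ k L w} : σ.prinVal M p₂ = some (k, L) → Eval σ M U e w U' →
      (∀ k₁ L₁, ¬ RegOk k w k₁ L₁) →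
      ActStep U σ M (.register p₂ e p₁) U' σ M false

/-- An elementary command at the head of a command of a `synchronised` block, with the two
continuations. -/
def SCmd.head : SCmd → Option (Act × SCmd × SCmd)
  | .cond e₁ e₂ G₁ G₂ => some (.cond e₁ e₂, G₁, G₂)
  | .new x S R e G => some (.new x S R e, G, G)
  | .assign x e G => some (.assign x e, G, G)
  | .assignArr x e₁ e₂ G => some (.assignArr x e₁ e₂, G, G)
  | .decrypt p e x S RS G₁ G₂ => some (.decrypt p e x S RS, G₁, G₂)
  | .register p₂ e p₁ G₁ G₂ => some (.register p₂ e p₁, G₁, G₂)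
  | _ => none

/-- An elementary command at the head of a command, with the two continuations. -/
def Cmd.head : Cmd → Option (Act × Cmd × Cmd)
  | .cond e₁ e₂ C₁ C₂ => some (.cond e₁ e₂, C₁, C₂)
  | .new x S R e C => some (.new x S R e, C, C)
  | .assign x e C => some (.assign x e, C, C)
  | .assignArr x e₁ e₂ C => some (.assignArr x e₁ e₂, C, C)
  | .decrypt p e x S RS C₁ C₂ => some (.decrypt p e x S RS, C₁, C₂)
  | .register p₂ e p₁ C₁ C₂ => some (.register p₂ e p₁, C₁, C₂)
  | _ => none

/-- The state of the code of a `synchronised` block during its execution. -/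
inductive SConf where
  | run (σ : Env) (G : SCmd)
  | par (a b : SConf)

/-- One step inside a `synchronised` block. -/
inductive SStep : Finset ℕ × Mem × SConf → Finset ℕ × Mem × SConf → Prop
  | act {U U' σ σ' M M' G a G₁ G₂ b} : G.head = some (a, G₁, G₂) → ActStep U σ M a U' σ' M' b →
      SStep (U, M, .run σ G) (U', M', .run σ' (if b then G₁ else G₂))
  | fork {U σ M G₁ G₂} : SStep (U, M, .run σ (.par G₁ G₂)) (U, M, .par (.run σ G₁) (.run σ G₂))
  | left {U U' M M' a a' b} : SStep (U, M, a) (U', M', a') →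
      SStep (U, M, .par a b) (U', M', .par a' b)
  | right {U U' M M' a b b'} : SStep (U, M, b) (U', M', b') →
      SStep (U, M, .par a b) (U', M', .par a b')

/-- `Exit s σ`: the block has been executed completely, and `σ` is the substitution for its
continuation, which may use the names declared in the block. (By the typing rule, the continuation
of `G₁ | G₂` uses none of the names declared in `G₁` or in `G₂`, as it is typed in the scope of
either.) -/
inductive Exit : SConf → Env → Prop
  | nop {σ} : Exit (.run σ .nop) σ
  | par {a b σ σ'} : Exit a σ → Exit b σ' → Exit (.par a b) σ

/-- Threads: a command under the substitution applied to it so far, or the command that assigns the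
value `v` to the location `y`, by which a variable is modified from outside. -/
inductive Thread where
  | run (σ : Env) (C : Cmd)
  | set (y : ℕ) (v : Val)

/-- The keys and the seeds which have been generated so far. -/
structure Used where
  keys : Finset ℕ
  nonces : Finset ℕ

/-- `LStep u M t ev u' M' ts`: a thread `t` of a device with memory `M` reduces to the threads `ts`.
`ev` is `some (k, L)` if the reduction creates the principal `prin(k⁺, k⁻, L)`. -/
inductive LStep : Used → Mem → Thread → Option (ℕ × Finset Key) → Used → Mem → Multiset Thread → Prop
  | act {u σ M C a C₁ C₂ U' σ' M' b} : C.head = some (a, C₁, C₂) →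
      ActStep u.nonces σ M a U' σ' M' b →
      LStep u M (.run σ C) none { u with nonces := U' } M' {.run σ' (if b then C₁ else C₂)}
  | par {u σ M C₁ C₂} : LStep u M (.run σ (.par C₁ C₂)) none u M {.run σ C₁, .run σ C₂}
  | bang {u σ M C} : LStep u M (.run σ (.bang C)) none u M {.run σ C, .run σ (.bang C)}
  | letKey {u σ M k e C k' U' l} : Eval σ M u.nonces e (.pub k') U' → M.key l = none →
      LStep u M (.run σ (.letKey k e C)) none { u with nonces := U' } (M.setKey l k')
        {.run (σ.setKey k l) C}
  | newPrin {u σ M p RS C L k l} : evalRS σ M RS = some L → k ∉ u.keys → M.prin l = none →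
      LStep u M (.run σ (.newPrin p RS C)) (some (k, L)) { u with keys := insert k u.keys }
        (M.setPrin l (.hon k) L) {.run (σ.setPrin p l) C}
  | sync {u σ M G C U' M' s σ'} :
      Relation.ReflTransGen SStep (u.nonces, M, .run σ G) (U', M', s) → Exit s σ' →
      LStep u M (.run σ (.sync G C)) none { u with nonces := U' } M' {.run σ' C}
  | set {u M y v} : (M.var y).isSome → LStep u M (.set y v) none u (M.setVar y v) 0

/-! ## Systems of devices and their reductions -/

/-- A device: a memory and parallel threads. -/
structure Device where
  mem : Mem
  threads : Multiset Thread

/-- A system `ν α. D_i | D_j | …` of devices with identifiers. `chans` is the set `α` of established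
channels, each one recorded as `(id, i, j)`; the keys and seeds that have been generated are recorded
likewise, so as to make sense of freshness. -/
structure System where
  used : Used
  chans : Finset (ℕ × ℕ × ℕ)
  devs : ℕ → Option Device

/-- Replace the device with identifier `i`. -/
def System.setDev (P : System) (i : ℕ) (D : Device) : System :=
  { P with devs := Function.update P.devs i (some D) }

/-- `(i, k, L)`: the device `i` creates the principal `prin(k⁺, k⁻, L)`. -/
abbrev Event := ℕ × ℕ × Finset Key

/-- The reduction `P → P'`, labelled with the principal that it creates, if any. -/
inductive Step : System → Option Event → System → Prop
  | loc {P : System} {i M t T ev u' M' ts} : P.devs i = some ⟨M, t ::ₘ T⟩ →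
      LStep P.used M t ev u' M' ts →
      Step P (ev.map fun q => (i, q)) (({ P with used := u' } : System).setDev i ⟨M', ts + T⟩)
  | openPub {P : System} {i j M₁ M₂ T₁ T₂ σ₁ σ₂ c₁ c₂ S C₁ C₂ id} : i ≠ j →
      P.devs i = some ⟨M₁, .run σ₁ (.openPub .client c₁ S C₁) ::ₘ T₁⟩ →
      P.devs j = some ⟨M₂, .run σ₂ (.openPub .server c₂ S C₂) ::ₘ T₂⟩ →
      (id, i, j) ∉ P.chans →
      Step P none ((({ P with chans := insert (id, i, j) P.chans } : System).setDev i
          ⟨M₁, .run (σ₁.setChan c₁ (.est id i j)) C₁ ::ₘ T₁⟩).setDev j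
          ⟨M₂, .run (σ₂.setChan c₂ (.est id i j)) C₂ ::ₘ T₂⟩)
  | openPriv {P : System} {i j M₁ M₂ T₁ T₂ σ₁ σ₂ c₁ c₂ S R₁ R₂ R₁' R₂' k₁ k₂ p₁ p₂ C₁ C₂ id
      key₁ L₁ key₂ L₂ r r'} : i ≠ j →
      P.devs i = some ⟨M₁, .run σ₁ (.openPriv .client c₁ S R₁ R₁' k₁ p₁ C₁) ::ₘ T₁⟩ →
      P.devs j = some ⟨M₂, .run σ₂ (.openPriv .server c₂ S R₂ R₂' k₂ p₂ C₂) ::ₘ T₂⟩ →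
      σ₁.prinVal M₁ p₁ = some (key₁, L₁) → σ₂.prinVal M₂ p₂ = some (key₂, L₂) →
      σ₁.keyVal M₁ k₁ = some key₂ → σ₂.keyVal M₂ k₂ = some key₁ →
      evalRights σ₁ M₁ R₁ = some r → evalRights σ₂ M₂ R₂ = some r →
      evalRights σ₁ M₁ R₁' = some r' → evalRights σ₂ M₂ R₂' = some r' →
      (id, i, j) ∉ P.chans →
      Step P none ((({ P with chans := insert (id, i, j) P.chans } : System).setDev i
          ⟨M₁, .run (σ₁.setChan c₁ (.est id i j)) C₁ ::ₘ T₁⟩).setDev j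
          ⟨M₂, .run (σ₂.setChan c₂ (.est id i j)) C₂ ::ₘ T₂⟩)
  | comm {P : System} {i j M₁ M₂ T₁ T₂ σ₁ σ₂ c₁ c₂ e x C₁ C₂ id a b v U' y} : i ≠ j →
      P.devs i = some ⟨M₁, .run σ₁ (.output e c₁ C₁) ::ₘ T₁⟩ →
      P.devs j = some ⟨M₂, .run σ₂ (.input c₂ x C₂) ::ₘ T₂⟩ →
      σ₁.chan c₁ = some (.est id a b) → σ₂.chan c₂ = some (.est id a b) →
      Eval σ₁ M₁ P.used.nonces e v U' → M₂.var y = none →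
      Step P none ((({ P with used := { P.used with nonces := U' } } : System).setDev i
          ⟨M₁, .run σ₁ C₁ ::ₘ T₁⟩).setDev j
          ⟨M₂.setVar y v, .run (σ₂.setVar x y) C₂ ::ₘ T₂⟩)

/-- `P →* P'`, with the list of the labels of its reductions. -/
inductive Trace : System → List (Option Event) → System → Prop
  | refl {P} : Trace P [] P
  | cons {P ev P' evs P''} : Step P ev P' → Trace P' evs P'' → Trace P (ev :: evs) P''

/-! ## Valid initial systems and allowed devices -/

/-- The keys that occur in an initial memory. -/
def Mem.HasKey (M : Mem) (k : Key) : Prop :=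
  (∃ l L, M.prin l = some (k, L)) ∨ (∃ l, M.key l = some k) ∨ ∃ y, M.var y = some (.pub k)

/-- The context of an initial memory: its principals and its keys are in scope. -/
def Ctx.start (M : Mem) : Ctx where
  prin := {p | (M.prin p).isSome}
  key := {k | (M.key k).isSome}
  chan _ := none
  var _ := none

/-- Valid initial systems `A_0 | D_1 | … | D_n`. -/
structure ValidInitial (n : ℕ) (P : System) : Prop where
  ids : ∀ i, (P.devs i).isSome ↔ i ≤ n
  noChans : P.chans = ∅
  single : ∀ i D, P.devs i = some D → ∃ C, D.threads = {.run (.start D.mem) C}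
  finite : ∀ i D, P.devs i = some D → D.mem.IsFinite
  vars : ∀ i D, P.devs i = some D → ∀ y v, D.mem.var y = some v → ∃ k, v = .pub k
  prins : ∀ i D, P.devs i = some D → ∀ l k L, D.mem.prin l = some (k, L) → L = ∅
  uniq : ∀ i j D D', i ≠ j → P.devs i = some D → P.devs j = some D' →
    ∀ l l' k L L', D.mem.prin l = some (k, L) → D'.mem.prin l' ≠ some (k, L')
  /-- the keys which occur are not generated again -/
  known : ∀ i D, P.devs i = some D → ∀ n, D.mem.HasKey (.hon n) → n ∈ P.used.keys
  /-- the principals of the honest devices are not those that the attacker generates -/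
  own : ∀ i D, 1 ≤ i → P.devs i = some D → ∀ l a L, D.mem.prin l ≠ some (.att a, L)
  typed : ∀ i D, 1 ≤ i → P.devs i = some D → ∀ σ C, Thread.run σ C ∈ D.threads →
    WellTyped none (.start D.mem) C

/-- The backward function of one reduction. -/
def backward (ev : Option Event) (q : Finset ℕ × Finset Key) : Finset ℕ × Finset Key :=
  match ev with
  | some (i, k, L') =>
    if i ≠ 0 ∧ Key.hon k ∈ q.2 then (insert i q.1, L' ∪ q.2.erase (.hon k)) else q
  | none => q

/-- `(I₀, L₀)`, computed backwards along a sequence of reductions from `(∅, L)`. -/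
def traceBack (evs : List (Option Event)) (L : Finset Key) : Finset ℕ × Finset Key :=
  evs.foldr backward (∅, L)

/-- The device `i ≥ 1` of the initial system `P` owns the principal of the key `k`. -/
def Owns (P : System) (i : ℕ) (k : Key) : Prop :=
  1 ≤ i ∧ ∃ D, P.devs i = some D ∧ ∃ l, D.mem.prin l = some (k, ∅)

/-- The identifiers of the devices allowed by `L`, for the given reductions from `P`. -/
def devicesFrom (P : System) (evs : List (Option Event)) (L : Finset Key) : Set ℕ :=
  {i | i ∈ (traceBack evs L).1 ∨ ∃ k ∈ (traceBack evs L).2, Owns P i k}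

/-- The set of allowed devices is safe: every remaining key is owned initially by one of them. -/
def SafeDevices (P : System) (evs : List (Option Event)) (L : Finset Key) : Prop :=
  ∀ k ∈ (traceBack evs L).2, ∃ i, Owns P i k

/-! ## Open systems -/

/-- Variables of the attacker's knowledge: locations of the devices which belong to the attacker
(tagged with the device, so that there are no name conflicts) and received values. -/
inductive AttVar where
  | ofVar (i y : ℕ)
  | ofPrin (i l : ℕ)
  | ofKey (i l : ℕ)
  | recv (n : ℕ)
  deriving DecidableEq

abbrev Knowledge := AttVar → Option Term

/-- The union of the memories of the devices of `P` whose identifiers are not in `I`. -/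
noncomputable def System.knowledge (P : System) (I : Set ℕ) : Knowledge :=
  open Classical in fun
  | .ofVar i y => if i ∈ I then none else (P.devs i).bind fun D => (D.mem.var y).map .val
  | .ofPrin i l => if i ∈ I then none else
      (P.devs i).bind fun D => (D.mem.prin l).map fun q => .prin q.1 q.2
  | .ofKey i l => if i ∈ I then none else
      (P.devs i).bind fun D => (D.mem.key l).map fun k => .val (.pub k)
  | .recv _ => none

/-- An established channel is kept if both its ends are in `I`; otherwise it becomes an
attacker channel, by a fixed injection. -/
noncomputable def Chan.restrict (I : Set ℕ) : Chan → Chan :=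
  open Classical in fun
  | .est id i j =>
      if i ∈ I ∧ j ∈ I then .est id i j else .att (Nat.pair id (Nat.pair i j))
  | .att a => .att a

/-- Replacement of channels in a thread. -/
noncomputable def Thread.restrict (I : Set ℕ) : Thread → Thread
  | .run σ C => .run { σ with chan := fun c => (σ.chan c).map (Chan.restrict I) } C
  | .set y v => .set y v

/-- The subsystem of the devices whose identifiers are in `I`. -/
noncomputable def System.sub (P : System) (I : Set ℕ) : System :=
  open Classical in
  { used := P.used
    chans := P.chans.filter fun q => q.2.1 ∈ I ∧ q.2.2 ∈ I
    devs := fun i => if i ∈ I then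
      (P.devs i).map fun D => ⟨D.mem, D.threads.map (Thread.restrict I)⟩ else none }

/-- `P_{i:y=v}`: the thread `y := v` is added to the device `i`. -/
def System.reassign (P : System) (i y : ℕ) (v : Val) : System :=
  { P with
    devs := Function.update P.devs i
              ((P.devs i).map fun D => ⟨D.mem, .set y v ::ₘ D.threads⟩) }

/-- Open systems `K ⊨ P`. -/
structure OpenSystem where
  know : Knowledge
  sys : System

/-- Labels. `openPub r a S` and `openPriv r a S f g h h'` establish the attacker channel `a` with a
device in the role `r`, for which the attacker provides the types: `f` is a secret key for
the key that the device wants to connect to, `g` the public key under which the device acts, and `h`,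
`h'` the rights of the channel (`none` for `⊥`). `input a f` sends the value of `f` to a device,
`output a m` receives a value from a device into the variable `m`. -/
inductive Label where
  | openPub (r : Role) (a : ℕ) (S : Ty)
  | openPriv (r : Role) (a : ℕ) (S : Ty) (f g : AExpr AttVar) (h h' : Option (AExpr AttVar))
  | input (a : ℕ) (f : AExpr AttVar)
  | output (a : ℕ) (m : AttVar)

/-- The attacker provides the rights `r`. -/
def ProvidesRights (K : Knowledge) : Option (AExpr AttVar) → Option (Finset Key) → Prop
  | none, none => True
  | some h, some L => (h.eval K).bind Term.keys? = some L
  | _, _ => False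

/-- Internal reductions of an open system. -/
def OpenSystem.Internal (X Y : OpenSystem) : Prop :=
  Y.know = X.know ∧ ∃ ev, Step X.sys ev Y.sys

/-- Labelled reductions of an open system. -/
inductive LabStep : OpenSystem → Label → OpenSystem → Prop
  | openPub {K} {P : System} {i M T σ r c S C a} :
      P.devs i = some ⟨M, .run σ (.openPub r c S C) ::ₘ T⟩ →
      LabStep ⟨K, P⟩ (.openPub r a S)
        ⟨K, P.setDev i ⟨M, .run (σ.setChan c (.att a)) C ::ₘ T⟩⟩
  | openPriv {K} {P : System} {i M T σ r c S R₁ R₂ k p C a f g h h' key key' L r₁ r₂} :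
      P.devs i = some ⟨M, .run σ (.openPriv r c S R₁ R₂ k p C) ::ₘ T⟩ →
      σ.keyVal M k = some key → f.eval K = some (.sec key) →
      σ.prinVal M p = some (key', L) → g.eval K = some (.val (.pub key')) →
      evalRights σ M R₁ = some r₁ → ProvidesRights K h r₁ →
      evalRights σ M R₂ = some r₂ → ProvidesRights K h' r₂ →
      LabStep ⟨K, P⟩ (.openPriv r a S f g h h')
        ⟨K, P.setDev i ⟨M, .run (σ.setChan c (.att a)) C ::ₘ T⟩⟩
  | input {K} {P : System} {i M T σ c x C a f v y} :
      P.devs i = some ⟨M, .run σ (.input c x C) ::ₘ T⟩ →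
      σ.chan c = some (.att a) → f.eval K = some (.val v) → M.var y = none →
      LabStep ⟨K, P⟩ (.input a f)
        ⟨K, P.setDev i ⟨M.setVar y v, .run (σ.setVar x y) C ::ₘ T⟩⟩
  | output {K} {P : System} {i M T σ e c C a v U' m} :
      P.devs i = some ⟨M, .run σ (.output e c C) ::ₘ T⟩ →
      σ.chan c = some (.att a) → Eval σ M P.used.nonces e v U' → K m = none →
      LabStep ⟨K, P⟩ (.output a m)
        ⟨Function.update K m (some (.val v)),
          ({ P with used := { P.used with nonces := U' } } : System).setDev i
            ⟨M, .run σ C ::ₘ T⟩⟩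

/-- `X →* Y`. -/
def OpenSystem.Internals : OpenSystem → OpenSystem → Prop :=
  Relation.ReflTransGen OpenSystem.Internal

/-- `X ⇒l Y`. -/
def OpenSystem.Weak (X : OpenSystem) (l : Label) (Y : OpenSystem) : Prop :=
  ∃ X' Y', X.Internals X' ∧ LabStep X' l Y' ∧ Y'.Internals Y

/-- Static equivalence: the same variables, and no equality test of two extended expressions tells
the two apart. -/
def StaticEquiv (K₁ K₂ : Knowledge) : Prop :=
  (∀ m, (K₁ m).isSome ↔ (K₂ m).isSome) ∧
    ∀ f g : AExpr AttVar, f.eval K₁ = g.eval K₁ ↔ f.eval K₂ = g.eval K₂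

/-- The conditions on a labelled bisimulation. -/
structure IsBisimulation (R : OpenSystem → OpenSystem → Prop) : Prop where
  symm : ∀ X Y, R X Y → R Y X
  static : ∀ X Y, R X Y → StaticEquiv X.know Y.know
  internal : ∀ X Y X', R X Y → X.Internal X' → ∃ Y', Y.Internals Y' ∧ R X' Y'
  labelled : ∀ X Y l X', R X Y → LabStep X l X' → ∃ Y', Y.Weak l Y' ∧ R X' Y'

/-- Labelled bisimilarity, the largest labelled bisimulation. -/
def Bisimilar (X Y : OpenSystem) : Prop :=
  ∃ R, IsBisimulation R ∧ R X Y

end CloudTypes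

/-!
Let `W` be the set of the keys that can give access to data with the rights `L`: the keys of `L`, and
with the key of a principal that is created along the trace also the keys in the rights of that
principal. The computation of `dev(L, T)` follows the same dependencies backwards. Hence, if the set
of allowed devices is safe, all principals with a key in `W` belong to allowed devices, and no key of
`W` is a key of the attacker (`Trace.exists_keys`, `ValidInitial.exists_keys`). Rights are called
confidential if all their keys are in `W`; otherwise they are low.

Two values are indistinguishable (`Rel`) if they differ only in the contents of ciphers for
confidential rights. The ciphers made by devices carry random seeds, so the two sides need not use
the same ones: a partial bijection (`Pairing`) says which cipher of one side corresponds to which one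
of the other, and it also makes indistinguishability respect equality. All operations on values
respect the relation, as none of them uses a secret key of `W` on the side of the attacker
(`AExpr.eval_rel`); static equivalence follows (`staticEquiv_of_rel`).

The type system ensures that a thread whose `pc` is confidential writes to confidential variables only
(`LStep.tOk`), that it can neither open public channels nor create principals, and that all evaluations
and blocks of typable code can be carried out (`ActStep.progress`, `SOk.completes`). So two systems may
be regarded as equal if they agree but for the values of confidential variables and for any threads that
are confidential. This is the relation `Bisim`. A thread that is not confidential
reduces on both sides in the same way (`LStep.sim`), until it branches on confidential data or opens a
confidential channel; from then on it is itself confidential and needs no counterpart. The one case in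
which such a thread must not be forgotten is a `synchronised` block of which only a part has become
confidential, since the low code after the block waits for it; but that part can always be run to its
end on the other side (`SRel.complete`). The attacker cannot take part in a confidential secure channel,
because it would need a secret key of `W`. Therefore `Bisim W` is a labelled bisimulation
(`isBisimulation_bisim`).

It remains to see that the two systems of the theorem are related. Invariants of the trace (`SysOk`,
`SysOk.trace`) say that honest devices stay typable, that principals with a key in `W` occur, outside
ciphers for keys of `W`, only in the memories of allowed devices, and that channels for confidential
data connect allowed devices. The last two imply that the knowledge of the attacker is safe and that the
channels which the restriction to the allowed devices hands over to the attacker are low. As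
`L ⊆ W`, the declared variable is confidential (`SysOk.declare`), and the additional thread `y := v` is
one of the confidential threads without counterpart (`SysOk.bisim`).
-/

namespace CloudTypes

/-! ### Values that an observer without the keys of `W` cannot tell apart -/

/-- `Rel W Φ v w`: the values `v` and `w` look the same without the secret keys of `W`. Ciphers made
by devices are related by `Φ`, which need not say anything about the contents of a cipher for keys
of `W`; ciphers made by the attacker are related structurally. A principal with a key in `W` occurs
only in ciphers for keys of `W`. -/
inductive Rel (W : Finset Key) (Φ : Val → Val → Prop) : Val → Val → Prop
  | int (i) : Rel W Φ (.int i) (.int i)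
  | pub (k) : Rel W Φ (.pub k) (.pub k)
  | nav : Rel W Φ .nav .nav
  | enc {v w s L} : Rel W Φ v w → Rel W Φ (.enc v (.att s) L) (.enc w (.att s) L)
  | encPrin {k L s L'} : (k ∈ W → L' ⊆ W) →
      Rel W Φ (.encPrin k L (.att s) L') (.encPrin k L (.att s) L')
  | cipher {c d} : Φ c d → Rel W Φ c d
  | nil : Rel W Φ (.arr []) (.arr [])
  | cons {v w l m} : Rel W Φ v w → Rel W Φ (.arr l) (.arr m) → Rel W Φ (.arr (v :: l)) (.arr (w :: m))

/-- Two ciphers made by devices, with seeds in `U` and `U'`, that may be taken to correspond to each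
other. -/
def CipherPair (W : Finset Key) (U U' : Finset ℕ) (Φ : Val → Val → Prop) (c d : Val) : Prop :=
  (∃ v w n n' L, c = .enc v (.hon n) L ∧ d = .enc w (.hon n') L ∧ n ∈ U ∧ n' ∈ U' ∧
    (L ⊆ W ∨ Rel W Φ v w)) ∨
  ∃ k L n n' L', c = .encPrin k L (.hon n) L' ∧ d = .encPrin k L (.hon n') L' ∧ n ∈ U ∧ n' ∈ U' ∧
    (k ∈ W → L' ⊆ W)

/-- `Φ` is a partial bijection between ciphers with seeds in `U` and in `U'`. -/
structure Pairing (W : Finset Key) (U U' : Finset ℕ) (Φ : Val → Val → Prop) : Prop where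
  shape : ∀ c d, Φ c d → CipherPair W U U' Φ c d
  inj : ∀ c d c' d', Φ c d → Φ c' d' → (c = c' ↔ d = d')

/-- Related terms; secrets that are not wrapped in a cipher do not belong to the keys of `W`. -/
inductive TRel (W : Finset Key) (Φ : Val → Val → Prop) : Term → Term → Prop
  | val {v w} : Rel W Φ v w → TRel W Φ (.val v) (.val w)
  | prin {k L} : k ∉ W → TRel W Φ (.prin k L) (.prin k L)
  | sec {k} : k ∉ W → TRel W Φ (.sec k) (.sec k)

variable {W : Finset Key} {Φ Ψ : Val → Val → Prop} {U U' V V' : Finset ℕ}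

theorem Rel.mono (h : ∀ c d, Φ c d → Ψ c d) {v w} (hv : Rel W Φ v w) : Rel W Ψ v w := by
  induction hv with
  | int i => exact .int i
  | pub k => exact .pub k
  | nav => exact .nav
  | enc _ ih => exact .enc ih
  | encPrin h => exact .encPrin h
  | cipher hc => exact .cipher (h _ _ hc)
  | nil => exact .nil
  | cons _ _ ih ih' => exact .cons ih ih'

theorem Rel.flip {v w} (hv : Rel W Φ v w) : Rel W (fun c d => Φ d c) w v := by
  induction hv with
  | int i => exact .int i
  | pub k => exact .pub k
  | nav => exact .nav
  | enc _ ih => exact .enc ih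
  | encPrin h => exact .encPrin h
  | cipher hc => exact .cipher hc
  | nil => exact .nil
  | cons _ _ ih ih' => exact .cons ih ih'

theorem TRel.mono (h : ∀ c d, Φ c d → Ψ c d) {s t} (hv : TRel W Φ s t) : TRel W Ψ s t := by
  cases hv with
  | val hv => exact .val (hv.mono h)
  | prin hk => exact .prin hk
  | sec hk => exact .sec hk

theorem TRel.flip {s t} (hv : TRel W Φ s t) : TRel W (fun c d => Φ d c) t s := by
  cases hv with
  | val hv => exact .val hv.flip
  | prin hk => exact .prin hk
  | sec hk => exact .sec hk

theorem CipherPair.mono (h : ∀ c d, Φ c d → Ψ c d) (hU : U ⊆ V) (hU' : U' ⊆ V') {c d}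
    (hc : CipherPair W U U' Φ c d) : CipherPair W V V' Ψ c d := by
  rcases hc with ⟨v, w, n, n', L, h1, h2, h3, h4, h5⟩ | ⟨k, L, n, n', L', h1, h2, h3, h4, h5⟩
  · exact .inl ⟨v, w, n, n', L, h1, h2, hU h3, hU' h4, h5.imp_right (Rel.mono h)⟩
  · exact .inr ⟨k, L, n, n', L', h1, h2, hU h3, hU' h4, h5⟩

theorem Pairing.flip (h : Pairing W U U' Φ) : Pairing W U' U (fun c d => Φ d c) where
  shape c d hc := by
    rcases h.shape _ _ hc with ⟨v, w, n, n', L, h1, h2, h3, h4, h5⟩ |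
      ⟨k, L, n, n', L', h1, h2, h3, h4, h5⟩
    · exact .inl ⟨w, v, n', n, L, h2, h1, h4, h3, h5.imp_right Rel.flip⟩
    · exact .inr ⟨k, L, n', n, L', h2, h1, h4, h3, h5⟩
  inj c d c' d' h1 h2 := (h.inj _ _ _ _ h1 h2).symm

theorem Pairing.mono (h : Pairing W U U' Φ) (hU : U ⊆ V) (hU' : U' ⊆ V') : Pairing W V V' Φ :=
  ⟨fun c d hc => (h.shape c d hc).mono (fun _ _ h => h) hU hU', h.inj⟩

/-- Two fresh ciphers may be made to correspond to each other. -/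
theorem Pairing.insert (h : Pairing W U U' Φ) {n n' c d} (hn : n ∉ U) (hn' : n' ∉ U')
    (hc : (∃ v w L, c = .enc v (.hon n) L ∧ d = .enc w (.hon n') L ∧ (L ⊆ W ∨ Rel W Φ v w)) ∨
      ∃ k L L', c = .encPrin k L (.hon n) L' ∧ d = .encPrin k L (.hon n') L' ∧ (k ∈ W → L' ⊆ W)) :
    Pairing W (insert n U) (insert n' U') (fun a b => Φ a b ∨ a = c ∧ b = d) := by
  have key : ∀ a b, Φ a b → a ≠ c ∧ b ≠ d := by
    intro a b hab
    rcases h.shape _ _ hab with ⟨v, w, m, m', L, rfl, rfl, h3, h4, h5⟩ |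
      ⟨k, L, m, m', L', rfl, rfl, h3, h4, h5⟩ <;>
    rcases hc with ⟨v, w, L, rfl, rfl, -⟩ | ⟨k, L, L', rfl, rfl, -⟩ <;>
    constructor <;> simp only [ne_eq, Val.enc.injEq, Val.encPrin.injEq, Nonce.hon.injEq, reduceCtorEq,
      not_false_eq_true] <;> rintro ⟨-, h⟩ <;> simp_all
  constructor
  · rintro a b (hab | ⟨rfl, rfl⟩)
    · exact (h.shape a b hab).mono (fun _ _ => .inl) (Finset.subset_insert _ _)
        (Finset.subset_insert _ _)
    · rcases hc with ⟨v, w, L, h1, h2, h3⟩ | ⟨k, L, L', h1, h2, h3⟩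
      · exact .inl ⟨v, w, n, n', L, h1, h2, by simp, by simp, h3.imp_right (Rel.mono fun _ _ => .inl)⟩
      · exact .inr ⟨k, L, n, n', L', h1, h2, by simp, by simp, h3⟩
  · rintro a b a' b' (h1 | ⟨rfl, rfl⟩) (h2 | ⟨rfl, rfl⟩)
    · exact h.inj _ _ _ _ h1 h2
    · have := key _ _ h1; simp [this.1, this.2]
    · have := key _ _ h2; simp [this.1.symm, this.2.symm]
    · simp

/-- The possible shapes of related values. -/
theorem Rel.elim (hΦ : Pairing W U U' Φ) {a b} (h : Rel W Φ a b) :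
    (∃ i, a = .int i ∧ b = .int i) ∨ (∃ k, a = .pub k ∧ b = .pub k) ∨ (a = .nav ∧ b = .nav) ∨
    (∃ v w n n' L, a = .enc v n L ∧ b = .enc w n' L ∧ (L ⊆ W ∨ Rel W Φ v w)) ∨
    (∃ k L n n' L', a = .encPrin k L n L' ∧ b = .encPrin k L n' L' ∧ (k ∈ W → L' ⊆ W)) ∨
    ∃ l m, a = .arr l ∧ b = .arr m ∧ List.Forall₂ (Rel W Φ) l m := by
  generalize ha : a = a' at h
  generalize hb : b = b' at h
  induction h generalizing a b with
  | int i => simp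
  | pub k => simp
  | nav => simp
  | enc h => exact .inr <| .inr <| .inr <| .inl ⟨_, _, _, _, _, rfl, rfl, .inr h⟩
  | encPrin h => exact .inr <| .inr <| .inr <| .inr <| .inl ⟨_, _, _, _, _, rfl, rfl, h⟩
  | cipher hc =>
    rcases hΦ.shape _ _ hc with ⟨v, w, n, n', L, h1, h2, h3, h4, h5⟩ |
      ⟨k, L, n, n', L', h1, h2, h3, h4, h5⟩
    · exact .inr <| .inr <| .inr <| .inl ⟨v, w, _, _, L, h1, h2, h5⟩
    · exact .inr <| .inr <| .inr <| .inr <| .inl ⟨k, L, _, _, L', h1, h2, h5⟩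
  | nil => exact .inr <| .inr <| .inr <| .inr <| .inr ⟨[], [], rfl, rfl, .nil⟩
  | cons hv _ _ ih =>
    have := ih rfl rfl
    simp only [reduceCtorEq, false_and, exists_false, false_or, Val.arr.injEq] at this
    obtain ⟨l, m, rfl, rfl, hl⟩ := this
    exact .inr <| .inr <| .inr <| .inr <| .inr ⟨_, _, rfl, rfl, .cons hv hl⟩

theorem Rel.arr {l m} (h : List.Forall₂ (Rel W Φ) l m) : Rel W Φ (.arr l) (.arr m) := by
  induction h with
  | nil => exact .nil
  | cons h _ ih => exact .cons h ih

theorem Rel.of_pub (hΦ : Pairing W U U' Φ) {k b} (h : Rel W Φ (.pub k) b) : b = .pub k := by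
  rcases h.elim hΦ with h | h | h | h | h | h <;> simp_all

theorem Rel.of_enc (hΦ : Pairing W U U' Φ) {v n L b} (h : Rel W Φ (.enc v n L) b) :
    ∃ w n', b = .enc w n' L ∧ (L ⊆ W ∨ Rel W Φ v w) := by
  rcases h.elim hΦ with h | h | h | h | h | h <;> simp_all

theorem Rel.of_encPrin (hΦ : Pairing W U U' Φ) {k L n L' b} (h : Rel W Φ (.encPrin k L n L') b) :
    ∃ n', b = .encPrin k L n' L' ∧ (k ∈ W → L' ⊆ W) := by
  rcases h.elim hΦ with h | h | h | h | h | h <;> simp_all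

/-- The partial bijection makes the second of two related values a function of the first. -/
theorem Rel.unique (hΦ : Pairing W U U' Φ) {a b d} (h : Rel W Φ a b) (h' : Rel W Φ a d) : b = d := by
  induction h generalizing d with
  | int i => rcases h'.elim hΦ with h | h | h | h | h | h <;> simp_all
  | pub i => rcases h'.elim hΦ with h | h | h | h | h | h <;> simp_all
  | nav => rcases h'.elim hΦ with h | h | h | h | h | h <;> simp_all
  | enc h ih =>
    cases h' with
    | enc h' => rw [ih h']
    | cipher hc => rcases hΦ.shape _ _ hc with ⟨_, _, _, _, _, h1, _⟩ | ⟨_, _, _, _, _, h1, _⟩ <;> simp at h1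
  | encPrin h =>
    cases h' with
    | encPrin h' => rfl
    | cipher hc => rcases hΦ.shape _ _ hc with ⟨_, _, _, _, _, h1, _⟩ | ⟨_, _, _, _, _, h1, _⟩ <;> simp at h1
  | cipher hc =>
    cases h' with
    | cipher hc' => exact (hΦ.inj _ _ _ _ hc hc').1 rfl
    | _ => rcases hΦ.shape _ _ hc with ⟨_, _, _, _, _, h1, _⟩ | ⟨_, _, _, _, _, h1, _⟩ <;> simp at h1
  | nil =>
    cases h' with
    | nil => rfl
    | cipher hc => rcases hΦ.shape _ _ hc with ⟨_, _, _, _, _, h1, _⟩ | ⟨_, _, _, _, _, h1, _⟩ <;> simp at h1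
  | cons _ _ ih1 ih2 =>
    cases h' with
    | cons h1 h2 => rw [ih1 h1, Val.arr.inj (ih2 h2)]
    | cipher hc => rcases hΦ.shape _ _ hc with ⟨_, _, _, _, _, h1, _⟩ | ⟨_, _, _, _, _, h1, _⟩ <;> simp at h1

theorem Rel.eq_iff (hΦ : Pairing W U U' Φ) {a b c d} (h : Rel W Φ a b) (h' : Rel W Φ c d) :
    a = c ↔ b = d :=
  ⟨fun e => by subst e; exact h.unique hΦ h', fun e => by subst e; exact h.flip.unique hΦ.flip h'.flip⟩

theorem TRel.eq_iff (hΦ : Pairing W U U' Φ) {a b c d} (h : TRel W Φ a b) (h' : TRel W Φ c d) :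
    a = c ↔ b = d := by
  cases h <;> cases h' <;> simp
  exact Rel.eq_iff hΦ ‹_› ‹_›

/-! ### Computations respect indistinguishability -/

theorem Rel.binop (hΦ : Pairing W U U' Φ) (o) {a b c d} (h : Rel W Φ a b) (h' : Rel W Φ c d) :
    Rel W Φ (a.binop o c) (b.binop o d) := by
  rcases h.elim hΦ with ⟨i, rfl, rfl⟩ | ⟨_, rfl, rfl⟩ | ⟨rfl, rfl⟩ | ⟨_, _, _, _, _, rfl, rfl, _⟩ |
    ⟨_, _, _, _, _, rfl, rfl, _⟩ | ⟨_, _, rfl, rfl, _⟩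
  · rcases h'.elim hΦ with ⟨j, rfl, rfl⟩ | ⟨_, rfl, rfl⟩ | ⟨rfl, rfl⟩ | ⟨_, _, _, _, _, rfl, rfl, _⟩ |
      ⟨_, _, _, _, _, rfl, rfl, _⟩ | ⟨_, _, rfl, rfl, _⟩ <;> simp only [Val.binop] <;> try exact .nav
    cases o i j with
    | none => exact .nav
    | some c => exact .int c
  all_goals exact .nav

theorem Rel.getD (l m : List Val) (h : List.Forall₂ (Rel W Φ) l m) (n : ℕ) :
    Rel W Φ ((l[n]?).getD .nav) ((m[n]?).getD .nav) := by
  induction h generalizing n with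
  | nil => simpa using .nav
  | cons h _ ih =>
    cases n with
    | zero => simpa using h
    | succ n => simpa using ih n

theorem Rel.index (hΦ : Pairing W U U' Φ) {a b c d} (h : Rel W Φ a b) (h' : Rel W Φ c d) :
    Rel W Φ (a.index c) (b.index d) := by
  rcases h.elim hΦ with ⟨i, rfl, rfl⟩ | ⟨_, rfl, rfl⟩ | ⟨rfl, rfl⟩ | ⟨_, _, _, _, _, rfl, rfl, _⟩ |
    ⟨_, _, _, _, _, rfl, rfl, _⟩ | ⟨l, m, rfl, rfl, hl⟩
  case inr.inr.inr.inr.inr =>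
    rcases h'.elim hΦ with ⟨j, rfl, rfl⟩ | ⟨_, rfl, rfl⟩ | ⟨rfl, rfl⟩ | ⟨_, _, _, _, _, rfl, rfl, _⟩ |
      ⟨_, _, _, _, _, rfl, rfl, _⟩ | ⟨_, _, rfl, rfl, _⟩ <;> simp only [Val.index] <;> try exact .nav
    split_ifs
    · exact Rel.getD l m hl _
    · exact .nav
  all_goals exact .nav

theorem forall₂_set {α β : Type*} {R : α → β → Prop} {l : List α} {m : List β}
    (h : List.Forall₂ R l m) {a b} (hab : R a b) (n : ℕ) : List.Forall₂ R (l.set n a) (m.set n b) := by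
  induction h generalizing n with
  | nil => exact .nil
  | cons h hl ih =>
    cases n with
    | zero => exact .cons hab hl
    | succ n => exact .cons h (ih n)

theorem Rel.setIndex (hΦ : Pairing W U U' Φ) {a b c d v w} (h : Rel W Φ a b) (h' : Rel W Φ c d)
    (hv : Rel W Φ v w) : Rel W Φ (a.setIndex c v) (b.setIndex d w) := by
  rcases h.elim hΦ with ⟨i, rfl, rfl⟩ | ⟨_, rfl, rfl⟩ | ⟨rfl, rfl⟩ | ⟨_, _, _, _, _, rfl, rfl, _⟩ |
    ⟨_, _, _, _, _, rfl, rfl, _⟩ | ⟨l, m, rfl, rfl, hl⟩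
  case inr.inr.inr.inr.inr =>
    rcases h'.elim hΦ with ⟨j, rfl, rfl⟩ | ⟨_, rfl, rfl⟩ | ⟨rfl, rfl⟩ | ⟨_, _, _, _, _, rfl, rfl, _⟩ |
      ⟨_, _, _, _, _, rfl, rfl, _⟩ | ⟨_, _, rfl, rfl, _⟩ <;> simp only [Val.setIndex] <;> try exact h
    split_ifs
    · exact Rel.arr (forall₂_set hl hv _)
    · exact h
  all_goals exact h

theorem Rel.valCons (hΦ : Pairing W U U' Φ) {a b c d} (h : Rel W Φ a b) (h' : Rel W Φ c d) :
    Rel W Φ (a.cons c) (b.cons d) := by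
  rcases h'.elim hΦ with ⟨j, rfl, rfl⟩ | ⟨_, rfl, rfl⟩ | ⟨rfl, rfl⟩ | ⟨_, _, _, _, _, rfl, rfl, _⟩ |
    ⟨_, _, _, _, _, rfl, rfl, _⟩ | ⟨_, _, rfl, rfl, hl⟩
  case inr.inr.inr.inr.inr => exact .cons h h'
  all_goals exact .nav

theorem Rel.key? (hΦ : Pairing W U U' Φ) {a b} (h : Rel W Φ a b) : a.key? = b.key? := by
  rcases h.elim hΦ with ⟨i, rfl, rfl⟩ | ⟨_, rfl, rfl⟩ | ⟨rfl, rfl⟩ | ⟨_, _, _, _, _, rfl, rfl, _⟩ |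
    ⟨_, _, _, _, _, rfl, rfl, _⟩ | ⟨l, m, rfl, rfl, hl⟩ <;> rfl

theorem TRel.keys? (hΦ : Pairing W U U' Φ) {s t} (h : TRel W Φ s t) : s.keys? = t.keys? := by
  cases h with
  | val h =>
    rcases h.elim hΦ with ⟨i, rfl, rfl⟩ | ⟨_, rfl, rfl⟩ | ⟨rfl, rfl⟩ | ⟨_, _, _, _, _, rfl, rfl, _⟩ |
      ⟨_, _, _, _, _, rfl, rfl, _⟩ | ⟨l, m, rfl, rfl, hl⟩ <;> try rfl
    have : l.mapM Val.key? = m.mapM Val.key? := by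
      clear h
      induction hl with
      | nil => rfl
      | cons h hl ih => rw [List.mapM_cons, List.mapM_cons, h.key? hΦ, ih]
    simp only [Term.keys?, Val.keys?, this]
  | prin => rfl
  | sec => rfl

theorem TRel.encr (hΦ : Pairing W U U' Φ) {s t r r'} (h : TRel W Φ s t) (hr : TRel W Φ r r') (n) :
    TRel W Φ (.encr s r n) (.encr t r' n) := by
  unfold Term.encr
  rw [hr.keys? hΦ]
  cases h <;> cases r'.keys? <;> simp only
  · exact .val .nav
  · exact .val (.enc ‹_›)
  · exact .val .nav
  · exact .val (.encPrin fun h => absurd h ‹_›)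
  · exact .val .nav
  · exact .val .nav

/-- The key used for decryption is not in `W`, hence neither are all keys of a cipher that it opens, and
the contents are related. -/
theorem TRel.decr (hΦ : Pairing W U U' Φ) {s t r r'} (h : TRel W Φ s t) (hr : TRel W Φ r r') :
    TRel W Φ (.decr s r) (.decr t r') := by
  cases h with
  | val h =>
    rcases h.elim hΦ with ⟨i, rfl, rfl⟩ | ⟨_, rfl, rfl⟩ | ⟨rfl, rfl⟩ | ⟨_, _, _, _, _, rfl, rfl, _⟩ |
      ⟨_, _, _, _, _, rfl, rfl, _⟩ | ⟨l, m, rfl, rfl, hl⟩ <;>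
    cases hr <;> simp only [Term.decr] <;> try exact .val .nav
    · split_ifs
      · rename_i hW _ hk hkL
        exact .val (hW.resolve_left fun hs => hk (hs hkL))
      · exact .val .nav
    · split_ifs
      · rename_i hW _ hk hkL
        exact .prin fun hs => hk (hW hs hkL)
      · exact .val .nav
  | prin => cases hr <;> exact .val .nav
  | sec => cases hr <;> exact .val .nav

theorem TRel.alter (hΦ : Pairing W U U' Φ) {s t r r'} (h : TRel W Φ s t) (hr : TRel W Φ r r') :
    TRel W Φ (.alter s r) (.alter t r') := by
  unfold Term.alter
  rw [hr.keys? hΦ]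
  cases h <;> cases r'.keys? <;> simp only
  case prin.some h _ => exact .prin h
  all_goals exact .val .nav

theorem TRel.freshprin (hW : ∀ j, Key.att j ∉ W) (hΦ : Pairing W U U' Φ) {s t} (h : TRel W Φ s t) :
    TRel W Φ (.freshprin s) (.freshprin t) := by
  cases h with
  | val h =>
    rcases h.elim hΦ with ⟨i, rfl, rfl⟩ | ⟨_, rfl, rfl⟩ | ⟨rfl, rfl⟩ | ⟨_, _, _, _, _, rfl, rfl, _⟩ |
      ⟨_, _, _, _, _, rfl, rfl, _⟩ | ⟨l, m, rfl, rfl, hl⟩ <;> simp only [Term.freshprin] <;>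
      try exact .val .nav
    split_ifs
    · exact .prin (hW _)
    · exact .val .nav
  | prin => exact .val .nav
  | sec => exact .val .nav

theorem TRel.lift₂ {h : Val → Val → Val}
    (hh : ∀ a b c d, Rel W Φ a b → Rel W Φ c d → Rel W Φ (h a c) (h b d)) {s t r r'}
    (hs : TRel W Φ s t) (hr : TRel W Φ r r') : TRel W Φ (.lift₂ h s r) (.lift₂ h t r') := by
  cases hs <;> cases hr <;> simp only [Term.lift₂] <;> try exact .val .nav
  exact .val (hh _ _ _ _ ‹_› ‹_›)

theorem TRel.toVal {s t} (h : TRel W Φ s t) : Rel W Φ s.toVal t.toVal := by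
  cases h with
  | val h => exact h
  | prin => exact .nav
  | sec => exact .nav

theorem optionRel_bind_map {α : Type*} {R : α → α → Prop} {a b c d : Option α} {f : α → α → α}
    (h : Option.Rel R a b) (h' : Option.Rel R c d)
    (hf : ∀ a b c d, R a b → R c d → R (f a c) (f b d)) :
    Option.Rel R (a.bind fun s => c.map (f s)) (b.bind fun s => d.map (f s)) := by
  cases h <;> cases h' <;> constructor
  exact hf _ _ _ _ ‹_› ‹_›

theorem optionRel_map {α : Type*} {R : α → α → Prop} {a b : Option α} {f : α → α}
    (h : Option.Rel R a b) (hf : ∀ a b, R a b → R (f a) (f b)) :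
    Option.Rel R (a.map f) (b.map f) := by
  cases h <;> constructor
  exact hf _ _ ‹_›

/-- What the attacker computes from indistinguishable knowledge is indistinguishable. In particular,
it never obtains a secret key of `W`. -/
theorem AExpr.eval_rel (hW : ∀ j, Key.att j ∉ W) (hΦ : Pairing W U U' Φ) {X : Type}
    {K K' : X → Option Term} (hK : ∀ m, Option.Rel (TRel W Φ) (K m) (K' m)) (f : AExpr X) :
    Option.Rel (TRel W Φ) (f.eval K) (f.eval K') := by
  induction f with
  | var m => exact hK m
  | int i => exact .some (.val (.int i))
  | op o f g hf hg =>
    exact optionRel_bind_map hf hg fun _ _ _ _ => TRel.lift₂ fun _ _ _ _ => Rel.binop hΦ o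
  | encr f r n hf hr => exact optionRel_bind_map hf hr fun _ _ _ _ h h' => TRel.encr hΦ h h' n
  | decr f g hf hg => exact optionRel_bind_map hf hg fun _ _ _ _ => TRel.decr hΦ
  | alter f g hf hg => exact optionRel_bind_map hf hg fun _ _ _ _ => TRel.alter hΦ
  | freshprin f hf => exact optionRel_map hf fun _ _ => TRel.freshprin hW hΦ
  | pub f hf =>
    refine optionRel_map hf fun _ _ h => ?_
    cases h <;> first | exact .val (.pub _) | exact .val .nav
  | sec f hf =>
    refine optionRel_map hf fun _ _ h => ?_
    cases h <;> first | exact .sec ‹_› | exact .val .nav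
  | rights f hf =>
    refine optionRel_map hf fun _ _ h => ?_
    cases h with
    | prin _ =>
      refine .val (Rel.arr ?_)
      rw [List.forall₂_same]
      intro v hv
      obtain ⟨k, -, rfl⟩ := List.mem_map.1 hv
      exact .pub k
    | _ => exact .val .nav
  | nil => exact .some (.val .nil)
  | cons f g hf hg =>
    exact optionRel_bind_map hf hg fun _ _ _ _ => TRel.lift₂ fun _ _ _ _ => Rel.valCons hΦ
  | elem f g hf hg =>
    exact optionRel_bind_map hf hg fun _ _ _ _ => TRel.lift₂ fun _ _ _ _ => Rel.index hΦ

theorem staticEquiv_of_rel (hW : ∀ j, Key.att j ∉ W) (hΦ : Pairing W U U' Φ) {K K' : Knowledge}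
    (hK : ∀ m, Option.Rel (TRel W Φ) (K m) (K' m)) : StaticEquiv K K' := by
  refine ⟨fun m => ?_, fun f g => ?_⟩
  · have := hK m
    generalize K m = a at this
    generalize K' m = b at this
    cases this <;> simp
  · have h1 := AExpr.eval_rel hW hΦ hK f
    have h2 := AExpr.eval_rel hW hΦ hK g
    generalize f.eval K = a at h1
    generalize f.eval K' = b at h1
    generalize g.eval K = c at h2
    generalize g.eval K' = d at h2
    cases h1 <;> cases h2 <;> simp
    exact TRel.eq_iff hΦ ‹_› ‹_›

/-! ### Safe values -/

/-- `Safe W U v`: the seeds of devices in `v` are in `U`, and principals with keys in `W` occur in `v`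
only in ciphers for keys of `W`. -/
inductive Safe (W : Finset Key) (U : Finset ℕ) : Val → Prop
  | int (i) : Safe W U (.int i)
  | pub (k) : Safe W U (.pub k)
  | nav : Safe W U .nav
  | enc {v n L} : Safe W U v → (∀ m, n = .hon m → m ∈ U) → Safe W U (.enc v n L)
  | encPrin {k L n L'} : (k ∈ W → L' ⊆ W) → (∀ m, n = .hon m → m ∈ U) →
      Safe W U (.encPrin k L n L')
  | nil : Safe W U (.arr [])
  | cons {v l} : Safe W U v → Safe W U (.arr l) → Safe W U (.arr (v :: l))

/-- The identity on the safe ciphers that were made by devices. A safe value is one that is related to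
itself by it, so what is known about `Rel` carries over to `Safe`. -/
def SafeId (W : Finset Key) (U : Finset ℕ) (c d : Val) : Prop :=
  c = d ∧ Safe W U c ∧ ((∃ v n L, c = .enc v (.hon n) L) ∨ ∃ k L n L', c = .encPrin k L (.hon n) L')

theorem Safe.mono (h : U ⊆ V) {v} (hv : Safe W U v) : Safe W V v := by
  induction hv with
  | int i => exact .int i
  | pub k => exact .pub k
  | nav => exact .nav
  | enc _ h1 ih => exact .enc ih fun m hm => h (h1 m hm)
  | encPrin h0 h1 => exact .encPrin h0 fun m hm => h (h1 m hm)
  | nil => exact .nil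
  | cons _ _ ih ih' => exact .cons ih ih'

theorem Safe.rel {v} (hv : Safe W U v) : Rel W (SafeId W U) v v := by
  induction hv with
  | int i => exact .int i
  | pub k => exact .pub k
  | nav => exact .nav
  | @enc v n L h h1 ih =>
    cases n with
    | hon n => exact .cipher ⟨rfl, .enc h h1, .inl ⟨_, _, _, rfl⟩⟩
    | att n => exact .enc ih
  | @encPrin k L n L' h0 h1 =>
    cases n with
    | hon n => exact .cipher ⟨rfl, .encPrin h0 h1, .inr ⟨_, _, _, _, rfl⟩⟩
    | att n => exact .encPrin h0
  | nil => exact .nil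
  | cons _ _ ih ih' => exact .cons ih ih'

theorem Rel.safe {v w} (h : Rel W (SafeId W U) v w) : Safe W U v := by
  induction h with
  | int i => exact .int i
  | pub k => exact .pub k
  | nav => exact .nav
  | enc _ ih => exact .enc ih (by simp)
  | encPrin h => exact .encPrin h (by simp)
  | cipher hc => exact hc.2.1
  | nil => exact .nil
  | cons _ _ ih ih' => exact .cons ih ih'

theorem pairing_safeId (W : Finset Key) (U : Finset ℕ) : Pairing W U U (SafeId W U) where
  shape := by
    rintro c _ ⟨rfl, hs, ⟨v, n, L, rfl⟩ | ⟨k, L, n, L', rfl⟩⟩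
    · cases hs with
      | enc h1 h2 => exact .inl ⟨v, v, n, n, L, rfl, rfl, h2 n rfl, h2 n rfl, .inr h1.rel⟩
    · cases hs with
      | encPrin h1 h2 => exact .inr ⟨k, L, n, n, L', rfl, rfl, h2 n rfl, h2 n rfl, h1⟩
  inj := by
    rintro c _ c' _ ⟨rfl, -⟩ ⟨rfl, -⟩
    rfl

end CloudTypes

namespace CloudTypes

/-! ### Confidential rights -/

variable {W : Finset Key} {Γ : Ctx} {σ σ' : Env} {M M' : Mem}

/-- The rights `R` are not confidential: some key outside `W` may read what they protect. Names
without a value are ignored. -/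
def Low (W : Finset Key) (σ : Env) (M : Mem) : Rights → Prop
  | none => True
  | some RS => ∃ r ∈ RS, ∃ k, r.eval σ M = some k ∧ k ∉ W

/-- The evaluated rights are not confidential. -/
def LowKeys (W : Finset Key) : Option (Finset Key) → Prop
  | none => True
  | some L => ¬ L ⊆ W

theorem Low.mono {R₁ R₂ : Rights} (h : Rights.Sub R₁ R₂) (hl : Low W σ M R₁) : Low W σ M R₂ := by
  cases R₂ with
  | none => trivial
  | some s =>
    obtain ⟨s₁, rfl, hs⟩ := h
    obtain ⟨r, hr, hk⟩ := hl
    exact ⟨r, hs hr, hk⟩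

theorem Low.of_inter {R₁ R₂ : Rights} (h : Low W σ M (R₁.inter R₂)) :
    Low W σ M R₁ ∧ Low W σ M R₂ := by
  cases R₁ <;> cases R₂ <;> simp only [Rights.inter] at h
  · exact ⟨trivial, trivial⟩
  · exact ⟨trivial, h⟩
  · exact ⟨h, trivial⟩
  · obtain ⟨r, hr, hk⟩ := h
    exact ⟨⟨r, (Finset.mem_inter.1 hr).1, hk⟩, ⟨r, (Finset.mem_inter.1 hr).2, hk⟩⟩

theorem Rights.sub_refl (R : Rights) : Rights.Sub R R := by
  cases R with
  | none => trivial
  | some s => exact ⟨s, rfl, subset_rfl⟩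

/-- The names of the rights `R` have the same values on both sides. -/
def SameNames (σ : Env) (M : Mem) (σ' : Env) (M' : Mem) : Rights → Prop
  | none => True
  | some RS => ∀ r ∈ RS, r.eval σ M = r.eval σ' M'

theorem SameNames.low {R : Rights} (h : SameNames σ M σ' M' R) : Low W σ M R ↔ Low W σ' M' R := by
  cases R with
  | none => rfl
  | some RS =>
    refine exists_congr fun r => and_congr_right fun hr => ?_
    rw [h r hr]

theorem SameNames.evalRS {RS : RSet} (h : SameNames σ M σ' M' (some RS)) :
    evalRS σ M RS = evalRS σ' M' RS := by
  have : RS.image (KeyRef.eval σ M) = RS.image (KeyRef.eval σ' M') := Finset.image_congr h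
  unfold CloudTypes.evalRS
  rw [this]

theorem SameNames.evalRights {R : Rights} (h : SameNames σ M σ' M' R) :
    evalRights σ M R = evalRights σ' M' R := by
  cases R with
  | none => rfl
  | some RS => simp only [CloudTypes.evalRights, h.evalRS]

theorem evalRS_eq_some {RS : RSet} {L : Finset Key} (h : evalRS σ M RS = some L) :
    (∀ r ∈ RS, ∃ k ∈ L, r.eval σ M = some k) ∧ ∀ k ∈ L, ∃ r ∈ RS, r.eval σ M = some k := by
  unfold evalRS at h
  split_ifs at h with h'
  cases h
  constructor
  · intro r hr
    cases hk : r.eval σ M with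
    | none => exact absurd (Finset.mem_image.2 ⟨r, hr, hk⟩) h'
    | some k => exact ⟨k, by simpa using ⟨r, hr, hk⟩, rfl⟩
  · intro k hk
    simpa using hk

theorem evalRS_isSome {RS : RSet} (h : ∀ r ∈ RS, (r.eval σ M).isSome) :
    ∃ L, evalRS σ M RS = some L := by
  unfold evalRS
  rw [if_neg]
  · exact ⟨_, rfl⟩
  · intro h'
    obtain ⟨r, hr, hk⟩ := Finset.mem_image.1 h'
    have := h r hr
    simp [hk] at this

/-- For rights whose names all have values, `Low` is a property of the keys that they denote. -/
theorem low_evalRS {RS : RSet} {L : Finset Key} (h : evalRS σ M RS = some L) :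
    Low W σ M (some RS) ↔ ¬ L ⊆ W := by
  obtain ⟨h1, h2⟩ := evalRS_eq_some h
  constructor
  · rintro ⟨r, hr, k, hk, hkW⟩ hL
    obtain ⟨k', hk', he⟩ := h1 r hr
    rw [hk] at he
    cases he
    exact hkW (hL hk')
  · intro hL
    obtain ⟨k, hk, hkW⟩ := Finset.not_subset.1 hL
    obtain ⟨r, hr, he⟩ := h2 k hk
    exact ⟨r, hr, k, he, hkW⟩

theorem low_evalRights {R : Rights} {r : Option (Finset Key)} (h : evalRights σ M R = some r) :
    Low W σ M R ↔ LowKeys W r := by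
  cases R with
  | none => cases h; rfl
  | some RS =>
    simp only [evalRights, Option.map_eq_some_iff] at h
    obtain ⟨L, hL, rfl⟩ := h
    exact low_evalRS hL

/-! ### Well-typed environments -/

/-- The levels of what a thread may use: the locations and the channels (with respect to the
transmitted data, resp. to the place where they are used) that are not confidential, and the channels
that exist. -/
structure Lev where
  lo : ℕ → Prop
  loD : Chan → Prop
  loP : Chan → Prop
  act : Chan → Prop

/-- The names in scope have values in the memory `M`, at the levels that their types prescribe. -/
structure EnvOk (W : Finset Key) (Γ : Ctx) (σ : Env) (M : Mem) (lv : Lev) : Prop where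
  prin_iff : ∀ p, p ∈ Γ.prin ↔ (σ.prin p).isSome
  prin_mem : ∀ p l, σ.prin p = some l → (M.prin l).isSome
  key_iff : ∀ k, k ∈ Γ.key ↔ (σ.key k).isSome
  key_mem : ∀ k l, σ.key k = some l → (M.key l).isSome
  var : ∀ x S R, Γ.var x = some (S, R) → Γ.WfRights R ∧ ∃ y, σ.var x = some y ∧
    (M.var y).isSome ∧ (lv.lo y ↔ Low W σ M R)
  chan : ∀ c S R₁ R₂, Γ.chan c = some (S, R₁, R₂) → Γ.WfRights R₁ ∧ Γ.WfRights R₂ ∧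
    ∃ ch, σ.chan c = some ch ∧ lv.act ch ∧ (lv.loD ch ↔ Low W σ M R₁) ∧ (lv.loP ch ↔ Low W σ M R₂)

/-- What is in the memory `M` remains in `M'`, up to the values of variables. -/
structure MemLe (M M' : Mem) : Prop where
  var : ∀ y, (M.var y).isSome → (M'.var y).isSome
  prin : ∀ l q, M.prin l = some q → M'.prin l = some q
  key : ∀ l q, M.key l = some q → M'.key l = some q

/-- The levels of existing locations and channels are unchanged. -/
structure LevLe (M : Mem) (lv lv' : Lev) : Prop where
  lo : ∀ y, (M.var y).isSome → (lv'.lo y ↔ lv.lo y)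
  act : ∀ ch, lv.act ch → lv'.act ch
  loD : ∀ ch, lv.act ch → (lv'.loD ch ↔ lv.loD ch)
  loP : ∀ ch, lv.act ch → (lv'.loP ch ↔ lv.loP ch)

theorem MemLe.refl (M : Mem) : MemLe M M := ⟨fun _ => id, fun _ _ => id, fun _ _ => id⟩

theorem MemLe.trans {M₁ M₂ M₃ : Mem} (h : MemLe M₁ M₂) (h' : MemLe M₂ M₃) : MemLe M₁ M₃ :=
  ⟨fun y hy => h'.var y (h.var y hy), fun l q hq => h'.prin l q (h.prin l q hq),
    fun l q hq => h'.key l q (h.key l q hq)⟩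

theorem MemLe.setVar (M : Mem) (y : ℕ) (v : Val) : MemLe M (M.setVar y v) := by
  refine ⟨fun z hz => ?_, fun _ _ => id, fun _ _ => id⟩
  by_cases h : z = y
  · subst h; simp [Mem.setVar]
  · simpa [Mem.setVar, h] using hz

theorem MemLe.setPrin {l : ℕ} (h : M.prin l = none) (k L) : MemLe M (M.setPrin l k L) := by
  refine ⟨fun _ => id, fun l' q hq => ?_, fun _ _ => id⟩
  have : l' ≠ l := by rintro rfl; simp [h] at hq
  simpa [Mem.setPrin, this] using hq

theorem MemLe.setKey {l : ℕ} (h : M.key l = none) (k) : MemLe M (M.setKey l k) := by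
  refine ⟨fun _ => id, fun _ _ => id, fun l' q hq => ?_⟩
  have : l' ≠ l := by rintro rfl; simp [h] at hq
  simpa [Mem.setKey, this] using hq

theorem LevLe.refl (M : Mem) (lv : Lev) : LevLe M lv lv :=
  ⟨fun _ _ => .rfl, fun _ => id, fun _ _ => .rfl, fun _ _ => .rfl⟩

theorem LevLe.trans {M₁ M₂ : Mem} {l₁ l₂ l₃ : Lev} (hM : MemLe M₁ M₂) (h : LevLe M₁ l₁ l₂)
    (h' : LevLe M₂ l₂ l₃) : LevLe M₁ l₁ l₃ :=
  ⟨fun y hy => (h'.lo y (hM.var y hy)).trans (h.lo y hy), fun c hc => h'.act c (h.act c hc),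
    fun c hc => (h'.loD c (h.act c hc)).trans (h.loD c hc),
    fun c hc => (h'.loP c (h.act c hc)).trans (h.loP c hc)⟩

theorem EnvOk.prinVal_isSome {lv} (h : EnvOk W Γ σ M lv) (p : ℕ) :
    p ∈ Γ.prin ↔ (σ.prinVal M p).isSome := by
  rw [h.prin_iff]
  unfold Env.prinVal
  cases hp : σ.prin p with
  | none => simp
  | some l => simpa using h.prin_mem p l hp

theorem EnvOk.keyVal_isSome {lv} (h : EnvOk W Γ σ M lv) (p : ℕ) :
    p ∈ Γ.key ↔ (σ.keyVal M p).isSome := by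
  rw [h.key_iff]
  unfold Env.keyVal
  cases hp : σ.key p with
  | none => simp
  | some l => simpa using h.key_mem p l hp

/-- The names of a thread keep their values when the memory grows. -/
theorem EnvOk.keyRef_eval {lv} (h : EnvOk W Γ σ M lv) (hM : MemLe M M') (r : KeyRef) :
    r.eval σ M = r.eval σ M' := by
  cases r with
  | key k =>
    simp only [KeyRef.eval, Env.keyVal]
    cases hk : σ.key k with
    | none => rfl
    | some l =>
      obtain ⟨q, hq⟩ := Option.isSome_iff_exists.1 (h.key_mem k l hk)
      simp [hq, hM.key l q hq]
  | pub p =>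
    simp only [KeyRef.eval, Env.prinVal]
    cases hk : σ.prin p with
    | none => rfl
    | some l =>
      obtain ⟨q, hq⟩ := Option.isSome_iff_exists.1 (h.prin_mem p l hk)
      simp [hq, hM.prin l q hq]

theorem EnvOk.sameNames {lv} (h : EnvOk W Γ σ M lv) (hM : MemLe M M') (R : Rights) :
    SameNames σ M σ M' R := by
  cases R with
  | none => trivial
  | some RS => exact fun r _ => h.keyRef_eval hM r

theorem EnvOk.low_iff {lv} (h : EnvOk W Γ σ M lv) (hM : MemLe M M') (R : Rights) :
    Low W σ M' R ↔ Low W σ M R := (h.sameNames hM R).low.symm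

theorem EnvOk.wf_isSome {lv} (h : EnvOk W Γ σ M lv) {RS : RSet} (hR : Γ.WfRights (some RS)) :
    ∀ r ∈ RS, (r.eval σ M).isSome := by
  intro r hr
  have := hR r hr
  cases r with
  | key k => exact (h.keyVal_isSome k).1 this
  | pub p => simpa [KeyRef.eval] using (h.prinVal_isSome p).1 this

theorem EnvOk.wf_evalRS {lv} (h : EnvOk W Γ σ M lv) {RS : RSet} (hR : Γ.WfRights (some RS)) :
    ∃ L, evalRS σ M RS = some L := evalRS_isSome (h.wf_isSome hR)

theorem EnvOk.wf_of_eval {lv} (h : EnvOk W Γ σ M lv) {R : Rights} {r} (hr : evalRights σ M R = some r) :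
    Γ.WfRights R := by
  cases R with
  | none => trivial
  | some RS =>
    simp only [evalRights, Option.map_eq_some_iff] at hr
    obtain ⟨L, hL, rfl⟩ := hr
    intro r hr
    obtain ⟨k, -, hk⟩ := (evalRS_eq_some hL).1 r hr
    cases r with
    | key k => exact (h.keyVal_isSome _).2 (by simp_all [KeyRef.eval])
    | pub p =>
      refine (h.prinVal_isSome _).2 ?_
      simp only [KeyRef.eval, Option.map_eq_some_iff] at hk
      obtain ⟨q, hq, -⟩ := hk
      simp [hq]

theorem EnvOk.mono {lv lv'} (h : EnvOk W Γ σ M lv) (hM : MemLe M M') (hlv : LevLe M lv lv') :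
    EnvOk W Γ σ M' lv' where
  prin_iff := h.prin_iff
  prin_mem p l hp := by
    obtain ⟨q, hq⟩ := Option.isSome_iff_exists.1 (h.prin_mem p l hp)
    simp [hM.prin l q hq]
  key_iff := h.key_iff
  key_mem p l hp := by
    obtain ⟨q, hq⟩ := Option.isSome_iff_exists.1 (h.key_mem p l hp)
    simp [hM.key l q hq]
  var x S R hx := by
    obtain ⟨hw, y, h1, h2, h3⟩ := h.var x S R hx
    exact ⟨hw, y, h1, hM.var y h2, by rw [hlv.lo y h2, h3, h.low_iff hM]⟩
  chan c S R₁ R₂ hc := by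
    obtain ⟨hw, hw', ch, h1, h2, h3, h4⟩ := h.chan c S R₁ R₂ hc
    exact ⟨hw, hw', ch, h1, hlv.act ch h2, by rw [hlv.loD ch h2, h3, h.low_iff hM],
      by rw [hlv.loP ch h2, h4, h.low_iff hM]⟩

theorem EnvOk.addVar {lv lv'} (h : EnvOk W Γ σ M lv) {x y v S R} (hR : Γ.WfRights R)
    (hlv : LevLe M lv lv') (hy : lv'.lo y ↔ Low W σ M R) :
    EnvOk W (Γ.addVar x S R) (σ.setVar x y) (M.setVar y v) lv' where
  prin_iff := h.prin_iff
  prin_mem := h.prin_mem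
  key_iff := h.key_iff
  key_mem := h.key_mem
  var x' S' R' hx := by
    by_cases hxx : x' = x
    · subst hxx
      simp only [Ctx.addVar, Function.update_self, Option.some.injEq, Prod.mk.injEq] at hx
      obtain ⟨rfl, rfl⟩ := hx
      exact ⟨hR, y, by simp [Env.setVar], by simp [Mem.setVar], hy⟩
    · simp only [Ctx.addVar, Function.update_of_ne hxx] at hx
      obtain ⟨hw, y', h1, h2, h3⟩ := h.var x' S' R' hx
      exact ⟨hw, y', by simpa [Env.setVar, hxx] using h1, (MemLe.setVar M y v).var y' h2,
        (hlv.lo y' h2).trans h3⟩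
  chan c S R₁ R₂ hc := by
    obtain ⟨hw, hw', ch, h1, h2, h3, h4⟩ := h.chan c S R₁ R₂ hc
    exact ⟨hw, hw', ch, h1, hlv.act ch h2, (hlv.loD ch h2).trans h3, (hlv.loP ch h2).trans h4⟩

theorem EnvOk.addChan {lv lv'} (h : EnvOk W Γ σ M lv) {c ch S R₁ R₂} (hR₁ : Γ.WfRights R₁)
    (hR₂ : Γ.WfRights R₂) (hlv : LevLe M lv lv') (ha : lv'.act ch) (h₁ : lv'.loD ch ↔ Low W σ M R₁)
    (h₂ : lv'.loP ch ↔ Low W σ M R₂) :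
    EnvOk W (Γ.addChan c S R₁ R₂) (σ.setChan c ch) M lv' where
  prin_iff := h.prin_iff
  prin_mem := h.prin_mem
  key_iff := h.key_iff
  key_mem := h.key_mem
  var x S' R' hx := by
    obtain ⟨hw, y', h1, h2, h3⟩ := h.var x S' R' hx
    exact ⟨hw, y', h1, h2, (hlv.lo y' h2).trans h3⟩
  chan c' S R₁ R₂ hc := by
    by_cases hcc : c' = c
    · subst hcc
      simp only [Ctx.addChan, Function.update_self, Option.some.injEq, Prod.mk.injEq] at hc
      obtain ⟨rfl, rfl, rfl⟩ := hc
      exact ⟨hR₁, hR₂, ch, by simp [Env.setChan], ha, h₁, h₂⟩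
    · simp only [Ctx.addChan, Function.update_of_ne hcc] at hc
      obtain ⟨hw, hw', ch, h1, h2, h3, h4⟩ := h.chan c' S R₁ R₂ hc
      exact ⟨hw, hw', ch, by simpa [Env.setChan, hcc] using h1, hlv.act ch h2,
        (hlv.loD ch h2).trans h3, (hlv.loP ch h2).trans h4⟩

theorem Ctx.WfRights.mono {Γ' : Ctx} (hp : Γ.prin ⊆ Γ'.prin) (hk : Γ.key ⊆ Γ'.key) {R : Rights}
    (h : Γ.WfRights R) : Γ'.WfRights R := by
  cases R with
  | none => trivial
  | some RS =>
    intro r hr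
    have := h r hr
    cases r with
    | key k => exact hk this
    | pub p => exact hp this

theorem Ctx.WfRights.addPrin {R : Rights} (h : Γ.WfRights R) (p : ℕ) : (Γ.addPrin p).WfRights R :=
  h.mono (Γ' := Γ.addPrin p) (Set.subset_insert _ _) subset_rfl

theorem Ctx.WfRights.addKey {R : Rights} (h : Γ.WfRights R) (k : ℕ) : (Γ.addKey k).WfRights R :=
  h.mono (Γ' := Γ.addKey k) (Set.Subset.refl Γ.prin) (Set.subset_insert _ _)

theorem EnvOk.sameNames_setPrin {p l k L} (hp : p ∉ Γ.prin) (hM : M.prin l = none) {lv}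
    (h : EnvOk W Γ σ M lv) {R : Rights} (hR : Γ.WfRights R) :
    SameNames σ M (σ.setPrin p l) (M.setPrin l k L) R := by
  cases R with
  | none => trivial
  | some RS =>
    intro r hr
    have := hR r hr
    rw [h.keyRef_eval (MemLe.setPrin hM k L)]
    cases r with
    | key k => rfl
    | pub p' =>
      have hpp : p' ≠ p := by rintro rfl; exact hp this
      simp [KeyRef.eval, Env.prinVal, Env.setPrin, hpp]

theorem EnvOk.sameNames_setKey {p l k} (hp : p ∉ Γ.key) (hM : M.key l = none) {lv}
    (h : EnvOk W Γ σ M lv) {R : Rights} (hR : Γ.WfRights R) :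
    SameNames σ M (σ.setKey p l) (M.setKey l k) R := by
  cases R with
  | none => trivial
  | some RS =>
    intro r hr
    have := hR r hr
    rw [h.keyRef_eval (MemLe.setKey hM k)]
    cases r with
    | pub k => rfl
    | key p' =>
      have hpp : p' ≠ p := by rintro rfl; exact hp this
      simp [KeyRef.eval, Env.keyVal, Env.setKey, hpp]

theorem EnvOk.addPrin {lv} (h : EnvOk W Γ σ M lv) {p l k L} (hp : p ∉ Γ.prin) (hM : M.prin l = none) :
    EnvOk W (Γ.addPrin p) (σ.setPrin p l) (M.setPrin l k L) lv where
  prin_iff p' := by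
    by_cases hpp : p' = p
    · subst hpp; simp [Ctx.addPrin, Env.setPrin]
    · simpa [Ctx.addPrin, Env.setPrin, hpp] using h.prin_iff p'
  prin_mem p' l' hp' := by
    by_cases hpp : p' = p
    · subst hpp
      simp only [Env.setPrin, Function.update_self, Option.some.injEq] at hp'
      subst hp'
      simp [Mem.setPrin]
    · simp only [Env.setPrin, Function.update_of_ne hpp] at hp'
      obtain ⟨q, hq⟩ := Option.isSome_iff_exists.1 (h.prin_mem p' l' hp')
      simp [(MemLe.setPrin hM k L).prin l' q hq]
  key_iff := h.key_iff
  key_mem := h.key_mem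
  var x S R hx := by
    obtain ⟨hw, y', h1, h2, h3⟩ := h.var x S R hx
    exact ⟨hw.addPrin p, y', h1, h2,
      h3.trans (h.sameNames_setPrin hp hM hw).low⟩
  chan c S R₁ R₂ hc := by
    obtain ⟨hw, hw', ch, h1, h2, h3, h4⟩ := h.chan c S R₁ R₂ hc
    exact ⟨hw.addPrin p, hw'.addPrin p,
      ch, h1, h2, h3.trans (h.sameNames_setPrin hp hM hw).low,
      h4.trans (h.sameNames_setPrin hp hM hw').low⟩

theorem EnvOk.addKey {lv} (h : EnvOk W Γ σ M lv) {p l k} (hp : p ∉ Γ.key) (hM : M.key l = none) :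
    EnvOk W (Γ.addKey p) (σ.setKey p l) (M.setKey l k) lv where
  key_iff p' := by
    by_cases hpp : p' = p
    · subst hpp; simp [Ctx.addKey, Env.setKey]
    · simpa [Ctx.addKey, Env.setKey, hpp] using h.key_iff p'
  key_mem p' l' hp' := by
    by_cases hpp : p' = p
    · subst hpp
      simp only [Env.setKey, Function.update_self, Option.some.injEq] at hp'
      subst hp'
      simp [Mem.setKey]
    · simp only [Env.setKey, Function.update_of_ne hpp] at hp'
      obtain ⟨q, hq⟩ := Option.isSome_iff_exists.1 (h.key_mem p' l' hp')
      simp [(MemLe.setKey hM k).key l' q hq]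
  prin_iff := h.prin_iff
  prin_mem := h.prin_mem
  var x S R hx := by
    obtain ⟨hw, y', h1, h2, h3⟩ := h.var x S R hx
    exact ⟨hw.addKey p, y', h1, h2,
      h3.trans (h.sameNames_setKey hp hM hw).low⟩
  chan c S R₁ R₂ hc := by
    obtain ⟨hw, hw', ch, h1, h2, h3, h4⟩ := h.chan c S R₁ R₂ hc
    exact ⟨hw.addKey p, hw'.addKey p,
      ch, h1, h2, h3.trans (h.sameNames_setKey hp hM hw).low,
      h4.trans (h.sameNames_setKey hp hM hw').low⟩

/-! ### Evaluation never gets stuck -/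

theorem exists_fresh {α : Type*} {f : ℕ → Option α} (h : {y | (f y).isSome}.Finite) :
    ∃ y, f y = none := by
  obtain ⟨y, hy⟩ := h.exists_notMem
  exact ⟨y, by simpa using hy⟩

/-- Typable expressions always have a value, which may be `nav`: run-time errors do not block. -/
theorem EnvOk.eval_total {lv e S R} (h : EnvOk W Γ σ M lv) (he : HasType Γ e S R) (U : Finset ℕ) :
    ∃ v U', Eval σ M U e v U' := by
  induction he generalizing U with
  | @var x S R hx =>
    obtain ⟨-, y, h1, h2, -⟩ := h.var x S R hx
    obtain ⟨v, hv⟩ := Option.isSome_iff_exists.1 h2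
    exact ⟨v, U, .var (by simp [Env.varVal, h1, hv])⟩
  | int => exact ⟨_, _, .int⟩
  | pub hp =>
    obtain ⟨⟨k, L⟩, hq⟩ := Option.isSome_iff_exists.1 ((h.prinVal_isSome _).1 hp)
    exact ⟨_, _, .pub hq⟩
  | release hp =>
    obtain ⟨⟨k, L⟩, hq⟩ := Option.isSome_iff_exists.1 ((h.prinVal_isSome _).1 hp)
    by_cases hL : L = ∅
    · subst hL
      exact ⟨_, _, .releaseErr hq⟩
    · obtain ⟨n, hn⟩ := Infinite.exists_notMem_finset U
      exact ⟨_, _, .release hq hL hn⟩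
  | enc hR _ _ ih =>
    obtain ⟨v, U', hv⟩ := ih U
    obtain ⟨L, hL⟩ := h.wf_evalRS hR
    obtain ⟨n, hn⟩ := Infinite.exists_notMem_finset U'
    exact ⟨_, _, .enc hv hL hn⟩
  | op _ _ ih1 ih2 =>
    obtain ⟨v, U', hv⟩ := ih1 U
    obtain ⟨w, U'', hw⟩ := ih2 U'
    exact ⟨_, _, .op hv hw⟩
  | arrNil => exact ⟨_, _, .arrNil⟩
  | arrCons _ _ ih1 ih2 =>
    obtain ⟨v, U', hv⟩ := ih1 U
    obtain ⟨w, U'', hw⟩ := ih2 U'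
    have : ∃ l, w = .arr l := by cases hw <;> exact ⟨_, rfl⟩
    obtain ⟨l, rfl⟩ := this
    exact ⟨_, _, .arrCons hv hw⟩
  | @elem x e S R₁ R₂ hx _ ih =>
    obtain ⟨-, y, h1, h2, -⟩ := h.var x _ _ hx
    obtain ⟨w, hw⟩ := Option.isSome_iff_exists.1 h2
    obtain ⟨v, U', hv⟩ := ih U
    exact ⟨_, _, .elem (w := w) (by simp [Env.varVal, h1, hw]) hv⟩

theorem Eval.used_mono {U U' : Finset ℕ} {e v} (h : Eval σ M U e v U') : U ⊆ U' := by
  induction h with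
  | release => exact Finset.subset_insert _ _
  | enc _ _ _ ih => exact ih.trans (Finset.subset_insert _ _)
  | op _ _ ih1 ih2 => exact ih1.trans ih2
  | arrCons _ _ ih1 ih2 => exact ih1.trans ih2
  | elem _ _ ih => exact ih
  | _ => exact subset_rfl

theorem ActStep.used_mono {U U' : Finset ℕ} {a b} (h : ActStep U σ M a U' σ' M' b) : U ⊆ U' := by
  cases h with
  | condTrue h1 h2 => exact h1.used_mono.trans h2.used_mono
  | condFalse h1 h2 _ => exact h1.used_mono.trans h2.used_mono
  | assignArr h1 h2 _ _ => exact h1.used_mono.trans h2.used_mono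
  | _ => exact Eval.used_mono ‹_›

theorem SStep.used_mono {a b : Finset ℕ × Mem × SConf} (h : SStep a b) : a.1 ⊆ b.1 := by
  induction h with
  | act _ h => exact h.used_mono
  | fork => exact subset_rfl
  | left _ ih => exact ih
  | right _ ih => exact ih

theorem SStep.star_used_mono {a b : Finset ℕ × Mem × SConf} (h : Relation.ReflTransGen SStep a b) :
    a.1 ⊆ b.1 := by
  induction h with
  | refl => exact subset_rfl
  | tail _ h ih => exact ih.trans h.used_mono

theorem ActStep.memLe {U U' : Finset ℕ} {a b} (h : ActStep U σ M a U' σ' M' b) : MemLe M M' := by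
  cases h with
  | regTrue _ _ _ h => exact .setPrin h _ _
  | _ => first | exact .refl _ | exact .setVar _ _ _

theorem SStep.memLe {a b : Finset ℕ × Mem × SConf} (h : SStep a b) : MemLe a.2.1 b.2.1 := by
  induction h with
  | act _ h => exact h.memLe
  | fork => exact .refl _
  | left _ ih => exact ih
  | right _ ih => exact ih

theorem SStep.star_memLe {a b : Finset ℕ × Mem × SConf} (h : Relation.ReflTransGen SStep a b) :
    MemLe a.2.1 b.2.1 := by
  induction h with
  | refl => exact .refl _
  | tail _ h ih => exact ih.trans h.memLe

theorem LStep.memLe {u u' t ev ts} (h : LStep u M t ev u' M' ts) : MemLe M M' := by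
  cases h with
  | act _ h => exact h.memLe
  | par => exact .refl _
  | bang => exact .refl _
  | letKey _ h => exact .setKey h _
  | newPrin _ _ h => exact .setPrin h _ _
  | sync h _ => exact SStep.star_memLe h
  | set => exact .setVar _ _ _

theorem Mem.IsFinite.setVar (h : M.IsFinite) (y v) : (M.setVar y v).IsFinite := by
  refine ⟨(h.1.insert y).subset fun z hz => ?_, h.2⟩
  by_cases hzy : z = y
  · exact .inl hzy
  · exact .inr (by simpa [Mem.setVar, hzy] using hz)

theorem Mem.IsFinite.setPrin (h : M.IsFinite) (y k L) : (M.setPrin y k L).IsFinite := by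
  refine ⟨h.1, (h.2.1.insert y).subset fun z hz => ?_, h.2.2⟩
  by_cases hzy : z = y
  · exact .inl hzy
  · exact .inr (by simpa [Mem.setPrin, hzy] using hz)

theorem Mem.IsFinite.setKey (h : M.IsFinite) (y k) : (M.setKey y k).IsFinite := by
  refine ⟨h.1, h.2.1, (h.2.2.insert y).subset fun z hz => ?_⟩
  by_cases hzy : z = y
  · exact .inl hzy
  · exact .inr (by simpa [Mem.setKey, hzy] using hz)

theorem ActStep.isFinite {U U' : Finset ℕ} {a b} (h : ActStep U σ M a U' σ' M' b)
    (hM : M.IsFinite) : M'.IsFinite := by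
  cases h with
  | regTrue => exact hM.setPrin _ _ _
  | _ => first | exact hM | exact hM.setVar _ _

theorem SStep.isFinite {a b : Finset ℕ × Mem × SConf} (h : SStep a b) (hM : a.2.1.IsFinite) :
    b.2.1.IsFinite := by
  induction h with
  | act _ h => exact h.isFinite hM
  | fork => exact hM
  | left _ ih => exact ih hM
  | right _ ih => exact ih hM

theorem SStep.star_isFinite {a b : Finset ℕ × Mem × SConf} (h : Relation.ReflTransGen SStep a b)
    (hM : a.2.1.IsFinite) : b.2.1.IsFinite := by
  induction h with
  | refl => exact hM
  | tail _ h ih => exact h.isFinite ih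

theorem LStep.isFinite {u u' t ev ts} (h : LStep u M t ev u' M' ts) (hM : M.IsFinite) :
    M'.IsFinite := by
  cases h with
  | act _ h => exact h.isFinite hM
  | par => exact hM
  | bang => exact hM
  | letKey _ h => exact hM.setKey _ _
  | newPrin _ _ h => exact hM.setPrin _ _ _
  | sync h _ => exact SStep.star_isFinite h hM
  | set => exact hM.setVar _ _

end CloudTypes

namespace CloudTypes

/-! ### Typing is preserved by the reductions of a single device -/

variable {W : Finset Key} {Γ : Ctx} {σ σ' : Env} {M M' : Mem} {lv lv' : Lev} {h : Prop}

/-- The command `C` under the substitution `σ` is typable, and even so in a confidential context if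
`h` holds. -/
def RunOk (W : Finset Key) (h : Prop) (lv : Lev) (M : Mem) (σ : Env) (C : Cmd) : Prop :=
  ∃ Γ pc, EnvOk W Γ σ M lv ∧ WellTyped pc Γ C ∧ (h → ¬ Low W σ M pc)

/-- `RunOk` for the state of a `synchronised` block with the continuation `C`. -/
inductive SOk (W : Finset Key) (h : Prop) (lv : Lev) (M : Mem) (C : Cmd) : SConf → Prop
  | run {σ G} : RunOk W h lv M σ (G.plug C) → SOk W h lv M C (.run σ G)
  | par {a b} : SOk W h lv M C a → SOk W h lv M C b → SOk W h lv M C (.par a b)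

/-- `RunOk` for threads. A thread that sets a variable from outside is regarded as confidential: its
location is. -/
def TOk (W : Finset Key) (h : Prop) (lv : Lev) (M : Mem) : Thread → Prop
  | .run σ C => RunOk W h lv M σ C
  | .set y _ => h ∧ (M.var y).isSome ∧ ¬ lv.lo y

/-- `M'` and `M` differ in confidential variables only. -/
structure Quiet (lv : Lev) (M M' : Mem) : Prop where
  prin : M'.prin = M.prin
  key : M'.key = M.key
  var : ∀ y, lv.lo y → M'.var y = M.var y

/-- How memories and levels change when a device reduces, with a confidential thread if `h` holds. -/
structure Grow (h : Prop) (lv : Lev) (M : Mem) (lv' : Lev) (M' : Mem) : Prop where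
  mem : MemLe M M'
  lev : LevLe M lv lv'
  alloc : ∀ y, lv'.lo y → (M'.var y).isSome
  loD : lv'.loD = lv.loD
  loP : lv'.loP = lv.loP
  act : lv'.act = lv.act
  same : h → lv' = lv
  quiet : h → Quiet lv M M'

theorem Quiet.refl (lv : Lev) (M : Mem) : Quiet lv M M := ⟨rfl, rfl, fun _ _ => rfl⟩

theorem Quiet.trans {M'' : Mem} (h₁ : Quiet lv M M') (h₂ : Quiet lv M' M'') : Quiet lv M M'' :=
  ⟨h₂.prin.trans h₁.prin, h₂.key.trans h₁.key, fun y hy => (h₂.var y hy).trans (h₁.var y hy)⟩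

theorem Quiet.setVar {y : ℕ} (hy : ¬ lv.lo y) (M : Mem) (v : Val) : Quiet lv M (M.setVar y v) := by
  refine ⟨rfl, rfl, fun z hz => ?_⟩
  have : z ≠ y := by rintro rfl; exact hy hz
  simp [Mem.setVar, this]

theorem Grow.refl (ha : ∀ y, lv.lo y → (M.var y).isSome) : Grow h lv M lv M :=
  ⟨.refl _, .refl _ _, ha, rfl, rfl, rfl, fun _ => rfl, fun _ => .refl _ _⟩

theorem Grow.trans {lv'' : Lev} {M'' : Mem} (h₁ : Grow h lv M lv' M') (h₂ : Grow h lv' M' lv'' M'') :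
    Grow h lv M lv'' M'' :=
  ⟨h₁.mem.trans h₂.mem, h₁.lev.trans h₁.mem h₂.lev, h₂.alloc, h₂.loD.trans h₁.loD,
    h₂.loP.trans h₁.loP, h₂.act.trans h₁.act, fun hh => (h₂.same hh).trans (h₁.same hh),
    fun hh => (h₁.quiet hh).trans (h₁.same hh ▸ h₂.quiet hh)⟩

/-- The levels after the creation of the location `y`, confidential unless `p` holds. -/
def Lev.addLoc (lv : Lev) (y : ℕ) (p : Prop) : Lev := { lv with lo := fun z => lv.lo z ∨ (z = y ∧ p) }

theorem Grow.addLoc (ha : ∀ y, lv.lo y → (M.var y).isSome) {y : ℕ} (hy : M.var y = none) {p : Prop}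
    (hp : h → ¬ p) (v : Val) : Grow h lv M (lv.addLoc y p) (M.setVar y v) where
  mem := .setVar _ _ _
  lev := by
    refine ⟨fun z hz => ?_, fun _ => id, fun _ _ => .rfl, fun _ _ => .rfl⟩
    have : z ≠ y := by rintro rfl; simp [hy] at hz
    simp [Lev.addLoc, this]
  alloc := by
    rintro z (hz | ⟨rfl, -⟩)
    · exact (MemLe.setVar M y v).var z (ha z hz)
    · simp [Mem.setVar]
  loD := rfl
  loP := rfl
  act := rfl
  same hh := by simp [Lev.addLoc, hp hh]
  quiet hh := .setVar (fun hl => by have := ha y hl; simp [hy] at this) _ _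

theorem Lev.addLoc_lo (ha : ∀ y, lv.lo y → (M.var y).isSome) {y : ℕ} (hy : M.var y = none) (p : Prop) :
    (lv.addLoc y p).lo y ↔ p := by
  have : ¬ lv.lo y := fun hl => by have := ha y hl; simp [hy] at this
  simp [Lev.addLoc, this]

theorem Grow.setVar (ha : ∀ y, lv.lo y → (M.var y).isSome) {y : ℕ} (hy : h → ¬ lv.lo y) (v : Val) :
    Grow h lv M lv (M.setVar y v) :=
  ⟨.setVar _ _ _, .refl _ _, fun z hz => (MemLe.setVar M y v).var z (ha z hz), rfl, rfl, rfl,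
    fun _ => rfl, fun hh => .setVar (hy hh) _ _⟩

theorem low_setVar {x y v} {R : Rights} :
    Low W (σ.setVar x y) (M.setVar y v) R ↔ Low W σ M R := by
  refine SameNames.low ?_
  cases R with
  | none => trivial
  | some RS => intro r _; cases r <;> rfl

theorem low_setChan {c ch} {R : Rights} : Low W (σ.setChan c ch) M R ↔ Low W σ M R := by
  refine SameNames.low ?_
  cases R with
  | none => trivial
  | some RS => intro r _; cases r <;> rfl

theorem not_low_inter {R₁ R₂ : Rights} (hp : h → ¬ Low W σ M R₁) : h → ¬ Low W σ M (R₁.inter R₂) :=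
  fun hh hl => hp hh (Low.of_inter hl).1

theorem RunOk.mono {C} (hr : RunOk W h lv M σ C) (hM : MemLe M M') (hl : LevLe M lv lv') :
    RunOk W h lv' M' σ C := by
  obtain ⟨Γ, pc, hE, hT, hp⟩ := hr
  exact ⟨Γ, pc, hE.mono hM hl, hT, fun hh => (hE.low_iff hM pc).not.2 (hp hh)⟩

theorem SOk.mono {C s} (hr : SOk W h lv M C s) (hM : MemLe M M') (hl : LevLe M lv lv') :
    SOk W h lv' M' C s := by
  induction hr with
  | run hr => exact .run (hr.mono hM hl)
  | par _ _ ih1 ih2 => exact .par ih1 ih2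

theorem TOk.mono {t} (hr : TOk W h lv M t) (hM : MemLe M M') (hl : LevLe M lv lv') :
    TOk W h lv' M' t := by
  cases t with
  | run σ C => exact RunOk.mono hr hM hl
  | set y v => exact ⟨hr.1, hM.var y hr.2.1, by rw [hl.lo y hr.2.1]; exact hr.2.2⟩

theorem ActStep.runOk {C C₁ C₂ : Cmd} {U U' a b} (hr : RunOk W h lv M σ C)
    (hh : C.head = some (a, C₁, C₂)) (hs : ActStep U σ M a U' σ' M' b)
    (ha : ∀ y, lv.lo y → (M.var y).isSome) :
    ∃ lv', Grow h lv M lv' M' ∧ RunOk W h lv' M' σ' (if b then C₁ else C₂) := by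
  obtain ⟨Γ, pc, hE, hT, hp⟩ := hr
  cases hT with
  | cond h1 h2 h3 h4 =>
    simp only [Cmd.head, Option.some.injEq, Prod.mk.injEq] at hh
    obtain ⟨rfl, rfl, rfl⟩ := hh
    cases hs with
    | condTrue => exact ⟨lv, .refl ha, Γ, _, hE, h3, not_low_inter (not_low_inter hp)⟩
    | condFalse => exact ⟨lv, .refl ha, Γ, _, hE, h4, not_low_inter (not_low_inter hp)⟩
  | new h1 h2 h3 h4 h5 h6 =>
    simp only [Cmd.head, Option.some.injEq, Prod.mk.injEq] at hh
    obtain ⟨rfl, rfl, rfl⟩ := hh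
    cases hs with
    | new hv hy =>
      exact ⟨_, .addLoc ha hy (fun hh hl => hp hh (Low.of_inter (hl.mono h4)).1) _, _, _,
        hE.addVar h2 (Grow.addLoc (h := False) ha hy (fun h => h.elim) .nav).lev (Lev.addLoc_lo ha hy _),
        h6, fun hh => low_setVar.not.2 (hp hh)⟩
  | assign h1 h2 h3 h4 =>
    simp only [Cmd.head, Option.some.injEq, Prod.mk.injEq] at hh
    obtain ⟨rfl, rfl, rfl⟩ := hh
    cases hs with
    | @assign _ _ _ _ _ v y hv hy hM =>
      cases h1 with
      | var h1 =>
        obtain ⟨-, y', e1, -, e3⟩ := hE.var _ _ _ h1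
        rw [hy] at e1
        cases e1
        have hg : Grow h lv M lv (M.setVar y v) :=
          .setVar ha (fun hh hl => hp hh (Low.of_inter ((e3.1 hl).mono h3)).1) _
        exact ⟨lv, hg, RunOk.mono ⟨Γ, pc, hE, h4, hp⟩ hg.mem hg.lev⟩
  | assignArr h0 h1 h2 h3 h4 =>
    simp only [Cmd.head, Option.some.injEq, Prod.mk.injEq] at hh
    obtain ⟨rfl, rfl, rfl⟩ := hh
    cases hs with
    | @assignArr _ _ _ _ _ _ _ v₁ v₂ y w hv hv' hy hM =>
      cases h2 with
      | var h2 =>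
        obtain ⟨-, y', e1, -, e3⟩ := hE.var _ _ _ h2
        rw [hy] at e1
        cases e1
        have hg : Grow h lv M lv (M.setVar y (w.setIndex v₁ v₂)) :=
          .setVar ha (fun hh hl => hp hh (Low.of_inter (Low.of_inter ((e3.1 hl).mono h3)).1).1) _
        exact ⟨lv, hg, RunOk.mono ⟨Γ, pc, hE, h4, hp⟩ hg.mem hg.lev⟩
  | decrypt h1 h2 h3 h4 h5 h6 h7 h8 =>
    simp only [Cmd.head, Option.some.injEq, Prod.mk.injEq] at hh
    obtain ⟨rfl, rfl, rfl⟩ := hh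
    cases hs with
    | decTrue _ _ _ _ hy =>
      exact ⟨_, .addLoc ha hy (fun hh hl => hp hh (Low.of_inter (hl.mono h6)).2) _, _, _,
        hE.addVar h2 (Grow.addLoc (h := False) ha hy (fun h => h.elim) .nav).lev (Lev.addLoc_lo ha hy _),
        h7, fun hh => low_setVar.not.2 (not_low_inter hp hh)⟩
    | decFalse => exact ⟨lv, .refl ha, Γ, _, hE, h8, not_low_inter hp⟩
  | register h1 h2 h3 h4 h5 =>
    simp only [Cmd.head, Option.some.injEq, Prod.mk.injEq] at hh
    obtain ⟨rfl, rfl, rfl⟩ := hh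
    have hp' : ¬ h := fun hh => hp hh trivial
    cases hs with
    | regTrue _ _ _ hl =>
      refine ⟨lv, ⟨.setPrin hl _ _, .refl _ _, ha, rfl, rfl, rfl, fun _ => rfl, fun hh => (hp' hh).elim⟩,
        _, _, hE.addPrin h1 hl, h4, fun hh => (hp' hh).elim⟩
    | regFalse => exact ⟨lv, .refl ha, Γ, _, hE, h5, hp⟩
  | _ => simp [Cmd.head] at hh

theorem SCmd.head_plug {G G₁ G₂ : SCmd} {a} (hh : G.head = some (a, G₁, G₂)) (C : Cmd) :
    (G.plug C).head = some (a, G₁.plug C, G₂.plug C) := by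
  cases G <;> simp only [SCmd.head, Option.some.injEq, Prod.mk.injEq, reduceCtorEq] at hh <;>
    obtain ⟨rfl, rfl, rfl⟩ := hh <;> rfl

theorem SStep.sOk {C : Cmd} {p q : Finset ℕ × Mem × SConf} (hs : SStep p q) {lv : Lev}
    (hr : SOk W h lv p.2.1 C p.2.2) (ha : ∀ y, lv.lo y → (p.2.1.var y).isSome) :
    ∃ lv', Grow h lv p.2.1 lv' q.2.1 ∧ SOk W h lv' q.2.1 C q.2.2 := by
  induction hs with
  | @act U U' σ σ' M M' G a G₁ G₂ b hh hs =>
    cases hr with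
    | run hr =>
      obtain ⟨lv', h1, h2⟩ := hs.runOk hr (SCmd.head_plug hh C) ha
      refine ⟨lv', h1, .run ?_⟩
      cases b <;> exact h2
  | fork =>
    cases hr with
    | run hr =>
      obtain ⟨Γ, pc, hE, hT, hp⟩ := hr
      cases hT with
      | par h1 h2 => exact ⟨lv, .refl ha, .par (.run ⟨Γ, pc, hE, h1, hp⟩) (.run ⟨Γ, pc, hE, h2, hp⟩)⟩
  | left _ ih =>
    cases hr with
    | par h1 h2 =>
      obtain ⟨lv', e1, e2⟩ := ih h1 ha
      exact ⟨lv', e1, .par e2 (h2.mono e1.mem e1.lev)⟩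
  | right _ ih =>
    cases hr with
    | par h1 h2 =>
      obtain ⟨lv', e1, e2⟩ := ih h2 ha
      exact ⟨lv', e1, .par (h1.mono e1.mem e1.lev) e2⟩

theorem SStep.star_sOk {C : Cmd} {p q : Finset ℕ × Mem × SConf} (hs : Relation.ReflTransGen SStep p q)
    {lv : Lev} (hr : SOk W h lv p.2.1 C p.2.2) (ha : ∀ y, lv.lo y → (p.2.1.var y).isSome) :
    ∃ lv', Grow h lv p.2.1 lv' q.2.1 ∧ SOk W h lv' q.2.1 C q.2.2 := by
  induction hs with
  | refl => exact ⟨lv, .refl ha, hr⟩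
  | tail _ hs ih =>
    obtain ⟨lv₁, g₁, h₁⟩ := ih
    obtain ⟨lv₂, g₂, h₂⟩ := hs.sOk h₁ g₁.alloc
    exact ⟨lv₂, g₁.trans g₂, h₂⟩

theorem SOk.exit {C s} (hr : SOk W h lv M C s) (he : Exit s σ) : RunOk W h lv M σ C := by
  induction he with
  | nop => cases hr with | run hr => exact hr
  | par _ _ ih _ => cases hr with | par h1 h2 => exact ih h1

theorem LStep.tOk {u u' t ev ts} (hs : LStep u M t ev u' M' ts) (hr : TOk W h lv M t)
    (ha : ∀ y, lv.lo y → (M.var y).isSome) :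
    ∃ lv', Grow h lv M lv' M' ∧ (∀ t' ∈ ts, TOk W h lv' M' t') ∧ (h → ev = none ∧ u'.keys = u.keys) := by
  cases hs with
  | act hh hs =>
    obtain ⟨lv', h1, h2⟩ := hs.runOk hr hh ha
    exact ⟨lv', h1, by simpa [TOk] using h2, fun _ => ⟨rfl, rfl⟩⟩
  | par =>
    obtain ⟨Γ, pc, hE, hT, hp⟩ := hr
    cases hT with
    | par h1 h2 =>
      refine ⟨lv, .refl ha, ?_, fun _ => ⟨rfl, rfl⟩⟩
      simp only [Multiset.insert_eq_cons, Multiset.mem_cons, Multiset.mem_singleton]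
      rintro _ (rfl | rfl)
      exacts [⟨Γ, pc, hE, h1, hp⟩, ⟨Γ, pc, hE, h2, hp⟩]
  | bang =>
    obtain ⟨Γ, pc, hE, hT, hp⟩ := id hr
    cases hT with
    | bang h1 =>
      refine ⟨lv, .refl ha, ?_, fun _ => ⟨rfl, rfl⟩⟩
      simp only [Multiset.insert_eq_cons, Multiset.mem_cons, Multiset.mem_singleton]
      rintro _ (rfl | rfl)
      exacts [⟨Γ, pc, hE, h1, hp⟩, hr]
  | letKey hv hl =>
    obtain ⟨Γ, pc, hE, hT, hp⟩ := hr
    cases hT with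
    | letKey h1 h2 h3 =>
      have hp' : ¬ h := fun hh => hp hh trivial
      refine ⟨lv, ⟨.setKey hl _, .refl _ _, ha, rfl, rfl, rfl, fun _ => rfl, fun hh => (hp' hh).elim⟩,
        ?_, fun _ => ⟨rfl, rfl⟩⟩
      simp only [Multiset.mem_singleton, forall_eq]
      exact ⟨_, _, hE.addKey h1 hl, h3, fun hh => (hp' hh).elim⟩
  | newPrin hL hk hl =>
    obtain ⟨Γ, pc, hE, hT, hp⟩ := hr
    cases hT with
    | newPrin h1 h2 h3 =>
      have hp' : ¬ h := fun hh => hp hh trivial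
      refine ⟨lv, ⟨.setPrin hl _ _, .refl _ _, ha, rfl, rfl, rfl, fun _ => rfl, fun hh => (hp' hh).elim⟩,
        ?_, fun hh => (hp' hh).elim⟩
      simp only [Multiset.mem_singleton, forall_eq]
      exact ⟨_, _, hE.addPrin h1 hl, h3, fun hh => (hp' hh).elim⟩
  | @sync _ _ G C _ _ _ _ hs he =>
    obtain ⟨Γ, pc, hE, hT, hp⟩ := hr
    cases hT with
    | sync h1 =>
      obtain ⟨lv', g, h2⟩ := SStep.star_sOk (C := C) hs (.run ⟨Γ, pc, hE, h1, hp⟩) ha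
      refine ⟨lv', g, ?_, fun _ => ⟨rfl, rfl⟩⟩
      simp only [Multiset.mem_singleton, forall_eq]
      exact h2.exit he
  | set hy => exact ⟨lv, .setVar ha (fun _ => hr.2.2) _, by simp, fun _ => ⟨rfl, rfl⟩⟩

/-! ### Elementary commands and blocks never get stuck -/

/-- Fresh locations exist, all expressions have values, and a failure of a test, of a decryption or of a
registration leads to the second branch. -/
theorem ActStep.progress {C C₁ C₂ : Cmd} {a} (hE : EnvOk W Γ σ M lv) {pc} (hT : WellTyped pc Γ C)
    (hh : C.head = some (a, C₁, C₂)) (hM : M.IsFinite) (U : Finset ℕ) :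
    ∃ U' σ' M' b, ActStep U σ M a U' σ' M' b := by
  obtain ⟨y, hy⟩ := exists_fresh hM.1
  obtain ⟨l, hl⟩ := exists_fresh hM.2.1
  cases hT with
  | cond h1 h2 h3 h4 =>
    simp only [Cmd.head, Option.some.injEq, Prod.mk.injEq] at hh
    obtain ⟨rfl, rfl, rfl⟩ := hh
    obtain ⟨v, U₁, hv⟩ := hE.eval_total h1 U
    obtain ⟨w, U₂, hw⟩ := hE.eval_total h2 U₁
    by_cases hvw : v = w
    · subst hvw; exact ⟨_, _, _, _, .condTrue hv hw⟩
    · exact ⟨_, _, _, _, .condFalse hv hw hvw⟩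
  | new h1 h2 h3 h4 h5 h6 =>
    simp only [Cmd.head, Option.some.injEq, Prod.mk.injEq] at hh
    obtain ⟨rfl, rfl, rfl⟩ := hh
    obtain ⟨v, U₁, hv⟩ := hE.eval_total h3 U
    exact ⟨_, _, _, _, .new hv hy⟩
  | assign h1 h2 h3 h4 =>
    simp only [Cmd.head, Option.some.injEq, Prod.mk.injEq] at hh
    obtain ⟨rfl, rfl, rfl⟩ := hh
    obtain ⟨v, U₁, hv⟩ := hE.eval_total h2 U
    cases h1 with
    | var h1 =>
      obtain ⟨-, y', e1, e2, -⟩ := hE.var _ _ _ h1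
      exact ⟨_, _, _, _, .assign hv e1 e2⟩
  | assignArr h0 h1 h2 h3 h4 =>
    simp only [Cmd.head, Option.some.injEq, Prod.mk.injEq] at hh
    obtain ⟨rfl, rfl, rfl⟩ := hh
    obtain ⟨v, U₁, hv⟩ := hE.eval_total h0 U
    obtain ⟨w, U₂, hw⟩ := hE.eval_total h1 U₁
    cases h2 with
    | var h2 =>
      obtain ⟨-, y', e1, e2, -⟩ := hE.var _ _ _ h2
      obtain ⟨_, e2⟩ := Option.isSome_iff_exists.1 e2
      exact ⟨_, _, _, _, .assignArr hv hw e1 e2⟩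
  | decrypt h1 h2 h3 h4 h5 h6 h7 h8 =>
    simp only [Cmd.head, Option.some.injEq, Prod.mk.injEq] at hh
    obtain ⟨rfl, rfl, rfl⟩ := hh
    obtain ⟨v, U₁, hv⟩ := hE.eval_total h5 U
    obtain ⟨⟨k, L⟩, hq⟩ := Option.isSome_iff_exists.1 ((hE.prinVal_isSome _).1 h4)
    obtain ⟨L', hL'⟩ := hE.wf_evalRS h2
    by_cases hd : ∃ w, DecOk k L' v w
    · obtain ⟨w, hd⟩ := hd
      exact ⟨_, _, _, _, .decTrue hq hv hL' hd hy⟩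
    · exact ⟨_, _, _, _, .decFalse hq hv hL' (not_exists.1 hd)⟩
  | register h1 h2 h3 h4 h5 =>
    simp only [Cmd.head, Option.some.injEq, Prod.mk.injEq] at hh
    obtain ⟨rfl, rfl, rfl⟩ := hh
    obtain ⟨v, U₁, hv⟩ := hE.eval_total h3 U
    obtain ⟨⟨k, L⟩, hq⟩ := Option.isSome_iff_exists.1 ((hE.prinVal_isSome _).1 h2)
    by_cases hd : ∃ k₁ L₁, RegOk k v k₁ L₁
    · obtain ⟨k₁, L₁, hd⟩ := hd
      exact ⟨_, _, _, _, .regTrue hq hv hd hl⟩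
    · exact ⟨_, _, _, _, .regFalse hq hv fun k₁ L₁ hd' => hd ⟨k₁, L₁, hd'⟩⟩
  | _ => simp [Cmd.head] at hh

/-- The block can be executed completely, in such a way that only confidential variables change. -/
def Completes (W : Finset Key) (lv : Lev) (C : Cmd) (U : Finset ℕ) (M : Mem) (s : SConf) : Prop :=
  ∃ U' M' s' σ', Relation.ReflTransGen SStep (U, M, s) (U', M', s') ∧ Exit s' σ' ∧
    SOk W True lv M' C s' ∧ Quiet lv M M'

theorem SStep.star_left {U U' : Finset ℕ} {a a' : SConf} (b : SConf)
    (hs : Relation.ReflTransGen SStep (U, M, a) (U', M', a')) :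
    Relation.ReflTransGen SStep (U, M, .par a b) (U', M', .par a' b) :=
  hs.lift (fun p : Finset ℕ × Mem × SConf => (p.1, p.2.1, SConf.par p.2.2 b)) fun _ _ h => .left h

theorem SStep.star_right {U U' : Finset ℕ} {b b' : SConf} (a : SConf)
    (hs : Relation.ReflTransGen SStep (U, M, b) (U', M', b')) :
    Relation.ReflTransGen SStep (U, M, .par a b) (U', M', .par a b') :=
  hs.lift (fun p : Finset ℕ × Mem × SConf => (p.1, p.2.1, SConf.par a p.2.2)) fun _ _ h => .right h

/-- The two sides of a parallel composition are executed one after the other. The first one does not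
change what the second one needs, except for the values of variables. -/
theorem Completes.par {C : Cmd} {a b : SConf} {U}
    (h1 : Completes W lv C U M a) (hb : SOk W True lv M C b) (hM : M.IsFinite)
    (ha : ∀ y, lv.lo y → (M.var y).isSome)
    (h2 : ∀ U M, M.IsFinite → (∀ y, lv.lo y → (M.var y).isSome) → SOk W True lv M C b →
      Completes W lv C U M b) : Completes W lv C U M (.par a b) := by
  obtain ⟨U₁, M₁, a', σ₁, e1, e2, e3, e4⟩ := h1
  have hm := SStep.star_memLe e1
  obtain ⟨U₂, M₂, b', σ₂, f1, f2, f3, f4⟩ := h2 U₁ M₁ (SStep.star_isFinite e1 hM)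
    (fun y hy => hm.var y (ha y hy)) (hb.mono hm (.refl _ _))
  exact ⟨U₂, M₂, .par a' b', σ₁, (SStep.star_left b e1).trans (SStep.star_right a' f1), .par e2 f2,
    .par (e3.mono (SStep.star_memLe f1) (.refl _ _)) f3, e4.trans f4⟩

/-- A confidential block can be executed completely, by induction on its code: it has neither replication
nor communication. -/
theorem SOk.completes_run {C : Cmd} (G : SCmd) : ∀ (σ : Env) (U : Finset ℕ) (M : Mem), M.IsFinite →
    (∀ y, lv.lo y → (M.var y).isSome) → SOk W True lv M C (.run σ G) →
    Completes W lv C U M (.run σ G) := by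
  have act : ∀ (G : SCmd) a G₁ G₂, G.head = some (a, G₁, G₂) →
      (∀ (σ : Env) (U : Finset ℕ) (M : Mem), M.IsFinite → (∀ y, lv.lo y → (M.var y).isSome) →
        SOk W True lv M C (.run σ G₁) → Completes W lv C U M (.run σ G₁)) →
      (∀ (σ : Env) (U : Finset ℕ) (M : Mem), M.IsFinite → (∀ y, lv.lo y → (M.var y).isSome) →
        SOk W True lv M C (.run σ G₂) → Completes W lv C U M (.run σ G₂)) →
      ∀ (σ : Env) (U : Finset ℕ) (M : Mem), M.IsFinite → (∀ y, lv.lo y → (M.var y).isSome) →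
        SOk W True lv M C (.run σ G) → Completes W lv C U M (.run σ G) := by
    intro G a G₁ G₂ hh ih1 ih2 σ U M hM ha hs
    have hs' := hs
    cases hs with
    | run hr =>
      obtain ⟨Γ, pc, hE, hT, hp⟩ := hr
      obtain ⟨U₁, σ₁, M₁, b, hst⟩ := ActStep.progress hE hT (SCmd.head_plug hh C) hM U
      have hst' := SStep.act hh hst
      obtain ⟨lv', g, hs₁⟩ := hst'.sOk hs' ha
      obtain rfl := g.same trivial
      have : Completes W lv' C U₁ M₁ (.run σ₁ (if b then G₁ else G₂)) := by
        cases b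
        · exact ih2 _ _ _ (hst.isFinite hM) g.alloc hs₁
        · exact ih1 _ _ _ (hst.isFinite hM) g.alloc hs₁
      obtain ⟨U₂, M₂, s₂, σ₂, e1, e2, e3, e4⟩ := this
      exact ⟨U₂, M₂, s₂, σ₂, .head hst' e1, e2, e3, (g.quiet trivial).trans e4⟩
  induction G with
  | nop => exact fun σ U M hM ha hs => ⟨U, M, _, σ, .refl, .nop, hs, .refl _ _⟩
  | cond _ _ _ _ ih1 ih2 => exact act _ _ _ _ rfl ih1 ih2
  | new _ _ _ _ _ ih => exact act _ _ _ _ rfl ih ih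
  | assign _ _ _ ih => exact act _ _ _ _ rfl ih ih
  | assignArr _ _ _ _ ih => exact act _ _ _ _ rfl ih ih
  | decrypt _ _ _ _ _ _ _ ih1 ih2 => exact act _ _ _ _ rfl ih1 ih2
  | register _ _ _ _ _ ih1 ih2 => exact act _ _ _ _ rfl ih1 ih2
  | par G₁ G₂ ih1 ih2 =>
    intro σ U M hM ha hs
    obtain ⟨lv', g, hs₁⟩ := (SStep.fork (U := U)).sOk hs ha
    obtain rfl := g.same trivial
    cases hs₁ with
    | par h1 h2 =>
      obtain ⟨U₂, M₂, s₂, σ₂, e1, e2, e3, e4⟩ := (ih1 σ U M hM ha h1).par h2 hM ha (ih2 σ)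
      exact ⟨U₂, M₂, s₂, σ₂, .head .fork e1, e2, e3, e4⟩

theorem SOk.completes {C : Cmd} (s : SConf) : ∀ (U : Finset ℕ) (M : Mem), M.IsFinite →
    (∀ y, lv.lo y → (M.var y).isSome) → SOk W True lv M C s → Completes W lv C U M s := by
  induction s with
  | run σ G => exact SOk.completes_run G σ
  | par a b iha ihb =>
    intro U M hM ha hs
    cases hs with
    | par h1 h2 => exact (iha U M hM ha h1).par h2 hM ha ihb

end CloudTypes

namespace CloudTypes

/-! ### Pairs of devices that differ in confidential data only -/

variable {W : Finset Key} {Φ Ψ : Val → Val → Prop} {U U' : Finset ℕ}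

/-- The channel `c` is an attacker channel, or one of the established channels `A`. -/
def Chan.Active (A : Finset (ℕ × ℕ × ℕ)) : Chan → Prop
  | .est id i j => (id, i, j) ∈ A
  | .att _ => True

/-- Corresponding channels of two systems with the established channels `A` and `A'`: `γ` relates
those which are used by threads that are not confidential, and `δ` those for data that are not
confidential. -/
structure Links where
  γ : Chan → Chan → Prop
  δ : Chan → Chan → Prop
  A : Finset (ℕ × ℕ × ℕ)
  A' : Finset (ℕ × ℕ × ℕ)

def Links.flip (G : Links) : Links := ⟨fun c d => G.γ d c, fun c d => G.δ d c, G.A', G.A⟩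

/-- The levels, on the first of two devices, given by the relation `b` between corresponding locations
and by corresponding channels: what corresponds to nothing is confidential. -/
def levOf (b : ℕ → ℕ → Prop) (G : Links) : Lev where
  lo y := ∃ y', b y y'
  loD c := ∃ d, G.δ c d
  loP c := ∃ d, G.γ c d
  act := Chan.Active G.A

/-- The levels on the second of two devices. -/
abbrev levOf' (b : ℕ → ℕ → Prop) (G : Links) : Lev := levOf (fun y y' => b y' y) G.flip

/-- The memories `M` and `M'` agree but for confidential variables, up to the relation `b` between
locations and up to indistinguishable values. -/
structure MemPair (W : Finset Key) (Φ : Val → Val → Prop) (b : ℕ → ℕ → Prop) (M M' : Mem) : Prop where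
  prin : M.prin = M'.prin
  key : M.key = M'.key
  safe : ∀ l k L, M.prin l = some (k, L) → k ∈ W → L ⊆ W
  fin : M.IsFinite
  fin' : M'.IsFinite
  var : ∀ y y', b y y' → ∃ v v', M.var y = some v ∧ M'.var y' = some v' ∧ Rel W Φ v v'
  inj : ∀ y y' z z', b y y' → b z z' → (y = z ↔ y' = z')

/-- Two substitutions which send the names in scope to corresponding locations and channels. -/
structure EnvPair (W : Finset Key) (b : ℕ → ℕ → Prop) (G : Links) (Γ : Ctx) (σ σ' : Env)
    (M M' : Mem) : Prop where
  left : EnvOk W Γ σ M (levOf b G)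
  right : EnvOk W Γ σ' M' (levOf' b G)
  prin : σ.prin = σ'.prin
  key : σ.key = σ'.key
  var : ∀ x S R y y', Γ.var x = some (S, R) → σ.var x = some y → σ'.var x = some y' →
    Low W σ M R → b y y'
  chan : ∀ c S R₁ R₂ ch ch', Γ.chan c = some (S, R₁, R₂) → σ.chan c = some ch →
    σ'.chan c = some ch' → (Low W σ M R₁ → G.δ ch ch') ∧ (Low W σ M R₂ → G.γ ch ch')

/-- New pairs of locations are made of locations that did not exist. -/
structure LocLe (M M' : Mem) (b b₁ : ℕ → ℕ → Prop) : Prop where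
  le : ∀ y y', b y y' → b₁ y y'
  new : ∀ y y', b₁ y y' → b y y' ∨ M.var y = none ∧ M'.var y' = none

/-- New pairs of channels are made of channels that did not exist. -/
structure LinkLe (G G₁ : Links) : Prop where
  γ_le : ∀ c d, G.γ c d → G₁.γ c d
  δ_le : ∀ c d, G.δ c d → G₁.δ c d
  γ_new : ∀ c d, G₁.γ c d → G.γ c d ∨ ¬ Chan.Active G.A c ∧ ¬ Chan.Active G.A' d
  δ_new : ∀ c d, G₁.δ c d → G.δ c d ∨ ¬ Chan.Active G.A c ∧ ¬ Chan.Active G.A' d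
  A : G.A ⊆ G₁.A
  A' : G.A' ⊆ G₁.A'

variable {b b₁ : ℕ → ℕ → Prop} {G G₁ : Links} {Γ : Ctx} {σ σ' : Env} {M M' N N' : Mem}

theorem MemPair.mono (h : MemPair W Φ b M M') (hΦ : ∀ c d, Φ c d → Ψ c d) : MemPair W Ψ b M M' :=
  { h with
    var := fun y y' hy => by
      obtain ⟨v, v', h1, h2, h3⟩ := h.var y y' hy
      exact ⟨v, v', h1, h2, h3.mono hΦ⟩ }

theorem MemPair.flip (h : MemPair W Φ b M M') :
    MemPair W (fun c d => Φ d c) (fun y y' => b y' y) M' M where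
  prin := h.prin.symm
  key := h.key.symm
  safe l k L hl := h.safe l k L (h.prin ▸ hl)
  fin := h.fin'
  fin' := h.fin
  var y y' hy := by
    obtain ⟨v, v', h1, h2, h3⟩ := h.var y' y hy
    exact ⟨v', v, h2, h1, h3.flip⟩
  inj y y' z z' h1 h2 := (h.inj _ _ _ _ h1 h2).symm

theorem MemPair.alloc (h : MemPair W Φ b M M') (y : ℕ) (hy : (levOf b G).lo y) : (M.var y).isSome := by
  obtain ⟨y', hy⟩ := hy
  obtain ⟨v, v', h1, h2, h3⟩ := h.var y y' hy
  simp [h1]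

theorem MemPair.alloc' (h : MemPair W Φ b M M') (y : ℕ) (hy : (levOf' b G).lo y) :
    (M'.var y).isSome := h.flip.alloc (G := G.flip) y hy

theorem MemPair.quiet_left (h : MemPair W Φ b M M') (hq : Quiet (levOf b G) M N) (hN : N.IsFinite) :
    MemPair W Φ b N M' where
  prin := hq.prin.trans h.prin
  key := hq.key.trans h.key
  safe l k L hl := h.safe l k L (hq.prin ▸ hl)
  fin := hN
  fin' := h.fin'
  var y y' hy := by
    rw [hq.var y ⟨y', hy⟩]
    exact h.var y y' hy
  inj := h.inj

theorem MemPair.quiet_right (h : MemPair W Φ b M M') (hq : Quiet (levOf' b G) M' N')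
    (hN : N'.IsFinite) : MemPair W Φ b M N' := (h.flip.quiet_left hq hN).flip

theorem MemPair.setVar (h : MemPair W Φ b M M') {y y' v v'}
    (hy : (b y y' ∧ Rel W Φ v v') ∨ (¬ ∃ z, b y z) ∧ ¬ ∃ z, b z y') :
    MemPair W Φ b (M.setVar y v) (M'.setVar y' v') where
  prin := h.prin
  key := h.key
  safe := h.safe
  fin := h.fin.setVar _ _
  fin' := h.fin'.setVar _ _
  inj := h.inj
  var z z' hz := by
    rcases hy with ⟨hy, hv⟩ | ⟨h1, h2⟩
    · have := h.inj _ _ _ _ hz hy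
      by_cases hzy : z = y
      · have hzy' := this.1 hzy
        subst hzy hzy'
        exact ⟨v, v', by simp [Mem.setVar], by simp [Mem.setVar], hv⟩
      · have hzy' := mt this.2 hzy
        simpa [Mem.setVar, hzy, hzy'] using h.var z z' hz
    · have hzy : z ≠ y := by rintro rfl; exact h1 ⟨_, hz⟩
      have hzy' : z' ≠ y' := by rintro rfl; exact h2 ⟨_, hz⟩
      simpa [Mem.setVar, hzy, hzy'] using h.var z z' hz

/-- The relation between locations after the creation of `y` and `y'`; they correspond to each other
if `p` holds. -/
def addLoc (b : ℕ → ℕ → Prop) (y y' : ℕ) (p : Prop) (z z' : ℕ) : Prop :=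
  b z z' ∨ (z = y ∧ z' = y' ∧ p)

theorem LocLe.refl (M M' : Mem) (b : ℕ → ℕ → Prop) : LocLe M M' b b := ⟨fun _ _ => id, fun _ _ => .inl⟩

theorem LocLe.trans {b₂ : ℕ → ℕ → Prop} (hM : MemLe M N) (hM' : MemLe M' N') (h : LocLe M M' b b₁)
    (h' : LocLe N N' b₁ b₂) : LocLe M M' b b₂ := by
  refine ⟨fun y y' hy => h'.le _ _ (h.le _ _ hy), fun y y' hy => ?_⟩
  rcases h'.new _ _ hy with hy | ⟨h1, h2⟩
  · exact h.new _ _ hy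
  · refine .inr ⟨?_, ?_⟩
    · by_contra hne
      have := hM.var y (Option.ne_none_iff_isSome.1 hne)
      simp [h1] at this
    · by_contra hne
      have := hM'.var y' (Option.ne_none_iff_isSome.1 hne)
      simp [h2] at this

theorem LinkLe.refl (G : Links) : LinkLe G G :=
  ⟨fun _ _ => id, fun _ _ => id, fun _ _ => .inl, fun _ _ => .inl, subset_rfl, subset_rfl⟩

theorem LocLe.flip (h : LocLe M M' b b₁) : LocLe M' M (fun y y' => b y' y) (fun y y' => b₁ y' y) :=
  ⟨fun y y' => h.le y' y, fun y y' hy => (h.new y' y hy).imp_right And.symm⟩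

theorem LinkLe.flip (h : LinkLe G G₁) : LinkLe G.flip G₁.flip :=
  ⟨fun c d => h.γ_le d c, fun c d => h.δ_le d c, fun c d hc => (h.γ_new d c hc).imp_right And.symm,
    fun c d hc => (h.δ_new d c hc).imp_right And.symm, h.A', h.A⟩

theorem levLe_of (hb : LocLe M M' b b₁) (hG : LinkLe G G₁) : LevLe M (levOf b G) (levOf b₁ G₁) where
  lo y hy := by
    refine ⟨?_, fun ⟨y', h⟩ => ⟨y', hb.le _ _ h⟩⟩
    rintro ⟨y', h⟩
    rcases hb.new _ _ h with h | ⟨h, -⟩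
    · exact ⟨y', h⟩
    · simp [h] at hy
  act ch hc := by
    cases ch with
    | est => exact hG.A hc
    | att => trivial
  loD ch hc := by
    refine ⟨?_, fun ⟨d, h⟩ => ⟨d, hG.δ_le _ _ h⟩⟩
    rintro ⟨d, h⟩
    rcases hG.δ_new _ _ h with h | ⟨h, -⟩
    · exact ⟨d, h⟩
    · exact absurd hc h
  loP ch hc := by
    refine ⟨?_, fun ⟨d, h⟩ => ⟨d, hG.γ_le _ _ h⟩⟩
    rintro ⟨d, h⟩
    rcases hG.γ_new _ _ h with h | ⟨h, -⟩
    · exact ⟨d, h⟩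
    · exact absurd hc h

theorem levLe_of' (hb : LocLe M M' b b₁) (hG : LinkLe G G₁) : LevLe M' (levOf' b G) (levOf' b₁ G₁) :=
  levLe_of hb.flip hG.flip

theorem sameNames_of_eq (h1 : σ.prin = σ'.prin) (h2 : σ.key = σ'.key) (h3 : M.prin = M'.prin)
    (h4 : M.key = M'.key) (R : Rights) : SameNames σ M σ' M' R := by
  cases R with
  | none => trivial
  | some RS => intro r _; cases r <;> simp [KeyRef.eval, Env.keyVal, Env.prinVal, h1, h2, h3, h4]

theorem EnvPair.sameNames (h : EnvPair W b G Γ σ σ' M M') (hM : MemPair W Φ b M M') (R : Rights) :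
    SameNames σ M σ' M' R := sameNames_of_eq h.prin h.key hM.prin hM.key R

theorem EnvPair.prinVal (h : EnvPair W b G Γ σ σ' M M') (hM : MemPair W Φ b M M') :
    σ.prinVal M = σ'.prinVal M' := by
  funext p; simp [Env.prinVal, h.prin, hM.prin]

theorem EnvPair.keyVal (h : EnvPair W b G Γ σ σ' M M') (hM : MemPair W Φ b M M') :
    σ.keyVal M = σ'.keyVal M' := by
  funext p; simp [Env.keyVal, h.key, hM.key]

theorem EnvPair.flip (h : EnvPair W b G Γ σ σ' M M') (hM : MemPair W Φ b M M') :
    EnvPair W (fun y y' => b y' y) G.flip Γ σ' σ M' M where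
  left := h.right
  right := h.left
  prin := h.prin.symm
  key := h.key.symm
  var x S R y y' hx h1 h2 hl := h.var x S R y' y hx h2 h1 ((h.sameNames hM R).low.2 hl)
  chan c S R₁ R₂ ch ch' hc h1 h2 := by
    have := h.chan c S R₁ R₂ ch' ch hc h2 h1
    exact ⟨fun hl => this.1 ((h.sameNames hM _).low.2 hl), fun hl => this.2 ((h.sameNames hM _).low.2 hl)⟩

theorem EnvPair.mono (h : EnvPair W b G Γ σ σ' M M') (hM : MemLe M N) (hM' : MemLe M' N')
    (hb : LocLe M M' b b₁) (hG : LinkLe G G₁) : EnvPair W b₁ G₁ Γ σ σ' N N' where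
  left := h.left.mono hM (levLe_of hb hG)
  right := h.right.mono hM' (levLe_of' hb hG)
  prin := h.prin
  key := h.key
  var x S R y y' hx h1 h2 hl := hb.le _ _ (h.var x S R y y' hx h1 h2 ((h.left.low_iff hM R).1 hl))
  chan c S R₁ R₂ ch ch' hc h1 h2 := by
    have := h.chan c S R₁ R₂ ch ch' hc h1 h2
    exact ⟨fun hl => hG.δ_le _ _ (this.1 ((h.left.low_iff hM _).1 hl)),
      fun hl => hG.γ_le _ _ (this.2 ((h.left.low_iff hM _).1 hl))⟩

theorem MemPair.not_loc (h : MemPair W Φ b M M') {y} (hy : M.var y = none) (z) : ¬ b y z := by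
  intro hz
  obtain ⟨v, v', h1, h2, h3⟩ := h.var y z hz
  simp [hy] at h1

theorem LocLe.addLoc {y y'} (hy : M.var y = none) (hy' : M'.var y' = none) (p : Prop) :
    LocLe M M' b (addLoc b y y' p) :=
  ⟨fun _ _ => .inl, fun z z' hz => hz.imp_right fun ⟨h1, h2, _⟩ => by subst h1 h2; exact ⟨hy, hy'⟩⟩

/-- The creation of a pair of locations. -/
theorem MemPair.addLoc (h : MemPair W Φ b M M') {y y' v v'} {p : Prop} (hy : M.var y = none)
    (hy' : M'.var y' = none) (hv : p → Rel W Φ v v') :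
    MemPair W Φ (addLoc b y y' p) (M.setVar y v) (M'.setVar y' v') := by
  have h1 := h.not_loc hy
  have h2 := h.flip.not_loc hy'
  have hs := h.setVar (v := v) (v' := v') (.inr ⟨not_exists.2 h1, not_exists.2 h2⟩)
  refine { hs with var := ?_, inj := ?_ }
  · rintro z z' (hz | ⟨rfl, rfl, hp⟩)
    · exact hs.var z z' hz
    · exact ⟨v, v', by simp [Mem.setVar], by simp [Mem.setVar], hv hp⟩
  · rintro z z' t t' (hz | ⟨rfl, rfl, hp⟩) (ht | ⟨rfl, rfl, hp'⟩)
    · exact h.inj _ _ _ _ hz ht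
    · exact ⟨fun e => by subst e; exact (h1 _ hz).elim, fun e => by subst e; exact (h2 _ hz).elim⟩
    · exact ⟨fun e => by subst e; exact (h1 _ ht).elim, fun e => by subst e; exact (h2 _ ht).elim⟩
    · simp

theorem EnvPair.addVar (h : EnvPair W b G Γ σ σ' M M') (hM : MemPair W Φ b M M') {x y y' v v' S R}
    (hy : M.var y = none) (hy' : M'.var y' = none) (hR : Γ.WfRights R) :
    EnvPair W (addLoc b y y' (Low W σ M R)) G (Γ.addVar x S R) (σ.setVar x y) (σ'.setVar x y')
      (M.setVar y v) (M'.setVar y' v') where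
  left := by
    refine h.left.addVar hR (levLe_of (LocLe.addLoc hy hy' _) (.refl _)) ⟨?_, fun hl => ⟨y', .inr ⟨rfl, rfl, hl⟩⟩⟩
    rintro ⟨z, hz | ⟨-, -, hl⟩⟩
    · exact (hM.not_loc hy _ hz).elim
    · exact hl
  right := by
    refine h.right.addVar hR (levLe_of' (LocLe.addLoc hy hy' _) (.refl _)) ⟨?_, fun hl =>
      ⟨y, .inr ⟨rfl, rfl, (h.sameNames hM R).low.2 hl⟩⟩⟩
    rintro ⟨z, hz | ⟨-, -, hl⟩⟩
    · exact (hM.flip.not_loc hy' _ hz).elim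
    · exact (h.sameNames hM R).low.1 hl
  prin := h.prin
  key := h.key
  var x' S' R' z z' hx hz hz' hl := by
    rw [low_setVar] at hl
    by_cases hxx : x' = x
    · subst hxx
      simp only [Ctx.addVar, Env.setVar, Function.update_self, Option.some.injEq, Prod.mk.injEq] at hx hz hz'
      obtain ⟨rfl, rfl⟩ := hx
      exact .inr ⟨hz.symm, hz'.symm, hl⟩
    · simp only [Ctx.addVar, Env.setVar, Function.update_of_ne hxx] at hx hz hz'
      exact .inl (h.var x' S' R' z z' hx hz hz' hl)
  chan c S R₁ R₂ ch ch' hc h1 h2 := by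
    rw [low_setVar, low_setVar]
    exact h.chan c S R₁ R₂ ch ch' hc h1 h2

theorem EnvPair.addPrin (h : EnvPair W b G Γ σ σ' M M') (hM : MemPair W Φ b M M') {p l k L}
    (hp : p ∉ Γ.prin) (hl : M.prin l = none) :
    EnvPair W b G (Γ.addPrin p) (σ.setPrin p l) (σ'.setPrin p l) (M.setPrin l k L)
      (M'.setPrin l k L) where
  left := h.left.addPrin hp hl
  right := h.right.addPrin hp (hM.prin ▸ hl)
  prin := by simp [Env.setPrin, h.prin]
  key := h.key
  var x S R y y' hx hy hy' hlow :=
    h.var x S R y y' hx hy hy' ((h.left.sameNames_setPrin hp hl (h.left.var x S R hx).1).low.2 hlow)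
  chan c S R₁ R₂ ch ch' hc h1 h2 := by
    have := h.chan c S R₁ R₂ ch ch' hc h1 h2
    have hw := h.left.chan c S R₁ R₂ hc
    exact ⟨fun hlow => this.1 ((h.left.sameNames_setPrin hp hl hw.1).low.2 hlow),
      fun hlow => this.2 ((h.left.sameNames_setPrin hp hl hw.2.1).low.2 hlow)⟩

theorem EnvPair.addKey (h : EnvPair W b G Γ σ σ' M M') (hM : MemPair W Φ b M M') {p l k}
    (hp : p ∉ Γ.key) (hl : M.key l = none) :
    EnvPair W b G (Γ.addKey p) (σ.setKey p l) (σ'.setKey p l) (M.setKey l k) (M'.setKey l k) where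
  left := h.left.addKey hp hl
  right := h.right.addKey hp (hM.key ▸ hl)
  prin := h.prin
  key := by simp [Env.setKey, h.key]
  var x S R y y' hx hy hy' hlow :=
    h.var x S R y y' hx hy hy' ((h.left.sameNames_setKey hp hl (h.left.var x S R hx).1).low.2 hlow)
  chan c S R₁ R₂ ch ch' hc h1 h2 := by
    have := h.chan c S R₁ R₂ ch ch' hc h1 h2
    have hw := h.left.chan c S R₁ R₂ hc
    exact ⟨fun hlow => this.1 ((h.left.sameNames_setKey hp hl hw.1).low.2 hlow),
      fun hlow => this.2 ((h.left.sameNames_setKey hp hl hw.2.1).low.2 hlow)⟩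

theorem MemPair.setPrin (h : MemPair W Φ b M M') {l k L} (hk : k ∈ W → L ⊆ W) :
    MemPair W Φ b (M.setPrin l k L) (M'.setPrin l k L) where
  prin := by simp [Mem.setPrin, h.prin]
  key := h.key
  safe l' k' L' hl := by
    by_cases hll : l' = l
    · subst hll
      simp only [Mem.setPrin, Function.update_self, Option.some.injEq, Prod.mk.injEq] at hl
      obtain ⟨rfl, rfl⟩ := hl
      exact hk
    · simp only [Mem.setPrin, Function.update_of_ne hll] at hl
      exact h.safe l' k' L' hl
  fin := h.fin.setPrin _ _ _
  fin' := h.fin'.setPrin _ _ _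
  var := h.var
  inj := h.inj

theorem MemPair.setKey (h : MemPair W Φ b M M') (l k) :
    MemPair W Φ b (M.setKey l k) (M'.setKey l k) where
  prin := h.prin
  key := by simp [Mem.setKey, h.key]
  safe := h.safe
  fin := h.fin.setKey _ _
  fin' := h.fin'.setKey _ _
  var := h.var
  inj := h.inj

/-! ### Simulation of evaluations and of elementary commands -/

/-- Evaluation on both sides gives indistinguishable values, unless the expression is
confidential. -/
theorem Eval.sim {e S R v U₁} (hE : EnvPair W b G Γ σ σ' M M') (hM : MemPair W Φ b M M')
    (hΦ : Pairing W U U' Φ) (he : HasType Γ e S R) (hv : Eval σ M U e v U₁) :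
    ∃ Ψ v' U₁', (∀ c d, Φ c d → Ψ c d) ∧ Pairing W U₁ U₁' Ψ ∧ Eval σ' M' U' e v' U₁' ∧
      (Low W σ M R → Rel W Ψ v v') := by
  have var : ∀ x S R v, Γ.var x = some (S, R) → σ.varVal M x = some v →
      ∃ v', σ'.varVal M' x = some v' ∧ (Low W σ M R → Rel W Φ v v') := by
    intro x S R v hx hv
    obtain ⟨-, y, h1, h2, -⟩ := hE.left.var x S R hx
    obtain ⟨-, y', h1', h2', -⟩ := hE.right.var x S R hx
    obtain ⟨v', hv'⟩ := Option.isSome_iff_exists.1 h2'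
    refine ⟨v', by simp [Env.varVal, h1', hv'], fun hl => ?_⟩
    obtain ⟨w, w', e1, e2, e3⟩ := hM.var y y' (hE.var x S R y y' hx h1 h1' hl)
    simp only [Env.varVal, h1, Option.bind_some, e1, Option.some.injEq] at hv
    rw [hv'] at e2
    cases e2
    subst hv
    exact e3
  induction he generalizing U U' Φ v U₁ with
  | var hx =>
    cases hv with
    | var hv =>
      obtain ⟨v', h1, h2⟩ := var _ _ _ _ hx hv
      exact ⟨Φ, v', U', fun _ _ => id, hΦ, .var h1, h2⟩
  | int => cases hv; exact ⟨Φ, _, U', fun _ _ => id, hΦ, .int, fun _ => .int _⟩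
  | pub hp =>
    cases hv with
    | pub hq =>
      rw [hE.prinVal hM] at hq
      exact ⟨Φ, _, U', fun _ _ => id, hΦ, .pub hq, fun _ => .pub _⟩
  | release hp =>
    cases hv with
    | @release _ p k L n hq hL hn =>
      obtain ⟨n', hn'⟩ := Infinite.exists_notMem_finset U'
      have hs : k ∈ W → L ⊆ W := by
        unfold Env.prinVal at hq
        obtain ⟨l, -, hl⟩ := Option.bind_eq_some_iff.1 hq
        exact hM.safe _ _ _ hl
      rw [hE.prinVal hM] at hq
      exact ⟨_, _, _, fun _ _ => .inl, hΦ.insert hn hn' (.inr ⟨k, L, L, rfl, rfl, hs⟩),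
        .release hq hL hn', fun _ => .cipher (.inr ⟨rfl, rfl⟩)⟩
    | releaseErr hq =>
      rw [hE.prinVal hM] at hq
      exact ⟨Φ, _, U', fun _ _ => id, hΦ, .releaseErr hq, fun _ => .nav⟩
  | @enc e RS S R hR he hsub ih =>
    cases hv with
    | @enc _ U₁ _ v _ L n hv hL hn =>
      obtain ⟨Ψ, v', U₁', h1, h2, h3, h4⟩ := ih hM hΦ hv var
      obtain ⟨n', hn'⟩ := Infinite.exists_notMem_finset U₁'
      have hL' := (hE.sameNames hM _).evalRS.symm.trans hL
      refine ⟨_, _, _, fun _ _ h => .inl (h1 _ _ h), h2.insert hn hn' (.inl ⟨v, v', L, rfl, rfl, ?_⟩),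
        .enc h3 hL' hn', fun _ => .cipher (.inr ⟨rfl, rfl⟩)⟩
      by_cases hLW : L ⊆ W
      · exact .inl hLW
      · exact .inr (h4 (((low_evalRS hL).2 hLW).mono hsub))
  | op _ _ ih1 ih2 =>
    cases hv with
    | op hv hw =>
      obtain ⟨Ψ, v', U₁', h1, h2, h3, h4⟩ := ih1 hM hΦ hv var
      obtain ⟨Ψ', w', U₂', g1, g2, g3, g4⟩ := ih2 (hM.mono h1) h2 hw fun x S R v hx hv =>
        (var x S R v hx hv).imp fun _ h => ⟨h.1, fun hl => (h.2 hl).mono h1⟩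
      refine ⟨Ψ', _, U₂', fun _ _ h => g1 _ _ (h1 _ _ h), g2, .op h3 g3, fun hl => ?_⟩
      exact ((h4 hl.of_inter.1).mono g1).binop g2 _ (g4 hl.of_inter.2)
  | arrNil => cases hv; exact ⟨Φ, _, U', fun _ _ => id, hΦ, .arrNil, fun _ => .nil⟩
  | arrCons _ _ ih1 ih2 =>
    cases hv with
    | arrCons hv hw =>
      obtain ⟨Ψ, v', U₁', h1, h2, h3, h4⟩ := ih1 hM hΦ hv var
      obtain ⟨Ψ', w', U₂', g1, g2, g3, g4⟩ := ih2 (hM.mono h1) h2 hw fun x S R v hx hv =>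
        (var x S R v hx hv).imp fun _ h => ⟨h.1, fun hl => (h.2 hl).mono h1⟩
      have : ∃ l, w' = .arr l := by cases g3 <;> exact ⟨_, rfl⟩
      obtain ⟨l, rfl⟩ := this
      exact ⟨Ψ', _, U₂', fun _ _ h => g1 _ _ (h1 _ _ h), g2, .arrCons h3 g3, fun hl =>
        .cons ((h4 hl).mono g1) (g4 hl)⟩
  | elem hx _ ih =>
    cases hv with
    | elem hw hv =>
      obtain ⟨Ψ, v', U₁', h1, h2, h3, h4⟩ := ih hM hΦ hv var
      obtain ⟨w', e1, e2⟩ := var _ _ _ _ hx hw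
      exact ⟨Ψ, _, U₁', h1, h2, .elem e1 h3, fun hl =>
        ((e2 hl.of_inter.1).mono h1).index h2 (h4 hl.of_inter.2)⟩

/-- Both sides of a pair of devices have changed, and still correspond to each other. -/
structure DevStep (W : Finset Key) (Φ : Val → Val → Prop) (b : ℕ → ℕ → Prop) (M M' : Mem)
    (Ψ : Val → Val → Prop) (b₁ : ℕ → ℕ → Prop) (N N' : Mem) (U U' : Finset ℕ) : Prop where
  le : ∀ c d, Φ c d → Ψ c d
  mem : MemLe M N
  mem' : MemLe M' N'
  loc : LocLe M M' b b₁
  pairing : Pairing W U U' Ψ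
  pair : MemPair W Ψ b₁ N N'

theorem DevStep.trans {Ξ : Val → Val → Prop} {b₂ : ℕ → ℕ → Prop} {K K' : Mem} {V V' : Finset ℕ}
    (h : DevStep W Φ b M M' Ψ b₁ N N' U U') (h' : DevStep W Ψ b₁ N N' Ξ b₂ K K' V V') :
    DevStep W Φ b M M' Ξ b₂ K K' V V' :=
  ⟨fun c d hc => h'.le c d (h.le c d hc), h.mem.trans h'.mem, h.mem'.trans h'.mem',
    h.loc.trans h.mem h.mem' h'.loc, h'.pairing, h'.pair⟩

theorem DevStep.refl (hΦ : Pairing W U U' Φ) (hM : MemPair W Φ b M M') :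
    DevStep W Φ b M M' Φ b M M' U U' :=
  ⟨fun _ _ => id, .refl _, .refl _, .refl _ _ _, hΦ, hM⟩

/-- Two substitutions for the same command, which is typable under both. -/
def RunPair (W : Finset Key) (b : ℕ → ℕ → Prop) (G : Links) (M M' : Mem) (σ σ' : Env) (C : Cmd) : Prop :=
  ∃ Γ pc, EnvPair W b G Γ σ σ' M M' ∧ WellTyped pc Γ C

/-- The command is confidential on both sides. -/
def Dropped (W : Finset Key) (b : ℕ → ℕ → Prop) (G : Links) (M M' : Mem) (σ σ' : Env) (C : Cmd) : Prop :=
  RunOk W True (levOf b G) M σ C ∧ RunOk W True (levOf' b G) M' σ' C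

theorem RunPair.mono {C} (h : RunPair W b G M M' σ σ' C) (hM : MemLe M N) (hM' : MemLe M' N')
    (hb : LocLe M M' b b₁) (hG : LinkLe G G₁) : RunPair W b₁ G₁ N N' σ σ' C := by
  obtain ⟨Γ, pc, hE, hT⟩ := h
  exact ⟨Γ, pc, hE.mono hM hM' hb hG, hT⟩

theorem EnvPair.dropped (hE : EnvPair W b G Γ σ σ' M M') (hM : MemPair W Φ b M M') {pc C}
    (hT : WellTyped pc Γ C) (hp : ¬ Low W σ M pc) : Dropped W b G M M' σ σ' C :=
  ⟨⟨Γ, pc, hE.left, hT, fun _ => hp⟩, ⟨Γ, pc, hE.right, hT, fun _ => (hE.sameNames hM pc).low.not.1 hp⟩⟩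

theorem Rights.inter_idem (pc R₁ R₂ : Rights) :
    (((pc.inter R₁).inter R₂).inter R₁).inter R₂ = (pc.inter R₁).inter R₂ := by
  cases pc <;> cases R₁ <;> cases R₂ <;> simp [Rights.inter] <;> ext r <;> simp <;> tauto

theorem Rights.inter_idem' (pc R : Rights) : (pc.inter R).inter R = pc.inter R := by
  cases pc <;> cases R <;> simp [Rights.inter]

theorem Rights.inter_inter_self (pc R : Rights) : R.inter (pc.inter R) = R.inter pc := by
  cases pc <;> cases R <;> simp [Rights.inter]
  ext r
  simp
  tauto

/-- The results of a decryption are indistinguishable unless the variable for them is confidential: the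
rights of the variable contain all keys of the cipher. -/
theorem DecOk.sim (hΦ : Pairing W U U' Φ) {k L w w' v} (hw : Rel W Φ w w') (h : DecOk k L w v) :
    ∃ v', DecOk k L w' v' ∧ (¬ L ⊆ W → Rel W Φ v v') := by
  obtain ⟨n, L', rfl, h1, h2⟩ := h
  obtain ⟨v', n', rfl, h3⟩ := hw.of_enc hΦ
  exact ⟨v', ⟨n', L', rfl, h1, h2⟩, fun hL => h3.resolve_left fun h => hL (h2.trans h)⟩

theorem RegOk.sim (hΦ : Pairing W U U' Φ) {k w w' k₁ L₁} (hw : Rel W Φ w w') (h : RegOk k w k₁ L₁) :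
    RegOk k w' k₁ L₁ ∧ (k₁ ∈ W → L₁ ⊆ W) := by
  obtain ⟨n, rfl, h1⟩ := h
  obtain ⟨n', rfl, h2⟩ := hw.of_encPrin hΦ
  exact ⟨⟨n', rfl, h1⟩, h2⟩

/-- An elementary command is matched by the same one on the other side, unless it is, or starts, a
confidential part of the code. In the latter case it branches on confidential data. The rule for such a
command depends on `pc` only through the `pc` of its branches, so it is also typable with that `pc`, and
the whole command may be regarded as confidential. -/
theorem ActStep.sim {C C₁ C₂ : Cmd} {a pc U₁ σ₁ N br} (hE : EnvPair W b G Γ σ σ' M M')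
    (hM : MemPair W Φ b M M') (hΦ : Pairing W U U' Φ) (hT : WellTyped pc Γ C)
    (hh : C.head = some (a, C₁, C₂)) (hs : ActStep U σ M a U₁ σ₁ N br) :
    Dropped W b G M M' σ σ' C ∨ ∃ Ψ b₁ U₁' σ₁' N', ActStep U' σ' M' a U₁' σ₁' N' br ∧
      DevStep W Φ b M M' Ψ b₁ N N' U₁ U₁' ∧ RunPair W b₁ G N N' σ₁ σ₁' (if br then C₁ else C₂) := by
  by_cases hpc : Low W σ M pc
  swap
  · exact .inl (hE.dropped hM hT hpc)
  obtain ⟨y', hy'⟩ := exists_fresh hM.fin'.1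
  have hT' := hT
  cases hT with
  | @cond _ _ e₁ e₂ _ _ S R₁ R₂ h1 h2 h3 h4 =>
    simp only [Cmd.head, Option.some.injEq, Prod.mk.injEq] at hh
    obtain ⟨rfl, rfl, rfl⟩ := hh
    by_cases hp : Low W σ M ((pc.inter R₁).inter R₂)
    swap
    · left
      refine hE.dropped hM (.cond h1 h2 ?_ ?_) hp <;> rw [Rights.inter_idem] <;> assumption
    right
    have hR := hp.of_inter.1.of_inter.2
    cases hs with
    | condTrue hv hw =>
      obtain ⟨Ψ, v', V, i1, i2, i3, i4⟩ := hv.sim hE hM hΦ h1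
      obtain ⟨Ψ', w', V', j1, j2, j3, j4⟩ := hw.sim hE (hM.mono i1) i2 h2
      have := (((i4 hR).mono j1).unique j2 (j4 hp.of_inter.2))
      subst this
      exact ⟨Ψ', b, _, _, _, .condTrue i3 j3, ⟨fun _ _ h => j1 _ _ (i1 _ _ h), .refl _, .refl _,
        .refl _ _ _, j2, hM.mono fun _ _ h => j1 _ _ (i1 _ _ h)⟩, Γ, _, hE, h3⟩
    | condFalse hv hw hne =>
      obtain ⟨Ψ, v', V, i1, i2, i3, i4⟩ := hv.sim hE hM hΦ h1
      obtain ⟨Ψ', w', V', j1, j2, j3, j4⟩ := hw.sim hE (hM.mono i1) i2 h2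
      have := (((i4 hR).mono j1).eq_iff j2 (j4 hp.of_inter.2)).not.1 hne
      exact ⟨Ψ', b, _, _, _, .condFalse i3 j3 this, ⟨fun _ _ h => j1 _ _ (i1 _ _ h), .refl _, .refl _,
        .refl _ _ _, j2, hM.mono fun _ _ h => j1 _ _ (i1 _ _ h)⟩, Γ, _, hE, h4⟩
  | new h1 h2 h3 h4 h5 h6 =>
    simp only [Cmd.head, Option.some.injEq, Prod.mk.injEq] at hh
    obtain ⟨rfl, rfl, rfl⟩ := hh
    cases hs with
    | new hv hy =>
      obtain ⟨Ψ, v', V, i1, i2, i3, i4⟩ := hv.sim hE hM hΦ h3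
      exact .inr ⟨Ψ, _, _, _, _, .new i3 hy', ⟨i1, .setVar _ _ _, .setVar _ _ _, .addLoc hy hy' _, i2,
        (hM.mono i1).addLoc hy hy' fun hl => i4 (hl.mono h4).of_inter.2⟩, _, _,
        hE.addVar hM hy hy' h2, h6⟩
  | @assign _ _ _ _ _ _ R₁ _ h1 h2 h3 h4 =>
    simp only [Cmd.head, Option.some.injEq, Prod.mk.injEq] at hh
    obtain ⟨rfl, rfl, rfl⟩ := hh
    cases hs with
    | assign hv hy hyM =>
      cases h1 with
      | var h1 =>
        obtain ⟨Ψ, v', V, i1, i2, i3, i4⟩ := hv.sim hE hM hΦ h2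
        obtain ⟨-, z, e1, e2, e3⟩ := hE.left.var _ _ _ h1
        obtain ⟨-, z', f1, f2, f3⟩ := hE.right.var _ _ _ h1
        rw [hy] at e1
        cases e1
        refine .inr ⟨Ψ, b, _, _, _, .assign i3 f1 f2, ⟨i1, .setVar _ _ _, .setVar _ _ _, .refl _ _ _, i2,
          (hM.mono i1).setVar ?_⟩, Γ, pc, hE.mono (.setVar _ _ _) (.setVar _ _ _) (.refl _ _ _) (.refl _), h4⟩
        by_cases hl : Low W σ M R₁
        · exact .inl ⟨hE.var _ _ _ _ _ h1 hy f1 hl, i4 (hl.mono h3).of_inter.2⟩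
        · exact .inr ⟨e3.not.2 hl, f3.not.2 ((hE.sameNames hM _).low.not.1 hl)⟩
  | @assignArr _ _ _ _ _ _ _ _ _ R₃ h0 h1 h2 h3 h4 =>
    simp only [Cmd.head, Option.some.injEq, Prod.mk.injEq] at hh
    obtain ⟨rfl, rfl, rfl⟩ := hh
    cases hs with
    | assignArr hv hw hy hyM =>
      cases h2 with
      | var h2 =>
        obtain ⟨Ψ, v', V, i1, i2, i3, i4⟩ := hv.sim hE hM hΦ h0
        obtain ⟨Ψ', w', V', j1, j2, j3, j4⟩ := hw.sim hE (hM.mono i1) i2 h1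
        obtain ⟨-, z, e1, e2, e3⟩ := hE.left.var _ _ _ h2
        obtain ⟨-, z', f1, f2, f3⟩ := hE.right.var _ _ _ h2
        obtain ⟨t, ht⟩ := Option.isSome_iff_exists.1 f2
        rw [hy] at e1
        cases e1
        have hle : ∀ c d, Φ c d → Ψ' c d := fun _ _ h => j1 _ _ (i1 _ _ h)
        refine .inr ⟨Ψ', b, _, _, _, .assignArr i3 j3 f1 ht, ⟨hle, .setVar _ _ _, .setVar _ _ _,
          .refl _ _ _, j2, (hM.mono hle).setVar ?_⟩, Γ, pc,
          hE.mono (.setVar _ _ _) (.setVar _ _ _) (.refl _ _ _) (.refl _), h4⟩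
        by_cases hl : Low W σ M R₃
        · have hb := hE.var _ _ _ _ _ h2 hy f1 hl
          refine .inl ⟨hb, ?_⟩
          obtain ⟨u, u', k1, k2, k3⟩ := hM.var _ _ hb
          rw [hyM] at k1
          rw [ht] at k2
          cases k1
          cases k2
          have := hl.mono h3
          exact (k3.mono hle).setIndex j2 ((i4 this.of_inter.1.of_inter.2).mono j1) (j4 this.of_inter.2)
        · exact .inr ⟨e3.not.2 hl, f3.not.2 ((hE.sameNames hM _).low.not.1 hl)⟩
  | @decrypt _ _ p e x S RS R₂ _ _ h1 h2 h3 h4 h5 h6 h7 h8 =>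
    simp only [Cmd.head, Option.some.injEq, Prod.mk.injEq] at hh
    obtain ⟨rfl, rfl, rfl⟩ := hh
    by_cases hp : Low W σ M (pc.inter R₂)
    swap
    · left
      refine hE.dropped hM (.decrypt h1 h2 h3 h4 h5 ?_ ?_ ?_) hp
      · rwa [Rights.inter_inter_self]
      · rwa [Rights.inter_idem']
      · rwa [Rights.inter_idem']
    right
    cases hs with
    | decTrue hq hv hL hd hy =>
      obtain ⟨Ψ, v', V, i1, i2, i3, i4⟩ := hv.sim hE hM hΦ h5
      obtain ⟨u, hu, hu'⟩ := hd.sim i2 (i4 hp.of_inter.2)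
      exact ⟨Ψ, _, _, _, _, .decTrue (hE.prinVal hM ▸ hq) i3 ((hE.sameNames hM _).evalRS ▸ hL) hu hy',
        ⟨i1, .setVar _ _ _, .setVar _ _ _, .addLoc hy hy' _, i2,
          (hM.mono i1).addLoc hy hy' fun hl => hu' ((low_evalRS hL).1 hl)⟩, _, _,
        hE.addVar hM hy hy' h2, h7⟩
    | decFalse hq hv hL hd =>
      obtain ⟨Ψ, v', V, i1, i2, i3, i4⟩ := hv.sim hE hM hΦ h5
      refine ⟨Ψ, b, _, _, _, .decFalse (hE.prinVal hM ▸ hq) i3 ((hE.sameNames hM _).evalRS ▸ hL) ?_,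
        ⟨i1, .refl _, .refl _, .refl _ _ _, i2, hM.mono i1⟩, Γ, _, hE, h8⟩
      intro u hu
      obtain ⟨t, ht, -⟩ := hu.sim i2.flip (i4 hp.of_inter.2).flip
      exact hd t ht
  | register h1 h2 h3 h4 h5 =>
    simp only [Cmd.head, Option.some.injEq, Prod.mk.injEq] at hh
    obtain ⟨rfl, rfl, rfl⟩ := hh
    right
    cases hs with
    | regTrue hq hv hd hl =>
      obtain ⟨Ψ, v', V, i1, i2, i3, i4⟩ := hv.sim hE hM hΦ h3
      obtain ⟨hd', hd''⟩ := hd.sim i2 (i4 trivial)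
      have hl' := hM.prin ▸ hl
      exact ⟨Ψ, b, _, _, _, .regTrue (hE.prinVal hM ▸ hq) i3 hd' hl',
        ⟨i1, .setPrin hl _ _, .setPrin hl' _ _, .refl _ _ _, i2, (hM.mono i1).setPrin hd''⟩, _, _,
        hE.addPrin hM h1 hl, h4⟩
    | regFalse hq hv hd =>
      obtain ⟨Ψ, v', V, i1, i2, i3, i4⟩ := hv.sim hE hM hΦ h3
      refine ⟨Ψ, b, _, _, _, .regFalse (hE.prinVal hM ▸ hq) i3 ?_,
        ⟨i1, .refl _, .refl _, .refl _ _ _, i2, hM.mono i1⟩, Γ, _, hE, h5⟩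
      intro k₁ L₁ hu
      exact hd _ _ (hu.sim i2.flip (i4 trivial).flip).1
  | _ => simp [Cmd.head] at hh

end CloudTypes

namespace CloudTypes

variable {W : Finset Key} {Φ Ψ : Val → Val → Prop} {U U' : Finset ℕ}
  {b b₁ : ℕ → ℕ → Prop} {G G₁ : Links} {Γ : Ctx} {σ σ' : Env} {M M' N N' : Mem}

/-! ### Simulation of blocks and of threads -/

/-- Corresponding states of a block on both sides. Where the block has entered confidential code, the
two states have nothing in common. -/
inductive SRel (W : Finset Key) (b : ℕ → ℕ → Prop) (G : Links) (M M' : Mem) (C : Cmd) :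
    SConf → SConf → Prop
  | run {σ σ' S} : RunPair W b G M M' σ σ' (S.plug C) → SRel W b G M M' C (.run σ S) (.run σ' S)
  | high {s s'} : SOk W True (levOf b G) M C s → SOk W True (levOf' b G) M' C s' →
      SRel W b G M M' C s s'
  | par {s s' t t'} : SRel W b G M M' C s s' → SRel W b G M M' C t t' →
      SRel W b G M M' C (.par s t) (.par s' t')

theorem SRel.mono {C s s'} (h : SRel W b G M M' C s s') (hM : MemLe M N) (hM' : MemLe M' N')
    (hb : LocLe M M' b b₁) : SRel W b₁ G N N' C s s' := by
  induction h with
  | run h => exact .run (h.mono hM hM' hb (.refl _))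
  | high h h' => exact .high (h.mono hM (levLe_of hb (.refl _))) (h'.mono hM' (levLe_of' hb (.refl _)))
  | par _ _ ih1 ih2 => exact .par ih1 ih2

/-- A confidential step of the first side alone. -/
theorem DevStep.quiet {V : Finset ℕ} (hΦ : Pairing W U U' Φ) (hM : MemPair W Φ b M M') (hU : U ⊆ V)
    (hm : MemLe M N) (hq : Quiet (levOf b G) M N) (hN : N.IsFinite) :
    DevStep W Φ b M M' Φ b N M' V U' := by
  refine ⟨fun _ _ => id, hm, .refl _, ⟨fun _ _ => id, fun _ _ => .inl⟩, hΦ.mono hU subset_rfl,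
    hM.quiet_left hq hN⟩

/-- A step of a confidential part of a block needs no counterpart. -/
theorem SStep.sim_high {C : Cmd} {p q : Finset ℕ × Mem × SConf} {s'} (hs : SStep p q)
    (hM : MemPair W Φ b p.2.1 M') (hΦ : Pairing W p.1 U' Φ) (h : SOk W True (levOf b G) p.2.1 C p.2.2)
    (h' : SOk W True (levOf' b G) M' C s') :
    DevStep W Φ b p.2.1 M' Φ b q.2.1 M' q.1 U' ∧ SRel W b G q.2.1 M' C q.2.2 s' := by
  obtain ⟨lv', g, e⟩ := hs.sOk h hM.alloc
  obtain rfl := g.same trivial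
  exact ⟨.quiet hΦ hM hs.used_mono g.mem (g.quiet trivial) (hs.isFinite hM.fin), .high e h'⟩

theorem SStep.sim {C : Cmd} {p q : Finset ℕ × Mem × SConf} (hs : SStep p q) : ∀ {M' U' s'},
    MemPair W Φ b p.2.1 M' → Pairing W p.1 U' Φ → SRel W b G p.2.1 M' C p.2.2 s' →
    ∃ Ψ b₁ U₁' N' s₁', Relation.ReflTransGen SStep (U', M', s') (U₁', N', s₁') ∧
      DevStep W Φ b p.2.1 M' Ψ b₁ q.2.1 N' q.1 U₁' ∧ SRel W b₁ G q.2.1 N' C q.2.2 s₁' := by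
  induction hs with
  | @act U U₁ σ σ₁ M N S a S₁ S₂ br hh hst =>
    intro M' U' s' hM hΦ hr
    have hs := SStep.act hh hst
    cases hr with
    | high h h' =>
      obtain ⟨h1, h2⟩ := hs.sim_high hM hΦ h h'
      exact ⟨_, _, _, _, _, .refl, h1, h2⟩
    | @run _ σ' _ hr =>
      obtain ⟨Γ, pc, hE, hT⟩ := hr
      rcases hst.sim hE hM hΦ hT (SCmd.head_plug hh C) with ⟨h, h'⟩ |
        ⟨Ψ, b₁, U₁', σ₁', N', h1, h2, h3⟩
      · obtain ⟨h1, h2⟩ := hs.sim_high (s' := .run σ' S) hM hΦ (.run h) (.run h')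
        exact ⟨_, _, _, _, _, .refl, h1, h2⟩
      · refine ⟨Ψ, b₁, U₁', N', _, .single (.act hh h1), h2, .run ?_⟩
        cases br <;> exact h3
  | fork =>
    intro M' U' s' hM hΦ hr
    cases hr with
    | high h h' =>
      obtain ⟨h1, h2⟩ := SStep.fork.sim_high hM hΦ h h'
      exact ⟨_, _, _, _, _, .refl, h1, h2⟩
    | run hr =>
      obtain ⟨Γ, pc, hE, hT⟩ := hr
      cases hT with
      | par h1 h2 =>
        exact ⟨Φ, b, U', M', _, .single .fork, .refl hΦ hM, .par (.run ⟨Γ, pc, hE, h1⟩) (.run ⟨Γ, pc, hE, h2⟩)⟩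
  | left hs ih =>
    intro M' U' s' hM hΦ hr
    cases hr with
    | high h h' =>
      obtain ⟨h1, h2⟩ := hs.left.sim_high hM hΦ h h'
      exact ⟨_, _, _, _, _, .refl, h1, h2⟩
    | par h h' =>
      obtain ⟨Ψ, b₁, U₁', N', s₁', h1, h2, h3⟩ := ih hM hΦ h
      exact ⟨Ψ, b₁, U₁', N', _, SStep.star_left _ h1, h2, .par h3 (h'.mono h2.mem h2.mem' h2.loc)⟩
  | right hs ih =>
    intro M' U' s' hM hΦ hr
    cases hr with
    | high h h' =>
      obtain ⟨h1, h2⟩ := hs.right.sim_high hM hΦ h h'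
      exact ⟨_, _, _, _, _, .refl, h1, h2⟩
    | par h h' =>
      obtain ⟨Ψ, b₁, U₁', N', s₁', h1, h2, h3⟩ := ih hM hΦ h'
      exact ⟨Ψ, b₁, U₁', N', _, SStep.star_right _ h1, h2, .par (h.mono h2.mem h2.mem' h2.loc) h3⟩

theorem SStep.star_sim {C : Cmd} {p q : Finset ℕ × Mem × SConf} (hs : Relation.ReflTransGen SStep p q)
    {s'} (hM : MemPair W Φ b p.2.1 M') (hΦ : Pairing W p.1 U' Φ) (hr : SRel W b G p.2.1 M' C p.2.2 s') :
    ∃ Ψ b₁ U₁' N' s₁', Relation.ReflTransGen SStep (U', M', s') (U₁', N', s₁') ∧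
      DevStep W Φ b p.2.1 M' Ψ b₁ q.2.1 N' q.1 U₁' ∧ SRel W b₁ G q.2.1 N' C q.2.2 s₁' := by
  induction hs with
  | refl => exact ⟨Φ, b, U', M', s', .refl, .refl hΦ hM, hr⟩
  | tail _ hs ih =>
    obtain ⟨Ψ, b₁, U₁', N', s₁', h1, h2, h3⟩ := ih
    obtain ⟨Ξ, b₂, U₂', K', s₂', g1, g2, g3⟩ := hs.sim h2.pair h2.pairing h3
    exact ⟨Ξ, b₂, U₂', K', s₂', h1.trans g1, h2.trans g2, g3⟩

/-- When a block is finished on one side, the confidential parts that remain on the other side can be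
completed. -/
theorem SRel.complete {C : Cmd} {s : SConf} (he : Exit s σ) : ∀ {U M' U' s'},
    MemPair W Φ b M M' → Pairing W U U' Φ → SRel W b G M M' C s s' →
    ∃ U₁' N' s₁' σ', Relation.ReflTransGen SStep (U', M', s') (U₁', N', s₁') ∧ Exit s₁' σ' ∧
      DevStep W Φ b M M' Φ b M N' U U₁' ∧ SRel W b G M N' C s s₁' ∧
      (RunPair W b G M N' σ σ' C ∨ Dropped W b G M N' σ σ' C) := by
  have high : ∀ {s : SConf} {σ} (_ : Exit s σ) {U M' U' s'}, MemPair W Φ b M M' → Pairing W U U' Φ →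
      SOk W True (levOf b G) M C s → SOk W True (levOf' b G) M' C s' →
      ∃ U₁' N' s₁' σ', Relation.ReflTransGen SStep (U', M', s') (U₁', N', s₁') ∧ Exit s₁' σ' ∧
      DevStep W Φ b M M' Φ b M N' U U₁' ∧ SRel W b G M N' C s s₁' ∧
      (RunPair W b G M N' σ σ' C ∨ Dropped W b G M N' σ σ' C) := by
    intro s σ he U M' U' s' hM hΦ h h'
    obtain ⟨U₁', N', s₁', σ', h1, h2, h3, h4⟩ := h'.completes s' U' M' hM.fin' hM.alloc'
    have hN := SStep.star_isFinite h1 hM.fin'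
    exact ⟨U₁', N', s₁', σ', h1, h2, ⟨fun _ _ => id, .refl _, SStep.star_memLe h1, .refl _ _ _,
      hΦ.mono subset_rfl (SStep.star_used_mono h1), hM.quiet_right h4 hN⟩, .high h h3,
      .inr ⟨h.exit he, h3.exit h2⟩⟩
  induction he with
  | nop =>
    intro U M' U' s' hM hΦ hr
    cases hr with
    | high h h' => exact high .nop hM hΦ h h'
    | @run _ σ' _ hr => exact ⟨U', M', _, σ', .refl, .nop, .refl hΦ hM, .run hr, .inl hr⟩
  | par he he' ih ih' =>
    intro U M' U' s' hM hΦ hr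
    cases hr with
    | high h h' => exact high (.par he he') hM hΦ h h'
    | par h h' =>
      obtain ⟨U₁', N', s₁', σ', h1, h2, h3, h4, h5⟩ := ih hM hΦ h
      obtain ⟨U₂', K', s₂', σ₂', g1, g2, g3, g4, g5⟩ := ih' h3.pair h3.pairing
        (h'.mono h3.mem h3.mem' h3.loc)
      refine ⟨U₂', K', _, σ', (SStep.star_left _ h1).trans (SStep.star_right _ g1), .par h2 g2,
        h3.trans g3, .par (h4.mono g3.mem g3.mem' g3.loc) g4, ?_⟩
      exact h5.imp (fun h => h.mono g3.mem g3.mem' g3.loc (.refl _)) fun h =>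
        ⟨h.1, h.2.mono g3.mem' (.refl _ _)⟩

/-- Corresponding threads. -/
def TPair (W : Finset Key) (b : ℕ → ℕ → Prop) (G : Links) (M M' : Mem) (t t' : Thread) : Prop :=
  ∃ σ σ' C, t = .run σ C ∧ t' = .run σ' C ∧ RunPair W b G M M' σ σ' C

/-- The threads of a pair of devices: corresponding threads, and any confidential threads on either
side. -/
def ThreadsPair (W : Finset Key) (b : ℕ → ℕ → Prop) (G : Links) (M M' : Mem)
    (T T' : Multiset Thread) : Prop :=
  ∃ (Q : Multiset (Thread × Thread)) (H H' : Multiset Thread),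
    T = Q.map Prod.fst + H ∧ T' = Q.map Prod.snd + H' ∧ (∀ q ∈ Q, TPair W b G M M' q.1 q.2) ∧
    (∀ t ∈ H, TOk W True (levOf b G) M t) ∧ ∀ t ∈ H', TOk W True (levOf' b G) M' t

theorem ThreadsPair.mono {T T'} (h : ThreadsPair W b G M M' T T') (hM : MemLe M N) (hM' : MemLe M' N')
    (hb : LocLe M M' b b₁) (hG : LinkLe G G₁) : ThreadsPair W b₁ G₁ N N' T T' := by
  obtain ⟨Q, H, H', h1, h2, h3, h4, h5⟩ := h
  refine ⟨Q, H, H', h1, h2, fun q hq => ?_, fun t ht => (h4 t ht).mono hM (levLe_of hb hG),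
    fun t ht => (h5 t ht).mono hM' (levLe_of' hb hG)⟩
  obtain ⟨σ, σ', C, e1, e2, e3⟩ := h3 q hq
  exact ⟨σ, σ', C, e1, e2, e3.mono hM hM' hb hG⟩

theorem ThreadsPair.flip {T T'} (h : ThreadsPair W b G M M' T T') (hM : MemPair W Φ b M M') :
    ThreadsPair W (fun y y' => b y' y) G.flip M' M T' T := by
  obtain ⟨Q, H, H', h1, h2, h3, h4, h5⟩ := h
  refine ⟨Q.map Prod.swap, H', H, by simp [h2], by simp [h1], ?_, h5, h4⟩
  simp only [Multiset.mem_map, forall_exists_index, and_imp]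
  rintro _ q hq rfl
  obtain ⟨σ, σ', C, e1, e2, Γ, pc, hE, hT⟩ := h3 q hq
  exact ⟨σ', σ, C, e2, e1, Γ, pc, hE.flip hM, hT⟩

theorem ThreadsPair.add {T T' S S'} (h : ThreadsPair W b G M M' T T') (g : ThreadsPair W b G M M' S S') :
    ThreadsPair W b G M M' (T + S) (T' + S') := by
  obtain ⟨Q, H, H', rfl, rfl, h3, h4, h5⟩ := h
  obtain ⟨P, K, K', rfl, rfl, g3, g4, g5⟩ := g
  refine ⟨Q + P, H + K, H' + K', ?_, ?_, ?_, ?_, ?_⟩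
  · rw [Multiset.map_add]; abel
  · rw [Multiset.map_add]; abel
  all_goals
    intro q hq
    rcases Multiset.mem_add.1 hq with hq | hq
    all_goals first | exact h3 q hq | exact g3 q hq | exact h4 q hq | exact g4 q hq | exact h5 q hq | exact g5 q hq

theorem ThreadsPair.of_left {T : Multiset Thread} (h : ∀ t ∈ T, TOk W True (levOf b G) M t) :
    ThreadsPair W b G M M' T 0 := ⟨0, T, 0, by simp, by simp, by simp, h, by simp⟩

theorem ThreadsPair.of_right {T : Multiset Thread} (h : ∀ t ∈ T, TOk W True (levOf' b G) M' t) :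
    ThreadsPair W b G M M' 0 T := ⟨0, 0, T, by simp, by simp, by simp, by simp, h⟩

theorem ThreadsPair.single {C} (h : RunPair W b G M M' σ σ' C) :
    ThreadsPair W b G M M' {.run σ C} {.run σ' C} :=
  ⟨{(.run σ C, .run σ' C)}, 0, 0, by simp, by simp, by simpa using ⟨σ, σ', C, rfl, rfl, h⟩, by simp,
    by simp⟩

theorem ThreadsPair.cons {T T' C} (h : RunPair W b G M M' σ σ' C) (g : ThreadsPair W b G M M' T T') :
    ThreadsPair W b G M M' (.run σ C ::ₘ T) (.run σ' C ::ₘ T') := (ThreadsPair.single h).add g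

theorem ThreadsPair.cons_left {T T' t} (h : TOk W True (levOf b G) M t)
    (g : ThreadsPair W b G M M' T T') : ThreadsPair W b G M M' (t ::ₘ T) T' := by
  have := (ThreadsPair.of_left (W := W) (b := b) (G := G) (M := M) (M' := M') (T := {t}) (by simpa using h)).add g
  simpa using this

theorem ThreadsPair.cons_right {T T' t} (h : TOk W True (levOf' b G) M' t)
    (g : ThreadsPair W b G M M' T T') : ThreadsPair W b G M M' T (t ::ₘ T') := by
  have := (ThreadsPair.of_right (W := W) (b := b) (G := G) (M := M) (M' := M') (T := {t}) (by simpa using h)).add g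
  simpa using this

theorem ThreadsPair.uncons {T T' t} (h : ThreadsPair W b G M M' (t ::ₘ T) T') :
    (TOk W True (levOf b G) M t ∧ ThreadsPair W b G M M' T T') ∨
    ∃ t' T₀', T' = t' ::ₘ T₀' ∧ TPair W b G M M' t t' ∧ ThreadsPair W b G M M' T T₀' := by
  obtain ⟨Q, H, H', h1, h2, h3, h4, h5⟩ := h
  have ht : t ∈ Q.map Prod.fst + H := h1 ▸ Multiset.mem_cons_self t T
  rcases Multiset.mem_add.1 ht with ht | ht
  · obtain ⟨q, hq, rfl⟩ := Multiset.mem_map.1 ht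
    obtain ⟨Q₀, rfl⟩ := Multiset.exists_cons_of_mem hq
    rw [Multiset.map_cons, Multiset.cons_add, Multiset.cons_inj_right] at h1
    rw [Multiset.map_cons, Multiset.cons_add] at h2
    exact .inr ⟨q.2, _, h2, h3 q hq, Q₀, H, H', h1, rfl,
      fun p hp => h3 p (Multiset.mem_cons_of_mem hp), h4, h5⟩
  · obtain ⟨H₀, rfl⟩ := Multiset.exists_cons_of_mem ht
    rw [Multiset.add_cons, Multiset.cons_inj_right] at h1
    exact .inl ⟨h4 t ht, Q, H₀, H', h1, h2, h3, fun p hp => h4 p (Multiset.mem_cons_of_mem hp), h5⟩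

/-- A thread with confidential code may be regarded as one without counterpart. -/
theorem ThreadsPair.uncons_high {T T' C} (h : ThreadsPair W b G M M' (.run σ C ::ₘ T) T')
    (hd : ∀ σ', RunPair W b G M M' σ σ' C → Dropped W b G M M' σ σ' C) :
    RunOk W True (levOf b G) M σ C ∧ ThreadsPair W b G M M' T T' := by
  rcases h.uncons with h | ⟨t', T₀', rfl, ⟨σ₁, σ', C', h1, rfl, h2⟩, h3⟩
  · exact h
  · cases h1
    have := hd σ' h2
    exact ⟨this.1, .cons_right this.2 h3⟩

/-- A thread with code that is not confidential has a counterpart. -/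
theorem ThreadsPair.uncons_low {T T' C} (h : ThreadsPair W b G M M' (.run σ C ::ₘ T) T')
    (hd : ¬ RunOk W True (levOf b G) M σ C) :
    ∃ σ' T₀', T' = .run σ' C ::ₘ T₀' ∧ RunPair W b G M M' σ σ' C ∧ ThreadsPair W b G M M' T T₀' := by
  rcases h.uncons with h | ⟨t', T₀', rfl, ⟨σ₁, σ', C', h1, rfl, h2⟩, h3⟩
  · exact absurd h.1 hd
  · cases h1
    exact ⟨σ', T₀', rfl, h2, h3⟩

theorem LStep.used_mono {u u₁ t ev ts} (hs : LStep u M t ev u₁ N ts) :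
    u.nonces ⊆ u₁.nonces ∧ u.keys ⊆ u₁.keys := by
  cases hs with
  | act _ hs => exact ⟨hs.used_mono, subset_rfl⟩
  | par => exact ⟨subset_rfl, subset_rfl⟩
  | bang => exact ⟨subset_rfl, subset_rfl⟩
  | letKey hv _ => exact ⟨hv.used_mono, subset_rfl⟩
  | newPrin => exact ⟨subset_rfl, Finset.subset_insert _ _⟩
  | sync hs _ => exact ⟨SStep.star_used_mono hs, subset_rfl⟩
  | set => exact ⟨subset_rfl, subset_rfl⟩

/-- A thread reduces in the same way as its counterpart, unless it is, or becomes, confidential. -/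
theorem LStep.sim {u u' : Used} {C ev u₁ ts} (hr : RunPair W b G M M' σ σ' C) (hM : MemPair W Φ b M M')
    (hΦ : Pairing W u.nonces u'.nonces Φ) (hk : u.keys = u'.keys) (hW : ∀ n, Key.hon n ∈ W → n ∈ u.keys)
    (hs : LStep u M (.run σ C) ev u₁ N ts) :
    Dropped W b G M M' σ σ' C ∨ ∃ ev' Ψ b₁ u₁' N' ts', LStep u' M' (.run σ' C) ev' u₁' N' ts' ∧
      DevStep W Φ b M M' Ψ b₁ N N' u₁.nonces u₁'.nonces ∧ u₁.keys = u₁'.keys ∧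
      ThreadsPair W b₁ G N N' ts ts' := by
  have hr' := hr
  obtain ⟨Γ, pc, hE, hT⟩ := hr
  cases hs with
  | act hh hs =>
    rcases hs.sim hE hM hΦ hT hh with h | ⟨Ψ, b₁, U₁', σ₁', N', h1, h2, h3⟩
    · exact .inl h
    · exact .inr ⟨none, Ψ, b₁, { u' with nonces := U₁' }, N', _, .act hh h1, h2, hk, .single h3⟩
  | par =>
    cases hT with
    | par h1 h2 =>
      exact .inr ⟨none, Φ, b, u', M', _, .par, .refl hΦ hM, hk,
        .cons ⟨Γ, pc, hE, h1⟩ (.single ⟨Γ, pc, hE, h2⟩)⟩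
  | bang =>
    cases hT with
    | bang h1 =>
      exact .inr ⟨none, Φ, b, u', M', _, .bang, .refl hΦ hM, hk, .cons ⟨Γ, pc, hE, h1⟩ (.single hr')⟩
  | letKey hv hl =>
    cases hT with
    | letKey h1 h2 h3 =>
      obtain ⟨Ψ, v', V, i1, i2, i3, i4⟩ := hv.sim hE hM hΦ h2
      obtain rfl := (i4 trivial).of_pub i2
      have hl' := hM.key ▸ hl
      exact .inr ⟨none, Ψ, b, _, _, _, .letKey i3 hl', ⟨i1, .setKey hl _, .setKey hl' _, .refl _ _ _, i2,
        (hM.mono i1).setKey _ _⟩, hk, .single ⟨_, _, hE.addKey hM h1 hl, h3⟩⟩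
  | newPrin hL hkf hl =>
    cases hT with
    | newPrin h1 h2 h3 =>
      -- the key is fresh, hence not in `W`, which imposes no condition on the rights of the principal
      have hl' := hM.prin ▸ hl
      exact .inr ⟨_, Φ, b, _, _, _, .newPrin ((hE.sameNames hM _).evalRS ▸ hL) (hk ▸ hkf) hl',
        ⟨fun _ _ => id, .setPrin hl _ _, .setPrin hl' _ _, .refl _ _ _, hΦ,
          hM.setPrin fun h => absurd (hW _ h) hkf⟩, by simp [hk],
        .single ⟨_, _, hE.addPrin hM h1 hl, h3⟩⟩
  | @sync _ _ S C _ _ _ _ hs he =>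
    cases hT with
    | sync h1 =>
      obtain ⟨Ψ, b₁, U₁', N', s₁', g1, g2, g3⟩ := SStep.star_sim (C := C) (s' := .run σ' S) (G := G) hs hM hΦ
        (.run ⟨Γ, pc, hE, h1⟩)
      obtain ⟨U₂', K', s₂', σ₂', k1, k2, k3, k4, k5⟩ := g3.complete he g2.pair g2.pairing
      -- the continuation is confidential if the last part of the block was, and low otherwise
      refine .inr ⟨none, Ψ, b₁, { u' with nonces := U₂' }, K', _, .sync (g1.trans k1) k2, g2.trans k3, hk, ?_⟩
      rcases k5 with k5 | ⟨k5, k6⟩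
      · exact .single k5
      · have h1 := ThreadsPair.of_left (W := W) (b := b₁) (G := G) (M := N) (M' := K')
          (T := {.run _ C}) (by simpa [TOk] using k5)
        have h2 := ThreadsPair.of_right (W := W) (b := b₁) (G := G) (M := N) (M' := K')
          (T := {.run _ C}) (by simpa [TOk] using k6)
        simpa using h1.add h2

/-- Corresponding devices. -/
structure DevPair (W : Finset Key) (Φ : Val → Val → Prop) (b : ℕ → ℕ → Prop) (G : Links)
    (D D' : Device) : Prop where
  mem : MemPair W Φ b D.mem D'.mem
  threads : ThreadsPair W b G D.mem D'.mem D.threads D'.threads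

theorem DevPair.mono {D D'} (h : DevPair W Φ b G D D') (hΦ : ∀ c d, Φ c d → Ψ c d) (hG : LinkLe G G₁) :
    DevPair W Ψ b G₁ D D' :=
  ⟨h.mem.mono hΦ, h.threads.mono (.refl _) (.refl _) (.refl _ _ _) hG⟩

theorem DevPair.flip {D D'} (h : DevPair W Φ b G D D') :
    DevPair W (fun c d => Φ d c) (fun y y' => b y' y) G.flip D' D :=
  ⟨h.mem.flip, h.threads.flip h.mem⟩

end CloudTypes

namespace CloudTypes

variable {W : Finset Key} {Φ Ψ : Val → Val → Prop} {U U' : Finset ℕ}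
  {b b₁ : ℕ → ℕ → Prop} {G G₁ : Links} {Γ : Ctx} {σ σ' : Env} {M M' N N' : Mem}

/-! ### Opening of channels -/

/-- The correspondence of channels is a partial bijection, which preserves the ends of the channels and
the names of attacker channels; no confidential data are sent on the latter. -/
structure LinkOk (G : Links) : Prop where
  att : ∀ a, G.δ (.att a) (.att a)
  sub : ∀ c d, G.δ c d → G.γ c d
  shape : ∀ c d, G.γ c d → (∃ a, c = .att a ∧ d = .att a) ∨
    ∃ id id' i j, c = .est id i j ∧ d = .est id' i j ∧ (id, i, j) ∈ G.A ∧ (id', i, j) ∈ G.A'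
  inj : ∀ c d c' d', G.γ c d → G.γ c' d' → (c = c' ↔ d = d')

/-- The links after the channels `(id, i, j)` and `(id', i, j)` have been established on the two sides.
They correspond to each other if `p` holds, also with respect to data if `q` holds. -/
def Links.openBoth (G : Links) (id id' i j : ℕ) (p q : Prop) : Links where
  γ c d := G.γ c d ∨ (c = .est id i j ∧ d = .est id' i j ∧ p)
  δ c d := G.δ c d ∨ (c = .est id i j ∧ d = .est id' i j ∧ q)
  A := insert (id, i, j) G.A
  A' := insert (id', i, j) G.A'

/-- The links after a channel has been established on the first side only. -/
def Links.openLeft (G : Links) (q : ℕ × ℕ × ℕ) : Links := { G with A := insert q G.A }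

theorem LinkOk.flip (h : LinkOk G) : LinkOk G.flip where
  att := h.att
  sub c d := h.sub d c
  shape c d hc := by
    rcases h.shape d c hc with ⟨a, h1, h2⟩ | ⟨id, id', i, j, h1, h2, h3, h4⟩
    · exact .inl ⟨a, h2, h1⟩
    · exact .inr ⟨id', id, i, j, h2, h1, h4, h3⟩
  inj c d c' d' h1 h2 := (h.inj _ _ _ _ h1 h2).symm

theorem LinkOk.not_new (h : LinkOk G) {id i j} (hi : (id, i, j) ∉ G.A) (d) :
    ¬ G.γ (.est id i j) d := by
  intro hc
  rcases h.shape _ _ hc with ⟨a, h1, h2⟩ | ⟨_, _, _, _, h1, h2, h3, h4⟩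
  · cases h1
  · cases h1; exact hi h3

theorem LinkOk.not_new' (h : LinkOk G) {id i j} (hi : (id, i, j) ∉ G.A') (d) :
    ¬ G.γ d (.est id i j) := h.flip.not_new hi d

theorem LinkOk.openBoth (h : LinkOk G) {id id' i j} (hi : (id, i, j) ∉ G.A) (hi' : (id', i, j) ∉ G.A')
    {p q : Prop} (hpq : q → p) : LinkOk (G.openBoth id id' i j p q) where
  att a := .inl (h.att a)
  sub c d hc := hc.imp (h.sub c d) fun ⟨h1, h2, h3⟩ => ⟨h1, h2, hpq h3⟩
  shape c d hc := by
    rcases hc with hc | ⟨h1, h2, h3⟩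
    · rcases h.shape c d hc with h1 | ⟨id, id', i, j, h1, h2, h3, h4⟩
      · exact .inl h1
      · exact .inr ⟨id, id', i, j, h1, h2, Finset.mem_insert_of_mem h3, Finset.mem_insert_of_mem h4⟩
    · exact .inr ⟨id, id', i, j, h1, h2, Finset.mem_insert_self _ _, Finset.mem_insert_self _ _⟩
  inj c d c' d' h1 h2 := by
    rcases h1 with h1 | ⟨rfl, rfl, h1⟩ <;> rcases h2 with h2 | ⟨rfl, rfl, h2⟩
    · exact h.inj _ _ _ _ h1 h2
    · exact ⟨fun e => by subst e; exact (h.not_new hi _ h1).elim,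
        fun e => by subst e; exact (h.not_new' hi' _ h1).elim⟩
    · exact ⟨fun e => by subst e; exact (h.not_new hi _ h2).elim,
        fun e => by subst e; exact (h.not_new' hi' _ h2).elim⟩
    · simp

theorem LinkOk.openLeft (h : LinkOk G) (q) : LinkOk (G.openLeft q) where
  att := h.att
  sub := h.sub
  shape c d hc := by
    rcases h.shape c d hc with h1 | ⟨id, id', i, j, h1, h2, h3, h4⟩
    · exact .inl h1
    · exact .inr ⟨id, id', i, j, h1, h2, Finset.mem_insert_of_mem h3, h4⟩
  inj := h.inj

theorem LinkLe.openBoth {id id' i j} (hi : (id, i, j) ∉ G.A) (hi' : (id', i, j) ∉ G.A') (p q : Prop) :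
    LinkLe G (G.openBoth id id' i j p q) where
  γ_le _ _ := .inl
  δ_le _ _ := .inl
  γ_new c d hc := hc.imp_right fun ⟨h1, h2, _⟩ => by subst h1 h2; exact ⟨hi, hi'⟩
  δ_new c d hc := hc.imp_right fun ⟨h1, h2, _⟩ => by subst h1 h2; exact ⟨hi, hi'⟩
  A := Finset.subset_insert _ _
  A' := Finset.subset_insert _ _

theorem LinkLe.openLeft (G : Links) (q) : LinkLe G (G.openLeft q) :=
  ⟨fun _ _ => id, fun _ _ => id, fun _ _ => .inl, fun _ _ => .inl, Finset.subset_insert _ _, subset_rfl⟩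

/-- The declaration of corresponding channels on both sides. -/
theorem EnvPair.addChan (h : EnvPair W b G Γ σ σ' M M') (hM : MemPair W Φ b M M') (hG : LinkLe G G₁)
    {c ch ch' S R₁ R₂} (hR₁ : Γ.WfRights R₁) (hR₂ : Γ.WfRights R₂) (ha : Chan.Active G₁.A ch)
    (ha' : Chan.Active G₁.A' ch')
    (hδ : Low W σ M R₁ ∧ G₁.δ ch ch' ∨ ¬ Low W σ M R₁ ∧ (∀ d, ¬ G₁.δ ch d) ∧ ∀ d, ¬ G₁.δ d ch')
    (hγ : Low W σ M R₂ ∧ G₁.γ ch ch' ∨ ¬ Low W σ M R₂ ∧ (∀ d, ¬ G₁.γ ch d) ∧ ∀ d, ¬ G₁.γ d ch') :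
    EnvPair W b G₁ (Γ.addChan c S R₁ R₂) (σ.setChan c ch) (σ'.setChan c ch') M M' where
  left := by
    refine h.left.addChan hR₁ hR₂ (levLe_of (.refl M M' _) hG) ha ?_ ?_
    · rcases hδ with ⟨h1, h2⟩ | ⟨h1, h2, -⟩
      · exact ⟨fun _ => h1, fun _ => ⟨_, h2⟩⟩
      · exact ⟨fun ⟨d, hd⟩ => (h2 d hd).elim, fun h => (h1 h).elim⟩
    · rcases hγ with ⟨h1, h2⟩ | ⟨h1, h2, -⟩
      · exact ⟨fun _ => h1, fun _ => ⟨_, h2⟩⟩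
      · exact ⟨fun ⟨d, hd⟩ => (h2 d hd).elim, fun h => (h1 h).elim⟩
  right := by
    refine h.right.addChan hR₁ hR₂ (levLe_of' (.refl M M' _) hG) ha' ?_ ?_
    · rw [(h.sameNames hM R₁).low] at hδ
      rcases hδ with ⟨h1, h2⟩ | ⟨h1, -, h2⟩
      · exact ⟨fun _ => h1, fun _ => ⟨_, h2⟩⟩
      · exact ⟨fun ⟨d, hd⟩ => (h2 d hd).elim, fun h => (h1 h).elim⟩
    · rw [(h.sameNames hM R₂).low] at hγ
      rcases hγ with ⟨h1, h2⟩ | ⟨h1, -, h2⟩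
      · exact ⟨fun _ => h1, fun _ => ⟨_, h2⟩⟩
      · exact ⟨fun ⟨d, hd⟩ => (h2 d hd).elim, fun h => (h1 h).elim⟩
  prin := h.prin
  key := h.key
  var x S R y y' hx h1 h2 hl := h.var x S R y y' hx h1 h2 (low_setChan.1 hl)
  chan c' S' T₁ T₂ d d' hc h1 h2 := by
    rw [low_setChan, low_setChan]
    by_cases hcc : c' = c
    · subst hcc
      simp only [Ctx.addChan, Env.setChan, Function.update_self, Option.some.injEq, Prod.mk.injEq] at hc h1 h2
      obtain ⟨rfl, rfl, rfl⟩ := hc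
      subst h1 h2
      exact ⟨fun hl => (hδ.resolve_right fun h => h.1 hl).2, fun hl => (hγ.resolve_right fun h => h.1 hl).2⟩
    · simp only [Ctx.addChan, Env.setChan, Function.update_of_ne hcc] at hc h1 h2
      have := h.chan c' S' T₁ T₂ d d' hc h1 h2
      exact ⟨fun hl => hG.δ_le _ _ (this.1 hl), fun hl => hG.γ_le _ _ (this.2 hl)⟩

/-- The declaration of an established channel on both sides. -/
theorem EnvPair.addEst (h : EnvPair W b G Γ σ σ' M M') (hM : MemPair W Φ b M M') (hG : LinkOk G)
    {id id' i j : ℕ} (hi : (id, i, j) ∉ G.A) (hi' : (id', i, j) ∉ G.A') {p q : Prop}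
    {c S R₁ R₂} (hR₁ : Γ.WfRights R₁) (hR₂ : Γ.WfRights R₂) (hq : q ↔ Low W σ M R₁)
    (hp : p ↔ Low W σ M R₂) :
    EnvPair W b (G.openBoth id id' i j p q) (Γ.addChan c S R₁ R₂) (σ.setChan c (.est id i j))
      (σ'.setChan c (.est id' i j)) M M' := by
  refine h.addChan hM (.openBoth hi hi' p q) hR₁ hR₂ (Finset.mem_insert_self _ _)
    (Finset.mem_insert_self _ _) ?_ ?_
  · by_cases hl : Low W σ M R₁
    · exact .inl ⟨hl, .inr ⟨rfl, rfl, hq.2 hl⟩⟩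
    · refine .inr ⟨hl, ?_, ?_⟩
      · rintro d (hd | ⟨-, -, hd⟩)
        exacts [hG.not_new hi _ (hG.sub _ _ hd), hl (hq.1 hd)]
      · rintro d (hd | ⟨-, -, hd⟩)
        exacts [hG.not_new' hi' _ (hG.sub _ _ hd), hl (hq.1 hd)]
  · by_cases hl : Low W σ M R₂
    · exact .inl ⟨hl, .inr ⟨rfl, rfl, hp.2 hl⟩⟩
    · refine .inr ⟨hl, ?_, ?_⟩
      · rintro d (hd | ⟨-, -, hd⟩)
        exacts [hG.not_new hi _ hd, hl (hp.1 hd)]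
      · rintro d (hd | ⟨-, -, hd⟩)
        exacts [hG.not_new' hi' _ hd, hl (hp.1 hd)]

/-- The declaration of an attacker channel on both sides. -/
theorem EnvPair.addAtt (h : EnvPair W b G Γ σ σ' M M') (hM : MemPair W Φ b M M') (hG : LinkOk G)
    {c S R₁ R₂ a} (hR₁ : Γ.WfRights R₁) (hR₂ : Γ.WfRights R₂) (h₁ : Low W σ M R₁)
    (h₂ : Low W σ M R₂) :
    EnvPair W b G (Γ.addChan c S R₁ R₂) (σ.setChan c (.att a)) (σ'.setChan c (.att a)) M M' :=
  h.addChan hM (.refl _) hR₁ hR₂ trivial trivial (.inl ⟨h₁, hG.att a⟩)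
    (.inl ⟨h₂, hG.sub _ _ (hG.att a)⟩)

/-! ### The bisimulation -/

/-- The links between two open systems. -/
abbrev mkLinks (γ δ : Chan → Chan → Prop) (X Y : System) : Links := ⟨γ, δ, X.chans, Y.chans⟩

/-- Two open systems that differ in confidential data only. All keys of `W` exist already, so principals
that are created later have keys outside `W`. -/
structure Inv (W : Finset Key) (Φ : Val → Val → Prop) (β : ℕ → ℕ → ℕ → Prop) (γ δ : Chan → Chan → Prop)
    (K K' : Knowledge) (X Y : System) : Prop where
  pairing : Pairing W X.used.nonces Y.used.nonces Φ
  keys : X.used.keys = Y.used.keys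
  fresh : ∀ n, Key.hon n ∈ W → n ∈ X.used.keys
  know : ∀ m, Option.Rel (TRel W Φ) (K m) (K' m)
  links : LinkOk (mkLinks γ δ X Y)
  devs : ∀ i, Option.Rel (DevPair W Φ (β i) (mkLinks γ δ X Y)) (X.devs i) (Y.devs i)

/-- Open systems that are related by some correspondence of ciphers, locations and channels. -/
def Bisim (W : Finset Key) (X Y : OpenSystem) : Prop :=
  ∃ Φ β γ δ, Inv W Φ β γ δ X.know Y.know X.sys Y.sys

theorem optionRel_flip {α β : Type*} {R : α → β → Prop} {S : β → α → Prop} (h : ∀ a b, R a b → S b a)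
    {a b} (hab : Option.Rel R a b) : Option.Rel S b a := by
  cases hab <;> constructor
  exact h _ _ ‹_›

theorem optionRel_some {α β : Type*} {R : α → β → Prop} {a : α} {x : Option α} {y : Option β}
    (h : Option.Rel R x y) (hx : x = some a) : ∃ b, y = some b ∧ R a b := by
  subst hx
  cases h
  exact ⟨_, rfl, ‹_›⟩

theorem Bisim.symm {X Y : OpenSystem} (h : Bisim W X Y) : Bisim W Y X := by
  obtain ⟨Φ, β, γ, δ, h⟩ := h
  exact ⟨fun c d => Φ d c, fun i y y' => β i y' y, fun c d => γ d c, fun c d => δ d c, {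
    pairing := h.pairing.flip
    keys := h.keys.symm
    fresh := fun n hn => h.keys ▸ h.fresh n hn
    know := fun m => optionRel_flip (fun _ _ => TRel.flip) (h.know m)
    links := h.links.flip
    devs := fun i => optionRel_flip (fun _ _ => DevPair.flip) (h.devs i) }⟩

/-- Devices that change, on both sides. -/
theorem optionRel_update {β : ℕ → ℕ → ℕ → Prop} {f g : ℕ → Option Device}
    (h : ∀ i, Option.Rel (DevPair W Φ (β i) G) (f i) (g i)) (hΦ : ∀ c d, Φ c d → Ψ c d)
    (hG : LinkLe G G₁) {i D D'} (hD : DevPair W Ψ b₁ G₁ D D') (k : ℕ) :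
    Option.Rel (DevPair W Ψ (Function.update β i b₁ k) G₁) (Function.update f i (some D) k)
      (Function.update g i (some D') k) := by
  by_cases hk : k = i
  · subst hk
    simp only [Function.update_self]
    exact Option.Rel.some hD
  · simp only [Function.update_of_ne hk]
    have := h k
    generalize f k = x at this
    generalize g k = y at this
    cases this <;> constructor
    exact DevPair.mono ‹_› hΦ hG

/-- Devices that change on the first side only. -/
theorem optionRel_update_left {β : ℕ → ℕ → ℕ → Prop} {f g : ℕ → Option Device}
    (h : ∀ i, Option.Rel (DevPair W Φ (β i) G) (f i) (g i)) (hG : LinkLe G G₁) {i D D'}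
    (hg : g i = some D') (hD : DevPair W Φ (β i) G₁ D D') (k : ℕ) :
    Option.Rel (DevPair W Φ (β k) G₁) (Function.update f i (some D) k) (g k) := by
  have := optionRel_update (i := i) (b₁ := β i) h (fun _ _ => id) hG hD k
  rwa [Function.update_eq_self, (Function.update_eq_self_iff (f := g)).2 hg.symm] at this

theorem DevPair.of {T T' : Multiset Thread} (hM : MemPair W Φ b M M') (hT : ThreadsPair W b G M M' T T') :
    DevPair W Φ b G ⟨M, T⟩ ⟨M', T'⟩ := ⟨hM, hT⟩

theorem Inv.dev {β γ δ K K'} {X Y : System} (h : Inv W Φ β γ δ K K' X Y) {i M T}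
    (hi : X.devs i = some ⟨M, T⟩) : ∃ M' T', Y.devs i = some ⟨M', T'⟩ ∧ MemPair W Φ (β i) M M' ∧
      ThreadsPair W (β i) (mkLinks γ δ X Y) M M' T T' := by
  obtain ⟨⟨M', T'⟩, hi', hM, hT⟩ := optionRel_some (h.devs i) hi
  exact ⟨M', T', hi', hM, hT⟩

theorem exists_fresh_chan (A : Finset (ℕ × ℕ × ℕ)) (i j : ℕ) : ∃ id, (id, i, j) ∉ A := by
  obtain ⟨id, h⟩ := Infinite.exists_notMem_finset (A.image Prod.fst)
  exact ⟨id, fun hA => h (Finset.mem_image_of_mem Prod.fst hA)⟩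

/-- If the sequel of the opening of a secure channel is confidential, then so is the command itself, since
it may also be typed with the `pc` of its sequel. -/
theorem EnvPair.openPriv_dropped (hE : EnvPair W b G Γ σ σ' M M') (hM : MemPair W Φ b M M')
    {pc r c S R₁ R₂ k p C} (hT : WellTyped pc Γ (.openPriv r c S R₁ R₂ k p C)) (h : ¬ Low W σ M R₂) :
    Dropped W b G M M' σ σ' (.openPriv r c S R₁ R₂ k p C) := by
  cases hT with
  | openPriv h1 h2 h3 h4 h5 h6 h7 h8 =>
    exact hE.dropped hM (.openPriv h1 h2 h3 h4 h5 h6 (Rights.sub_refl _) h8) h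

/-- The continuation of a confidential thread that has opened a confidential channel. -/
theorem RunOk.openPriv {h : Prop} {lv lv' : Lev} {r c S R₁ R₂ k p C ch r₁ r₂}
    (hr : RunOk W h lv M σ (.openPriv r c S R₁ R₂ k p C)) (hlv : LevLe M lv lv')
    (h₁ : evalRights σ M R₁ = some r₁) (h₂ : evalRights σ M R₂ = some r₂) (ha : lv'.act ch)
    (hD : lv'.loD ch ↔ LowKeys W r₁) (hP : lv'.loP ch ↔ LowKeys W r₂) :
    RunOk W h lv' M (σ.setChan c ch) C := by
  obtain ⟨Γ, pc, hE, hT, hp⟩ := hr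
  cases hT with
  | openPriv e1 e2 e3 e4 e5 e6 e7 e8 =>
    exact ⟨_, _, hE.addChan (hE.wf_of_eval h₁) (hE.wf_of_eval h₂) hlv ha
      (hD.trans (low_evalRights h₁).symm) (hP.trans (low_evalRights h₂).symm), e8,
      fun hh hl => hp hh ((low_setChan.1 hl).mono e7)⟩

/-- What the typing of a secure channel implies for the levels: `R₁` is low only if `R₂` is, `R₂` is
confidential if the thread is, and `R₁` is low if the key of the other end is not in `W`. -/
theorem low_of_openPriv {lv : Lev} {h : Prop} {r c S R₁ R₂ k p C}
    (hr : RunOk W h lv M σ (.openPriv r c S R₁ R₂ k p C)) :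
    (Low W σ M R₁ → Low W σ M R₂) ∧ (h → ¬ Low W σ M R₂) ∧
    ∀ k', σ.keyVal M k = some k' → k' ∉ W → Low W σ M R₁ := by
  obtain ⟨Γ, pc, hE, hT, hp⟩ := hr
  cases hT with
  | openPriv e1 e2 e3 e4 e5 e6 e7 e8 =>
    exact ⟨Low.mono e6, fun hh hl => hp hh (hl.mono e7), fun k' hk hW =>
      Low.mono e5 ⟨.key k, by simp, k', hk, hW⟩⟩

theorem prin_low_of_openPriv {lv : Lev} {h : Prop} {r c S R₁ R₂ k p C}
    (hr : RunOk W h lv M σ (.openPriv r c S R₁ R₂ k p C)) {k' L}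
    (hk : σ.prinVal M p = some (k', L)) (hW : k' ∉ W) : Low W σ M R₁ := by
  obtain ⟨Γ, pc, hE, hT, hp⟩ := hr
  cases hT with
  | openPriv e1 e2 e3 e4 e5 e6 e7 e8 =>
    exact Low.mono e5 ⟨.pub p, by simp, k', by simp [KeyRef.eval, hk], hW⟩

theorem know_mono {K K' : Knowledge} (hΦ : ∀ c d, Φ c d → Ψ c d)
    (h : ∀ m, Option.Rel (TRel W Φ) (K m) (K' m)) (m) : Option.Rel (TRel W Ψ) (K m) (K' m) := by
  have := h m
  generalize K m = x at this
  generalize K' m = y at this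
  cases this <;> constructor
  exact TRel.mono hΦ ‹_›

theorem internals_single {K : Knowledge} {X Y : System} {ev} (h : Step X ev Y) :
    OpenSystem.Internals ⟨K, X⟩ ⟨K, Y⟩ := .single ⟨rfl, ev, h⟩

/-- A reduction of a single device is matched. -/
theorem Inv.loc {β γ δ K K'} {X Y : System} (h : Inv W Φ β γ δ K K' X Y) {i t T ev u' ts}
    (hi : X.devs i = some ⟨M, t ::ₘ T⟩) (hs : LStep X.used M t ev u' N ts) :
    ∃ Y', OpenSystem.Internals ⟨K', Y⟩ ⟨K', Y'⟩ ∧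
      Bisim W ⟨K, ({ X with used := u' } : System).setDev i ⟨N, ts + T⟩⟩ ⟨K', Y'⟩ := by
  obtain ⟨M', T', hi', hM, hT⟩ := h.dev hi
  have high : TOk W True (levOf (β i) (mkLinks γ δ X Y)) M t →
      ThreadsPair W (β i) (mkLinks γ δ X Y) M M' T T' →
      ∃ Y', OpenSystem.Internals ⟨K', Y⟩ ⟨K', Y'⟩ ∧
        Bisim W ⟨K, ({ X with used := u' } : System).setDev i ⟨N, ts + T⟩⟩ ⟨K', Y'⟩ := by
    intro ht hT
    obtain ⟨lv', g, h1, h2⟩ := hs.tOk ht hM.alloc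
    obtain rfl := g.same trivial
    have hk := (h2 trivial).2
    refine ⟨Y, .refl, Φ, β, γ, δ, h.pairing.mono hs.used_mono.1 subset_rfl, hk.trans h.keys,
      fun n hn => hs.used_mono.2 (h.fresh n hn), h.know, h.links, ?_⟩
    refine optionRel_update_left h.devs (.refl _) hi'
      ⟨hM.quiet_left (g.quiet trivial) (hs.isFinite hM.fin), ?_⟩
    have := (ThreadsPair.of_left (M' := M') h1).add (hT.mono g.mem (.refl M') (.refl _ _ _) (.refl _))
    simpa using this
  rcases hT.uncons with ⟨h1, h2⟩ | ⟨t', T₀', rfl, ⟨σ, σ', C, rfl, rfl, hr⟩, h3⟩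
  · exact high h1 h2
  · rcases hs.sim hr hM h.pairing h.keys h.fresh with ⟨h1, h2⟩ |
      ⟨ev', Ψ, b₁, u₁', N', ts', h1, h2, h4, h5⟩
    · exact high h1 (.cons_right h2 h3)
    · refine ⟨({ Y with used := u₁' } : System).setDev i ⟨N', ts' + T₀'⟩, internals_single (.loc hi' h1),
        Ψ, Function.update β i b₁, γ, δ, h2.pairing, h4, fun n hn => hs.used_mono.2 (h.fresh n hn),
        know_mono h2.le h.know, h.links, ?_⟩
      exact optionRel_update h.devs h2.le (.refl _)
        ⟨h2.pair, h5.add (h3.mono h2.mem h2.mem' h2.loc (.refl _))⟩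

/-- Public channels are opened with `pc = ⊥`, hence never by confidential threads. -/
theorem not_runOk_openPub {lv : Lev} {r c S C} : ¬ RunOk W True lv M σ (.openPub r c S C) := by
  rintro ⟨Γ, pc, hE, hT, hp⟩
  cases hT
  exact hp trivial trivial

/-- The opening of a public channel between two devices is matched. -/
theorem Inv.openPub {β γ δ K K'} {X Y : System} (h : Inv W Φ β γ δ K K' X Y)
    {i j M₁ M₂ T₁ T₂ σ₁ σ₂ c₁ c₂ S C₁ C₂ id} (hij : i ≠ j)
    (hi : X.devs i = some ⟨M₁, .run σ₁ (.openPub .client c₁ S C₁) ::ₘ T₁⟩)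
    (hj : X.devs j = some ⟨M₂, .run σ₂ (.openPub .server c₂ S C₂) ::ₘ T₂⟩)
    (hid : (id, i, j) ∉ X.chans) :
    ∃ Y', OpenSystem.Internals ⟨K', Y⟩ ⟨K', Y'⟩ ∧
      Bisim W ⟨K, (({ X with chans := insert (id, i, j) X.chans } : System).setDev i
          ⟨M₁, .run (σ₁.setChan c₁ (.est id i j)) C₁ ::ₘ T₁⟩).setDev j
          ⟨M₂, .run (σ₂.setChan c₂ (.est id i j)) C₂ ::ₘ T₂⟩⟩ ⟨K', Y'⟩ := by
  obtain ⟨M₁', T₁', hi', hM₁, hT₁⟩ := h.dev hi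
  obtain ⟨M₂', T₂', hj', hM₂, hT₂⟩ := h.dev hj
  obtain ⟨σ₁', S₁', rfl, ⟨Γ₁, pc₁, hE₁, ht₁⟩, hS₁⟩ := hT₁.uncons_low not_runOk_openPub
  obtain ⟨σ₂', S₂', rfl, ⟨Γ₂, pc₂, hE₂, ht₂⟩, hS₂⟩ := hT₂.uncons_low not_runOk_openPub
  cases ht₁ with | openPub a₁ a₂ =>
  cases ht₂ with | openPub b₁ b₂ =>
  obtain ⟨id', hid'⟩ := exists_fresh_chan Y.chans i j
  have hle := LinkLe.openBoth (G := mkLinks γ δ X Y) hid hid' True True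
  have e₁ := hE₁.addEst hM₁ h.links hid hid' (p := True) (q := True) (c := c₁) (S := S) (R₁ := none)
    (R₂ := none) trivial trivial .rfl .rfl
  have e₂ := hE₂.addEst hM₂ h.links hid hid' (p := True) (q := True) (c := c₂) (S := S) (R₁ := none)
    (R₂ := none) trivial trivial .rfl .rfl
  refine ⟨_, internals_single (.openPub hij hi' hj' hid'), Φ, Function.update (Function.update β i (β i)) j (β j),
    _, _, h.pairing, h.keys, h.fresh, h.know, h.links.openBoth hid hid' (p := True) (q := True) (fun h => h), ?_⟩
  refine optionRel_update (optionRel_update h.devs (fun _ _ => _root_.id) hle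
    (.of hM₁ (.cons ⟨_, _, e₁, a₂⟩ (hS₁.mono (.refl _) (.refl _) (.refl _ _ _) hle)))) (fun _ _ => _root_.id)
    (.refl _) (.of hM₂ (.cons ⟨_, _, e₂, b₂⟩ (hS₂.mono (.refl _) (.refl _) (.refl _ _ _) hle)))

/-- The opening of a secure channel between two devices is matched. The rights `r'`, which are common to
both ends, are the `pc` of the two sequels: either both threads have counterparts, which open a channel as
well, or both are confidential. -/
theorem Inv.openPriv {β γ δ K K'} {X Y : System} (h : Inv W Φ β γ δ K K' X Y)
    {i j M₁ M₂ T₁ T₂ σ₁ σ₂ c₁ c₂ S R₁ R₂ R₁' R₂' k₁ k₂ p₁ p₂ C₁ C₂ id key₁ L₁ key₂ L₂ r r'}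
    (hij : i ≠ j)
    (hi : X.devs i = some ⟨M₁, .run σ₁ (.openPriv .client c₁ S R₁ R₁' k₁ p₁ C₁) ::ₘ T₁⟩)
    (hj : X.devs j = some ⟨M₂, .run σ₂ (.openPriv .server c₂ S R₂ R₂' k₂ p₂ C₂) ::ₘ T₂⟩)
    (hp₁ : σ₁.prinVal M₁ p₁ = some (key₁, L₁)) (hp₂ : σ₂.prinVal M₂ p₂ = some (key₂, L₂))
    (hk₁ : σ₁.keyVal M₁ k₁ = some key₂) (hk₂ : σ₂.keyVal M₂ k₂ = some key₁)
    (hR₁ : evalRights σ₁ M₁ R₁ = some r) (hR₂ : evalRights σ₂ M₂ R₂ = some r)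
    (hR₁' : evalRights σ₁ M₁ R₁' = some r') (hR₂' : evalRights σ₂ M₂ R₂' = some r')
    (hid : (id, i, j) ∉ X.chans) :
    ∃ Y', OpenSystem.Internals ⟨K', Y⟩ ⟨K', Y'⟩ ∧
      Bisim W ⟨K, (({ X with chans := insert (id, i, j) X.chans } : System).setDev i
          ⟨M₁, .run (σ₁.setChan c₁ (.est id i j)) C₁ ::ₘ T₁⟩).setDev j
          ⟨M₂, .run (σ₂.setChan c₂ (.est id i j)) C₂ ::ₘ T₂⟩⟩ ⟨K', Y'⟩ := by
  obtain ⟨M₁', T₁', hi', hM₁, hT₁⟩ := h.dev hi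
  obtain ⟨M₂', T₂', hj', hM₂, hT₂⟩ := h.dev hj
  have l₁ := low_evalRights (W := W) hR₁'
  have l₂ := low_evalRights (W := W) hR₂'
  by_cases hr' : LowKeys W r'
  · obtain ⟨σ₁', S₁', rfl, ⟨Γ₁, pc₁, hE₁, ht₁⟩, hS₁⟩ := hT₁.uncons_low
      fun hh => (low_of_openPriv hh).2.1 trivial (l₁.2 hr')
    obtain ⟨σ₂', S₂', rfl, ⟨Γ₂, pc₂, hE₂, ht₂⟩, hS₂⟩ := hT₂.uncons_low
      fun hh => (low_of_openPriv hh).2.1 trivial (l₂.2 hr')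
    cases ht₁ with | openPriv _ _ _ _ _ _ _ a₂ =>
    cases ht₂ with | openPriv _ _ _ _ _ _ _ b₂ =>
    obtain ⟨id', hid'⟩ := exists_fresh_chan Y.chans i j
    have hle := LinkLe.openBoth (G := mkLinks γ δ X Y) hid hid' True (LowKeys W r)
    have e₁ := hE₁.addEst hM₁ h.links hid hid' (c := c₁) (S := S) (hE₁.left.wf_of_eval hR₁)
      (hE₁.left.wf_of_eval hR₁') (low_evalRights hR₁).symm (iff_of_true trivial (l₁.2 hr'))
    have e₂ := hE₂.addEst hM₂ h.links hid hid' (c := c₂) (S := S) (hE₂.left.wf_of_eval hR₂)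
      (hE₂.left.wf_of_eval hR₂') (low_evalRights hR₂).symm (iff_of_true trivial (l₂.2 hr'))
    refine ⟨_, internals_single (.openPriv hij hi' hj' (hE₁.prinVal hM₁ ▸ hp₁) (hE₂.prinVal hM₂ ▸ hp₂)
      (hE₁.keyVal hM₁ ▸ hk₁) (hE₂.keyVal hM₂ ▸ hk₂) ((hE₁.sameNames hM₁ _).evalRights ▸ hR₁)
      ((hE₂.sameNames hM₂ _).evalRights ▸ hR₂) ((hE₁.sameNames hM₁ _).evalRights ▸ hR₁')
      ((hE₂.sameNames hM₂ _).evalRights ▸ hR₂') hid'), Φ,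
      Function.update (Function.update β i (β i)) j (β j),
      _, _, h.pairing, h.keys, h.fresh, h.know, h.links.openBoth hid hid' (p := True) (q := LowKeys W r) (fun _ => trivial), ?_⟩
    refine optionRel_update (optionRel_update h.devs (fun _ _ => _root_.id) hle
      (.of hM₁ (.cons ⟨_, _, e₁, a₂⟩ (hS₁.mono (.refl _) (.refl _) (.refl _ _ _) hle)))) (fun _ _ => _root_.id)
      (.refl _) (.of hM₂ (.cons ⟨_, _, e₂, b₂⟩ (hS₂.mono (.refl _) (.refl _) (.refl _ _ _) hle)))
  · obtain ⟨hr₁, hS₁⟩ := hT₁.uncons_high fun σ' ⟨Γ, pc, hE, hT⟩ => hE.openPriv_dropped hM₁ hT (l₁.not.2 hr')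
    obtain ⟨hr₂, hS₂⟩ := hT₂.uncons_high fun σ' ⟨Γ, pc, hE, hT⟩ => hE.openPriv_dropped hM₂ hT (l₂.not.2 hr')
    have hr : ¬ LowKeys W r := fun hr => hr' (l₁.1 ((low_of_openPriv hr₁).1 ((low_evalRights hR₁).2 hr)))
    have hle := LinkLe.openLeft (mkLinks γ δ X Y) (id, i, j)
    have hnew := h.links.not_new hid
    have hD : (∃ d, δ (.est id i j) d) ↔ LowKeys W r :=
      iff_of_false (fun ⟨d, hd⟩ => hnew d (h.links.sub _ _ hd)) hr
    have hP : (∃ d, γ (.est id i j) d) ↔ LowKeys W r' := iff_of_false (fun ⟨d, hd⟩ => hnew d hd) hr'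
    have e₁ := hr₁.openPriv (levLe_of (.refl M₁ M₁' _) hle) (ch := .est id i j) hR₁ hR₁'
      (Finset.mem_insert_self _ _) hD hP
    have e₂ := hr₂.openPriv (levLe_of (.refl M₂ M₂' _) hle) (ch := .est id i j) hR₂ hR₂'
      (Finset.mem_insert_self _ _) hD hP
    refine ⟨Y, .refl, Φ, β, γ, δ, h.pairing, h.keys, h.fresh, h.know, h.links.openLeft _, ?_⟩
    refine optionRel_update_left (optionRel_update_left h.devs hle hi'
      (.of hM₁ (.cons_left (t := .run _ C₁) e₁ (hS₁.mono (.refl _) (.refl _) (.refl _ _ _) hle)))) (.refl _) hj'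
      (.of hM₂ (.cons_left (t := .run _ C₂) e₂ (hS₂.mono (.refl _) (.refl _) (.refl _ _ _) hle)))

/-- A communication between two devices is matched: `pc` of both threads is the second right of the channel,
so either both threads have counterparts or both are confidential. -/
theorem Inv.comm {β γ δ K K'} {X Y : System} (h : Inv W Φ β γ δ K K' X Y)
    {i j M₁ M₂ T₁ T₂ σ₁ σ₂ c₁ c₂ e x C₁ C₂ id a b v U' y} (hij : i ≠ j)
    (hi : X.devs i = some ⟨M₁, .run σ₁ (.output e c₁ C₁) ::ₘ T₁⟩)
    (hj : X.devs j = some ⟨M₂, .run σ₂ (.input c₂ x C₂) ::ₘ T₂⟩)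
    (hc₁ : σ₁.chan c₁ = some (.est id a b)) (hc₂ : σ₂.chan c₂ = some (.est id a b))
    (hv : Eval σ₁ M₁ X.used.nonces e v U') (hy : M₂.var y = none) :
    ∃ Y', OpenSystem.Internals ⟨K', Y⟩ ⟨K', Y'⟩ ∧
      Bisim W ⟨K, (({ X with used := { X.used with nonces := U' } } : System).setDev i
          ⟨M₁, .run σ₁ C₁ ::ₘ T₁⟩).setDev j
          ⟨M₂.setVar y v, .run (σ₂.setVar x y) C₂ ::ₘ T₂⟩⟩ ⟨K', Y'⟩ := by
  obtain ⟨M₁', T₁', hi', hM₁, hT₁⟩ := h.dev hi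
  obtain ⟨M₂', T₂', hj', hM₂, hT₂⟩ := h.dev hj
  by_cases hlo : ∃ d, γ (.est id a b) d
  · obtain ⟨d, hd⟩ := hlo
    obtain ⟨σ₁', S₁', rfl, ⟨Γ₁, pc₁, hE₁, ht₁⟩, hS₁⟩ := hT₁.uncons_low <| by
      rintro ⟨Γ, pc, hE, hT, hp⟩
      cases hT with | output e1 e2 e3 e4 =>
      obtain ⟨-, -, ch, f1, -, -, f2⟩ := hE.chan _ _ _ _ e2
      rw [hc₁] at f1
      cases f1
      exact hp trivial (f2.1 ⟨d, hd⟩)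
    obtain ⟨σ₂', S₂', rfl, ⟨Γ₂, pc₂, hE₂, ht₂⟩, hS₂⟩ := hT₂.uncons_low <| by
      rintro ⟨Γ, pc, hE, hT, hp⟩
      cases hT with | input e1 e2 e3 =>
      obtain ⟨-, -, ch, f1, -, -, f2⟩ := hE.chan _ _ _ _ e2
      rw [hc₂] at f1
      cases f1
      exact hp trivial (f2.1 ⟨d, hd⟩)
    cases ht₁ with | @output _ _ _ _ _ _ R₁ R₃ e1 e2 e3 e4 =>
    cases ht₂ with | @input _ _ _ _ _ S₂ R₂ f1 f2 f3 =>
    obtain ⟨-, -, ch, g1, -, g2, g3⟩ := hE₁.left.chan _ _ _ _ e2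
    obtain ⟨-, -, ch', g1', -⟩ := hE₁.right.chan _ _ _ _ e2
    obtain ⟨k0, -, dh, k1, -, k2, k3⟩ := hE₂.left.chan _ _ _ _ f2
    obtain ⟨-, -, dh', k1', -⟩ := hE₂.right.chan _ _ _ _ f2
    rw [hc₁] at g1
    rw [hc₂] at k1
    cases g1
    cases k1
    have q1 := (hE₁.chan _ _ _ _ _ _ e2 hc₁ g1').2 (g3.1 ⟨d, hd⟩)
    have q2 := (hE₂.chan _ _ _ _ _ _ f2 hc₂ k1').2 (k3.1 ⟨d, hd⟩)
    obtain rfl := (h.links.inj _ _ _ _ q1 q2).1 rfl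
    have : ∃ id', ch' = .est id' a b := by
      rcases h.links.shape _ _ q1 with ⟨_, w1, w2⟩ | ⟨_, _, _, _, w1, w2, -⟩
      · cases w1
      · cases w1; exact ⟨_, w2⟩
    obtain ⟨id', rfl⟩ := this
    obtain ⟨Ψ, v', V, i1, i2, i3, i4⟩ := hv.sim hE₁ hM₁ h.pairing e1
    obtain ⟨y', hy'⟩ := exists_fresh hM₂.fin'.1
    have hrel : Low W σ₂ M₂ R₂ → Rel W Ψ v v' := fun hl => i4 ((g2.1 (k2.2 hl)).mono e3)
    refine ⟨_, internals_single (.comm hij hi' hj' g1' k1' i3 hy'), Ψ,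
      Function.update (Function.update β i (β i)) j (addLoc (β j) y y' (Low W σ₂ M₂ R₂)), γ, δ, i2, h.keys,
      h.fresh, know_mono i1 h.know, h.links, ?_⟩
    refine optionRel_update (optionRel_update h.devs i1 (.refl _)
      (.of (hM₁.mono i1) (.cons ⟨_, _, hE₁, e4⟩ hS₁))) (fun _ _ => _root_.id) (.refl _)
      (.of ((hM₂.mono i1).addLoc hy hy' hrel) (.cons ⟨_, _, hE₂.addVar hM₂ hy hy' k0, f3⟩
        (hS₂.mono (.setVar _ _ _) (.setVar _ _ _) (.addLoc hy hy' _) (.refl _))))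
  · obtain ⟨hr₁, hS₁⟩ := hT₁.uncons_high <| by
      rintro σ' ⟨Γ, pc, hE, hT⟩
      refine hE.dropped hM₁ hT ?_
      cases hT with | output e1 e2 e3 e4 =>
      obtain ⟨-, -, ch, f1, -, -, f2⟩ := hE.left.chan _ _ _ _ e2
      rw [hc₁] at f1
      cases f1
      exact f2.not.1 hlo
    obtain ⟨hr₂, hS₂⟩ := hT₂.uncons_high <| by
      rintro σ' ⟨Γ, pc, hE, hT⟩
      refine hE.dropped hM₂ hT ?_
      cases hT with | input e1 e2 e3 =>
      obtain ⟨-, -, ch, f1, -, -, f2⟩ := hE.left.chan _ _ _ _ e2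
      rw [hc₂] at f1
      cases f1
      exact f2.not.1 hlo
    obtain ⟨Γ₁, pc₁, hE₁, ht₁, hp₁⟩ := hr₁
    obtain ⟨Γ₂, pc₂, hE₂, ht₂, hp₂⟩ := hr₂
    cases ht₁ with | @output _ _ _ _ _ _ R₁ R₃ e1 e2 e3 e4 =>
    cases ht₂ with | @input _ _ _ _ _ S₂ R₂ f1 f2 f3 =>
    obtain ⟨k0, -, dh, k1, -, k2, k3⟩ := hE₂.chan _ _ _ _ f2
    rw [hc₂] at k1
    cases k1
    have hR₂ : ¬ Low W σ₂ M₂ R₂ := fun hl => by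
      obtain ⟨d, hd⟩ := k2.2 hl
      exact hlo ⟨d, h.links.sub _ _ hd⟩
    have hny : ¬ (levOf (β j) (mkLinks γ δ X Y)).lo y := fun hl => by
      have := hM₂.alloc y hl
      simp [hy] at this
    have e₂ : EnvOk W (Γ₂.addVar x S₂ R₂) (σ₂.setVar x y) (M₂.setVar y v)
        (levOf (β j) (mkLinks γ δ X Y)) := hE₂.addVar k0 (.refl _ _) (iff_of_false hny hR₂)
    refine ⟨Y, .refl, Φ, β, γ, δ, h.pairing.mono hv.used_mono subset_rfl, h.keys, h.fresh, h.know, h.links, ?_⟩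
    have hq : Quiet (levOf (β j) (mkLinks γ δ X Y)) M₂ (M₂.setVar y v) := .setVar hny _ _
    refine optionRel_update_left (optionRel_update_left h.devs (.refl _) hi'
      (.of hM₁ (.cons_left (t := .run _ C₁) ⟨_, _, hE₁, e4, hp₁⟩ hS₁))) (.refl _) hj'
      (.of (hM₂.quiet_left hq (hM₂.fin.setVar _ _)) (.cons_left (t := .run _ C₂) ⟨_, _, e₂, f3, fun hh => low_setVar.not.2 (hp₂ hh)⟩
        (hS₂.mono (.setVar _ _ _) (.refl _) (.refl _ _ _) (.refl _))))

/-- Internal reductions are matched. -/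
theorem Bisim.internal {X Y X' : OpenSystem} (h : Bisim W X Y) (hs : X.Internal X') :
    ∃ Y', Y.Internals Y' ∧ Bisim W X' Y' := by
  obtain ⟨K, P⟩ := X
  obtain ⟨K', P'⟩ := Y
  obtain ⟨K₁, P₁⟩ := X'
  obtain ⟨Φ, β, γ, δ, h⟩ := h
  obtain ⟨hK, ev, hs⟩ := hs
  obtain rfl : K₁ = K := hK
  change Step P ev P₁ at hs
  have : ∃ Y', OpenSystem.Internals ⟨K', P'⟩ ⟨K', Y'⟩ ∧ Bisim W ⟨K₁, P₁⟩ ⟨K', Y'⟩ := by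
    cases hs with
    | loc hi hs => exact h.loc hi hs
    | openPub hij hi hj hid => exact h.openPub hij hi hj hid
    | openPriv hij hi hj h1 h2 h3 h4 h5 h6 h7 h8 hid =>
      exact h.openPriv hij hi hj h1 h2 h3 h4 h5 h6 h7 h8 hid
    | comm hij hi hj h1 h2 h3 h4 => exact h.comm hij hi hj h1 h2 h3 h4
  obtain ⟨Y', h1, h2⟩ := this
  exact ⟨_, h1, h2⟩

theorem providesRights_rel (hW : ∀ j, Key.att j ∉ W) (hΦ : Pairing W U U' Φ) {K K' : Knowledge}
    (hK : ∀ m, Option.Rel (TRel W Φ) (K m) (K' m)) {f r} (h : ProvidesRights K f r) :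
    ProvidesRights K' f r := by
  cases f <;> cases r <;> try exact h
  rename_i f L
  simp only [ProvidesRights, Option.bind_eq_some_iff] at h ⊢
  obtain ⟨t, h1, h2⟩ := h
  obtain ⟨t', h3, h4⟩ := optionRel_some (AExpr.eval_rel hW hΦ hK f) h1
  exact ⟨t', h3, (h4.keys? hΦ) ▸ h2⟩

/-- Labelled reductions are matched. For a secure channel, the attacker gives a secret key, which is not in
`W`; the rights of the channel contain this key and are low. -/
theorem Bisim.labelled (hW : ∀ j, Key.att j ∉ W) {X Y X' : OpenSystem} {l} (h : Bisim W X Y)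
    (hs : LabStep X l X') : ∃ Y', Y.Weak l Y' ∧ Bisim W X' Y' := by
  obtain ⟨K', P'⟩ := Y
  obtain ⟨Φ, β, γ, δ, h⟩ := h
  suffices ∃ Y', LabStep ⟨K', P'⟩ l Y' ∧ Bisim W X' Y' by
    obtain ⟨Y', h1, h2⟩ := this
    exact ⟨Y', ⟨_, _, .refl, h1, .refl⟩, h2⟩
  cases hs with
  | @openPub K P i M T σ r c S C a hi =>
    obtain ⟨M', T', hi', hM, hT⟩ := h.dev hi
    obtain ⟨σ', S', rfl, ⟨Γ, pc, hE, ht⟩, hS⟩ := hT.uncons_low not_runOk_openPub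
    cases ht with | openPub a₁ a₂ =>
    refine ⟨_, .openPub hi', Φ, Function.update β i (β i), γ, δ, h.pairing, h.keys, h.fresh, h.know,
      h.links, ?_⟩
    exact optionRel_update h.devs (fun _ _ => id) (.refl _)
      (.of hM (.cons ⟨_, _, hE.addAtt (R₁ := none) (R₂ := none) hM h.links trivial trivial trivial trivial, a₂⟩ hS))
  | @openPriv K P i M T σ r c S R₁ R₂ k p C a f g f' g' key key' L r₁ r₂ hi hk hf hp hg hr₁ hf' hr₂ hg' =>
    obtain ⟨M', T', hi', hM, hT⟩ := h.dev hi
    obtain ⟨t, hft, ht⟩ := optionRel_some (AExpr.eval_rel hW h.pairing h.know f) hf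
    obtain ⟨s, hgs, hs⟩ := optionRel_some (AExpr.eval_rel hW h.pairing h.know g) hg
    cases ht with | sec hkey =>
    cases hs with | val hs =>
    obtain rfl := hs.of_pub h.pairing
    obtain ⟨σ', S', rfl, hr, hS⟩ := hT.uncons_low <| fun hh => by
      have := low_of_openPriv hh
      exact this.2.1 trivial (this.1 (this.2.2 key hk hkey))
    obtain ⟨Γ, pc, hE, ht⟩ := hr
    have hl := low_of_openPriv (h := False) ⟨Γ, pc, hE.left, ht, fun h => h.elim⟩
    have hl₁ := hl.2.2 key hk hkey
    cases ht with | openPriv _ _ _ _ _ _ _ a₂ =>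
    refine ⟨_, .openPriv hi' (hE.keyVal hM ▸ hk) hft (hE.prinVal hM ▸ hp) hgs
      ((hE.sameNames hM _).evalRights ▸ hr₁) (providesRights_rel hW h.pairing h.know hf')
      ((hE.sameNames hM _).evalRights ▸ hr₂) (providesRights_rel hW h.pairing h.know hg'),
      Φ, Function.update β i (β i), γ, δ, h.pairing, h.keys, h.fresh, h.know, h.links, ?_⟩
    exact optionRel_update h.devs (fun _ _ => id) (.refl _)
      (.of hM (.cons ⟨_, _, hE.addAtt hM h.links (hE.left.wf_of_eval hr₁) (hE.left.wf_of_eval hr₂) hl₁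
        (hl.1 hl₁), a₂⟩ hS))
  | @input K P i M T σ c x C a f v y hi hc hf hy =>
    obtain ⟨M', T', hi', hM, hT⟩ := h.dev hi
    obtain ⟨t, hft, ht⟩ := optionRel_some (AExpr.eval_rel hW h.pairing h.know f) hf
    cases ht with | @val _ v' hv =>
    obtain ⟨σ', S', rfl, ⟨Γ, pc, hE, ht⟩, hS⟩ := hT.uncons_low <| by
      rintro ⟨Γ, pc, hE, hT, hp⟩
      cases hT with | input e1 e2 e3 =>
      obtain ⟨-, -, ch, f1, -, -, f2⟩ := hE.chan _ _ _ _ e2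
      rw [hc] at f1
      cases f1
      exact hp trivial (f2.1 ⟨_, h.links.sub _ _ (h.links.att a)⟩)
    cases ht with | @input _ _ _ _ _ S R f1 f2 f3 =>
    obtain ⟨k0, -, ch, k1, -, k2, k3⟩ := hE.left.chan _ _ _ _ f2
    obtain ⟨-, -, ch', k1', -⟩ := hE.right.chan _ _ _ _ f2
    rw [hc] at k1
    cases k1
    have q := (hE.chan _ _ _ _ _ _ f2 hc k1').2 (k3.1 ⟨_, h.links.sub _ _ (h.links.att a)⟩)
    obtain rfl := (h.links.inj _ _ _ _ q (h.links.sub _ _ (h.links.att a))).1 rfl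
    obtain ⟨y', hy'⟩ := exists_fresh hM.fin'.1
    refine ⟨_, .input hi' k1' hft hy', Φ, Function.update β i (addLoc (β i) y y' (Low W σ M R)), γ, δ,
      h.pairing, h.keys, h.fresh, h.know, h.links, ?_⟩
    exact optionRel_update h.devs (fun _ _ => id) (.refl _)
      (.of (hM.addLoc hy hy' fun _ => hv) (.cons ⟨_, _, hE.addVar hM hy hy' k0, f3⟩
        (hS.mono (.setVar _ _ _) (.setVar _ _ _) (.addLoc hy hy' _) (.refl _))))
  | @output K P i M T σ e c C a v U' m hi hc hv hm =>
    obtain ⟨M', T', hi', hM, hT⟩ := h.dev hi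
    obtain ⟨σ', S', rfl, ⟨Γ, pc, hE, ht⟩, hS⟩ := hT.uncons_low <| by
      rintro ⟨Γ, pc, hE, hT, hp⟩
      cases hT with | output e1 e2 e3 e4 =>
      obtain ⟨-, -, ch, f1, -, -, f2⟩ := hE.chan _ _ _ _ e2
      rw [hc] at f1
      cases f1
      exact hp trivial (f2.1 ⟨_, h.links.sub _ _ (h.links.att a)⟩)
    cases ht with | output e1 e2 e3 e4 =>
    obtain ⟨k0, -, ch, k1, -, k2, k3⟩ := hE.left.chan _ _ _ _ e2
    obtain ⟨-, -, ch', k1', -⟩ := hE.right.chan _ _ _ _ e2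
    rw [hc] at k1
    cases k1
    have q := (hE.chan _ _ _ _ _ _ e2 hc k1').2 (k3.1 ⟨_, h.links.sub _ _ (h.links.att a)⟩)
    obtain rfl := (h.links.inj _ _ _ _ q (h.links.sub _ _ (h.links.att a))).1 rfl
    obtain ⟨Ψ, v', V, i1, i2, i3, i4⟩ := hv.sim hE hM h.pairing e1
    have hm' : K' m = none := by
      have := h.know m
      simp only [hm] at this
      generalize K' m = z at this
      cases this
      rfl
    refine ⟨_, .output hi' k1' i3 hm', Ψ, Function.update β i (β i), γ, δ, i2, h.keys, h.fresh, ?_,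
      h.links, ?_⟩
    · intro m'
      by_cases hmm : m' = m
      · subst hmm
        simpa using Option.Rel.some (TRel.val (i4 ((k2.1 ⟨_, h.links.att a⟩).mono e3)))
      · simpa [hmm] using know_mono i1 h.know m'
    · exact optionRel_update h.devs i1 (.refl _) (.of (hM.mono i1) (.cons ⟨_, _, hE, e4⟩ hS))

theorem isBisimulation_bisim (hW : ∀ j, Key.att j ∉ W) : IsBisimulation (Bisim W) where
  symm _ _ := Bisim.symm
  static := fun _ _ ⟨_, _, _, _, h⟩ => staticEquiv_of_rel hW h.pairing h.know
  internal _ _ _ := Bisim.internal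
  labelled _ _ _ _ := Bisim.labelled hW

end CloudTypes

namespace CloudTypes

/-! ### The confidential keys -/

variable {P P' : System} {evs : List (Option Event)} {L : Finset Key}

theorem Step.used_mono {ev} (h : Step P ev P') :
    P.used.nonces ⊆ P'.used.nonces ∧ P.used.keys ⊆ P'.used.keys := by
  cases h with
  | loc _ hs => exact hs.used_mono
  | openPub => exact ⟨subset_rfl, subset_rfl⟩
  | openPriv => exact ⟨subset_rfl, subset_rfl⟩
  | comm _ _ _ _ _ hv => exact ⟨hv.used_mono, subset_rfl⟩

theorem Step.fresh_key {i k L'} (h : Step P (some (i, k, L')) P') :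
    k ∉ P.used.keys ∧ k ∈ P'.used.keys := by
  generalize he : (some (i, k, L') : Option Event) = ev at h
  cases h with
  | loc _ hs =>
    cases hs with
    | newPrin h1 h2 h3 =>
      simp only [Option.map_some, Option.some.injEq, Prod.mk.injEq] at he
      obtain ⟨-, rfl, -⟩ := he
      exact ⟨h2, Finset.mem_insert_self _ _⟩
    | _ => simp at he
  | _ => simp at he

theorem Trace.used_mono (h : Trace P evs P') : P.used.keys ⊆ P'.used.keys := by
  induction h with
  | refl => exact subset_rfl
  | cons hs _ ih => exact hs.used_mono.2.trans ih

theorem Trace.fresh_key (h : Trace P evs P') : ∀ i k L', some (i, k, L') ∈ evs → k ∉ P.used.keys := by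
  induction h with
  | refl => simp
  | cons hs _ ih =>
    intro i k L' hm
    rcases List.mem_cons.1 hm with rfl | hm
    · exact hs.fresh_key.1
    · exact fun hk => ih i k L' hm (hs.used_mono.2 hk)

/-- The set `W` of the keys that can give access to data with the rights `L`: it contains the rights
of the principals created with one of these keys, which are then created by an allowed device. -/
theorem Trace.exists_keys (hT : Trace P evs P')
    (h0 : ∀ n, Key.hon n ∈ (traceBack evs L).2 → n ∈ P.used.keys) :
    ∃ W : Finset Key, L ⊆ W ∧ (∀ i k L', some (i, k, L') ∈ evs → Key.hon k ∈ W →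
        i ≠ 0 ∧ i ∈ (traceBack evs L).1 ∧ L' ⊆ W) ∧
      (∀ k ∈ W, k ∈ (traceBack evs L).2 ∨ ∃ n, k = .hon n ∧ n ∉ P.used.keys) ∧
      ∀ n, Key.hon n ∈ W → n ∈ P'.used.keys := by
  induction hT with
  | refl => exact ⟨L, subset_rfl, by simp, fun k hk => .inl hk, h0⟩
  | @cons P ev P₁ evs P' hs hT ih =>
    have hmono := hs.used_mono.2
    have hcons : traceBack (ev :: evs) L = backward ev (traceBack evs L) := rfl
    rw [hcons] at h0 ⊢
    set q := traceBack evs L with hq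
    rcases ev with _ | ⟨i, k, L'⟩
    · obtain ⟨W, h1, h2, h3, h4⟩ := ih fun n hn => hmono (h0 n hn)
      refine ⟨W, h1, fun i k L' hm => ?_, fun k hk => (h3 k hk).imp_right fun ⟨n, e, hn⟩ =>
        ⟨n, e, fun h => hn (hmono h)⟩, h4⟩
      exact h2 i k L' (by simpa using hm)
    · obtain ⟨f1, f2⟩ := hs.fresh_key
      by_cases hk : i ≠ 0 ∧ Key.hon k ∈ q.2
      · simp only [backward, if_pos hk] at h0 ⊢
        obtain ⟨W, h1, h2, h3, h4⟩ := ih fun n hn => by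
          by_cases hnk : n = k
          · exact hnk ▸ f2
          · refine hmono (h0 n (Finset.mem_union_right _ (Finset.mem_erase.2 ⟨?_, hn⟩)))
            simpa using hnk
        refine ⟨W ∪ L', h1.trans Finset.subset_union_left, fun j m L'' hm hW => ?_, fun m hm => ?_,
          fun n hn => ?_⟩
        · rcases List.mem_cons.1 hm with he | hm'
          · cases he
            exact ⟨hk.1, Finset.mem_insert_self _ _, Finset.subset_union_right⟩
          · rcases Finset.mem_union.1 hW with hW | hW
            · obtain ⟨g1, g2, g3⟩ := h2 j m L'' hm' hW
              exact ⟨g1, Finset.mem_insert_of_mem g2, g3.trans Finset.subset_union_left⟩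
            · -- a key of `L'` exists already, and cannot be created later on
              exact (hT.fresh_key j m L'' hm' (hmono (h0 m (Finset.mem_union_left _ hW)))).elim
        · rcases Finset.mem_union.1 hm with hm | hm
          · rcases h3 m hm with hm | ⟨n, rfl, hn⟩
            · by_cases hmk : m = .hon k
              · exact .inr ⟨k, hmk, f1⟩
              · exact .inl (Finset.mem_union_right _ (Finset.mem_erase.2 ⟨hmk, hm⟩))
            · exact .inr ⟨n, rfl, fun h => hn (hmono h)⟩
          · exact .inl (Finset.mem_union_left _ hm)
        · rcases Finset.mem_union.1 hn with hn | hn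
          · exact h4 n hn
          · exact hT.used_mono (hmono (h0 n (Finset.mem_union_left _ hn)))
      · simp only [backward, if_neg hk] at h0 ⊢
        obtain ⟨W, h1, h2, h3, h4⟩ := ih fun n hn => hmono (h0 n hn)
        refine ⟨W, h1, fun j m L'' hm hW => ?_, fun m hm => (h3 m hm).imp_right fun ⟨n, e, hn⟩ =>
          ⟨n, e, fun h => hn (hmono h)⟩, h4⟩
        rcases List.mem_cons.1 hm with he | hm'
        · cases he
          rcases h3 _ hW with hm | ⟨n, e, hn⟩
          · exact (f1 (h0 _ hm)).elim
          · cases e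
            exact (hn f2).elim
        · exact h2 j m L'' hm' hW

/-- What the sequence of reductions guarantees about the confidential keys `W`. -/
theorem ValidInitial.exists_keys {n} (hP : ValidInitial n P) (hT : Trace P evs P')
    (hs : SafeDevices P evs L) :
    ∃ W : Finset Key, L ⊆ W ∧ (∀ j, Key.att j ∉ W) ∧ (∀ m, Key.hon m ∈ W → m ∈ P'.used.keys) ∧
      (∀ i k L', some (i, k, L') ∈ evs → Key.hon k ∈ W → i ∈ devicesFrom P evs L ∧ L' ⊆ W) ∧
      ∀ i D, P.devs i = some D → ∀ l k L', D.mem.prin l = some (k, L') → k ∈ W →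
        i ∈ devicesFrom P evs L := by
  obtain ⟨W, h1, h2, h3, h4⟩ := hT.exists_keys (L := L) fun n hn => by
    obtain ⟨i, -, D, hD, l, hl⟩ := hs _ hn
    exact hP.known i D hD n (.inl ⟨l, _, hl⟩)
  refine ⟨W, h1, fun j hj => ?_, h4, fun i k L' he hk => ?_, fun i D hD l k L' hl hk => ?_⟩
  · rcases h3 _ hj with hj | ⟨n, e, -⟩
    · obtain ⟨i, hi, D, hD, l, hl⟩ := hs _ hj
      exact hP.own i D hi hD l j ∅ hl
    · cases e
  · obtain ⟨-, g2, g3⟩ := h2 i k L' he hk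
    exact ⟨.inl g2, g3⟩
  · rcases h3 _ hk with hk | ⟨n, rfl, hn⟩
    · obtain ⟨j, hj, D', hD', l', hl'⟩ := hs _ hk
      by_cases hij : i = j
      · subst hij
        exact .inr ⟨k, hk, hj, D', hD', l', hl'⟩
      · exact (hP.uniq i j D D' hij hD hD' l l' k L' ∅ hl hl').elim
    · exact (hn (hP.known i D hD n (.inl ⟨l, _, hl⟩))).elim

theorem traceBack_ne_zero (evs : List (Option Event)) (L : Finset Key) : 0 ∉ (traceBack evs L).1 := by
  induction evs with
  | nil => simp [traceBack]
  | cons ev evs ih =>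
    change 0 ∉ (backward ev (traceBack evs L)).1
    rcases ev with _ | ⟨i, k, L'⟩
    · exact ih
    · unfold backward
      dsimp only
      split_ifs with h
      · simpa using ⟨fun e => h.1 e.symm, ih⟩
      · exact ih

theorem zero_notMem_devicesFrom : 0 ∉ devicesFrom P evs L := by
  rintro (h | ⟨k, -, h, -⟩)
  · exact traceBack_ne_zero evs L h
  · omega

end CloudTypes

namespace CloudTypes

/-! ### Reductions of a device create safe values only -/

variable {W : Finset Key} {U U' : Finset ℕ} {p : Prop} {σ σ' : Env} {M M' : Mem} {lv : Lev}

/-- The variables of the memory contain safe values, and principals with keys in `W` occur only if `p`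
holds, and with rights in `W`. -/
structure MemSafe (W : Finset Key) (U : Finset ℕ) (p : Prop) (M : Mem) : Prop where
  var : ∀ y v, M.var y = some v → Safe W U v
  prin : ∀ l k L, M.prin l = some (k, L) → k ∈ W → p ∧ L ⊆ W
  fin : M.IsFinite

/-- The expression may be evaluated by a device with principals of `W` if `p` holds. -/
def Tame (p : Prop) (e : Expr) : Prop := (∃ Γ S R, HasType Γ e S R) ∨ ¬ p

theorem MemSafe.mono (h : MemSafe W U p M) (hU : U ⊆ U') : MemSafe W U' p M :=
  ⟨fun y v hv => (h.var y v hv).mono hU, h.prin, h.fin⟩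

theorem MemSafe.setVar (h : MemSafe W U p M) {v} (hv : Safe W U v) (y : ℕ) :
    MemSafe W U p (M.setVar y v) := by
  refine ⟨fun z w hz => ?_, h.prin, h.fin.setVar _ _⟩
  by_cases hzy : z = y
  · subst hzy
    simp only [Mem.setVar, Function.update_self, Option.some.injEq] at hz
    exact hz ▸ hv
  · exact h.var z w (by simpa [Mem.setVar, hzy] using hz)

theorem MemSafe.setPrin (h : MemSafe W U p M) {k L} (hk : k ∈ W → p ∧ L ⊆ W) (l : ℕ) :
    MemSafe W U p (M.setPrin l k L) := by
  refine ⟨h.var, fun l' k' L' hl => ?_, h.fin.setPrin _ _ _⟩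
  by_cases hll : l' = l
  · subst hll
    simp only [Mem.setPrin, Function.update_self, Option.some.injEq, Prod.mk.injEq] at hl
    obtain ⟨rfl, rfl⟩ := hl
    exact hk
  · exact h.prin l' k' L' (by simpa [Mem.setPrin, hll] using hl)

theorem MemSafe.varVal (h : MemSafe W U p M) {x v} (hx : σ.varVal M x = some v) : Safe W U v := by
  obtain ⟨y, -, hy⟩ := Option.bind_eq_some_iff.1 hx
  exact h.var y v hy

theorem MemSafe.prinVal (h : MemSafe W U p M) {x k L} (hx : σ.prinVal M x = some (k, L)) (hk : k ∈ W) :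
    p ∧ L ⊆ W := by
  obtain ⟨y, -, hy⟩ := Option.bind_eq_some_iff.1 hx
  exact h.prin y k L hy hk

theorem MemSafe.nameVal (h : MemSafe W U p M) (hp : ¬ p) (m : NameRef) :
    Option.Rel (TRel W (SafeId W U)) (σ.nameVal M m) (σ.nameVal M m) := by
  cases hm : σ.nameVal M m with
  | none => exact .none
  | some t =>
    refine .some ?_
    cases m with
    | var x =>
      obtain ⟨v, hv, rfl⟩ := Option.map_eq_some_iff.1 hm
      exact .val (h.varVal hv).rel
    | prin x =>
      obtain ⟨⟨k, L⟩, hv, rfl⟩ := Option.map_eq_some_iff.1 hm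
      exact .prin fun hk => hp (h.prinVal hv hk).1
    | key x =>
      obtain ⟨v, hv, rfl⟩ := Option.map_eq_some_iff.1 hm
      exact .val (.pub v)

theorem Safe.binop (o) {v w} (hv : Safe W U v) (hw : Safe W U w) : Safe W U (v.binop o w) :=
  (Rel.binop (pairing_safeId W U) o hv.rel hw.rel).safe

theorem Safe.index {v w} (hv : Safe W U v) (hw : Safe W U w) : Safe W U (v.index w) :=
  (Rel.index (pairing_safeId W U) hv.rel hw.rel).safe

theorem Safe.setIndex {v w u} (hv : Safe W U v) (hw : Safe W U w) (hu : Safe W U u) :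
    Safe W U (v.setIndex w u) :=
  (Rel.setIndex (pairing_safeId W U) hv.rel hw.rel hu.rel).safe

theorem Eval.safe (hW : ∀ j, Key.att j ∉ W) {e v} (h : Eval σ M U e v U') (hM : MemSafe W U p M)
    (he : Tame p e) : Safe W U' v := by
  induction h with
  | var hx => exact hM.varVal hx
  | int => exact .int _
  | pub => exact .pub _
  | release hx _ _ =>
    exact .encPrin (fun hk => (hM.prinVal hx hk).2) fun m hm => by cases hm; exact Finset.mem_insert_self _ _
  | releaseErr => exact .nav
  | enc _ _ _ ih =>
    refine .enc ((ih hM ?_).mono (Finset.subset_insert _ _)) fun m hm => by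
      cases hm; exact Finset.mem_insert_self _ _
    refine he.imp_left ?_
    rintro ⟨Γ, S, R, hT⟩
    cases hT with | enc _ h _ => exact ⟨_, _, _, h⟩
  | op h1 h2 ih1 ih2 =>
    refine .binop _ ((ih1 hM ?_).mono h2.used_mono) (ih2 (hM.mono h1.used_mono) ?_)
    all_goals
      refine he.imp_left ?_
      rintro ⟨Γ, S, R, hT⟩
      cases hT with | op h h' => exact ⟨_, _, _, ‹HasType Γ _ .int _›⟩
  | arrNil => exact .nil
  | arrCons h1 h2 ih1 ih2 =>
    refine .cons ((ih1 hM ?_).mono h2.used_mono) (ih2 (hM.mono h1.used_mono) ?_)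
    · refine he.imp_left ?_
      rintro ⟨Γ, S, R, hT⟩
      cases hT with | arrCons h h' => exact ⟨_, _, _, h⟩
    · refine he.imp_left ?_
      rintro ⟨Γ, S, R, hT⟩
      cases hT with | arrCons h h' => exact ⟨_, _, _, h'⟩
  | elem hx h1 ih1 =>
    refine .index ((hM.mono h1.used_mono).varVal hx) (ih1 hM ?_)
    refine he.imp_left ?_
    rintro ⟨Γ, S, R, hT⟩
    cases hT with | elem h h' => exact ⟨_, _, _, h'⟩
  | @ext U f t ht =>
    rcases he with ⟨Γ, S, R, hT⟩ | hp
    · cases hT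
    · have := AExpr.eval_rel hW (pairing_safeId W U) (hM.nameVal (σ := σ) hp) f
      rw [ht] at this
      cases this with | some h => exact h.toVal.safe

/-- The expressions of an elementary command. -/
def Act.exprs : Act → List Expr
  | .cond e₁ e₂ => [e₁, e₂]
  | .new _ _ _ e => [e]
  | .assign _ e => [e]
  | .assignArr _ e₁ e₂ => [e₁, e₂]
  | .decrypt _ e _ _ _ => [e]
  | .register _ e _ => [e]

theorem WellTyped.tame {pc Γ C a C₁ C₂} (h : WellTyped pc Γ C) (hh : C.head = some (a, C₁, C₂)) :
    ∀ e ∈ a.exprs, Tame p e := by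
  cases h <;> simp only [Cmd.head, Option.some.injEq, Prod.mk.injEq, reduceCtorEq] at hh <;>
    obtain ⟨rfl, -, -⟩ := hh <;> simp only [Act.exprs, List.mem_cons, List.not_mem_nil, or_false, forall_eq_or_imp,
      forall_eq]
  · exact ⟨.inl ⟨_, _, _, ‹_›⟩, .inl ⟨_, _, _, ‹_›⟩⟩
  · exact .inl ⟨_, _, _, ‹_›⟩
  · exact .inl ⟨_, _, _, ‹_›⟩
  · exact ⟨.inl ⟨_, _, _, ‹_›⟩, .inl ⟨_, _, _, ‹_›⟩⟩
  · exact .inl ⟨_, _, _, ‹_›⟩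
  · exact .inl ⟨_, _, _, ‹_›⟩

theorem ActStep.memSafe (hW : ∀ j, Key.att j ∉ W) {a b} (h : ActStep U σ M a U' σ' M' b)
    (hM : MemSafe W U p M) (ha : ∀ e ∈ a.exprs, Tame p e) : MemSafe W U' p M' := by
  have hM' := hM.mono h.used_mono
  cases h with
  | condTrue => exact hM'
  | condFalse => exact hM'
  | new hv _ => exact hM'.setVar (hv.safe hW hM (ha _ (by simp [Act.exprs]))) _
  | assign hv _ _ => exact hM'.setVar (hv.safe hW hM (ha _ (by simp [Act.exprs]))) _
  | assignArr h1 h2 _ hw =>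
    exact hM'.setVar ((hM'.var _ _ hw).setIndex
      ((h1.safe hW hM (ha _ (by simp [Act.exprs]))).mono h2.used_mono)
      (h2.safe hW (hM.mono h1.used_mono) (ha _ (by simp [Act.exprs])))) _
  | decTrue _ hv _ hd _ =>
    have := hv.safe hW hM (ha _ (by simp [Act.exprs]))
    obtain ⟨n, L, rfl, -, -⟩ := hd
    cases this with | enc h _ => exact hM'.setVar h _
  | decFalse => exact hM'
  | regTrue hk hv hd _ =>
    have := hv.safe hW hM (ha _ (by simp [Act.exprs]))
    obtain ⟨n, rfl, hkL⟩ := hd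
    cases this with
    | encPrin h _ => exact hM'.setPrin (fun h₁ => ⟨(hM.prinVal hk (h h₁ hkL)).1, h h₁⟩) _
  | regFalse => exact hM'

theorem SStep.memSafe (hW : ∀ j, Key.att j ∉ W) {C : Cmd} {q r : Finset ℕ × Mem × SConf} (hs : SStep q r)
    (hM : MemSafe W q.1 p q.2.1) (ht : SOk W False lv q.2.1 C q.2.2 ∨ ¬ p) :
    MemSafe W r.1 p r.2.1 := by
  induction hs with
  | act hh hs =>
    refine hs.memSafe hW hM fun e he => ?_
    rcases ht with ht | hp
    · cases ht with
      | run hr =>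
        obtain ⟨Γ, pc, hE, hT, -⟩ := hr
        exact hT.tame (SCmd.head_plug hh C) e he
    · exact .inr hp
  | fork => exact hM
  | left _ ih => exact ih hM (ht.imp_left fun h => by cases h; assumption)
  | right _ ih => exact ih hM (ht.imp_left fun h => by cases h; assumption)

theorem SStep.star_memSafe (hW : ∀ j, Key.att j ∉ W) {C : Cmd} {q r : Finset ℕ × Mem × SConf}
    (hs : Relation.ReflTransGen SStep q r) (hM : MemSafe W q.1 p q.2.1)
    (ha : ∀ y, lv.lo y → (q.2.1.var y).isSome) (ht : SOk W False lv q.2.1 C q.2.2 ∨ ¬ p) :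
    MemSafe W r.1 p r.2.1 := by
  induction hs with
  | refl => exact hM
  | tail h1 h2 ih =>
    rcases ht with ht | hp
    · obtain ⟨lv', -, h⟩ := SStep.star_sOk h1 ht ha
      exact h2.memSafe hW ih (.inl h)
    · exact h2.memSafe (lv := lv) (C := C) hW ih (.inr hp)

theorem LStep.memSafe (hW : ∀ j, Key.att j ∉ W) {u u' t ev ts} (hs : LStep u M t ev u' M' ts)
    (hM : MemSafe W u.nonces p M) (hr : ∃ σ C, t = .run σ C)
    (ha : ∀ y, lv.lo y → (M.var y).isSome) (ht : TOk W False lv M t ∨ ¬ p)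
    (hev : ∀ k L, ev = some (k, L) → Key.hon k ∈ W → p ∧ L ⊆ W) :
    MemSafe W u'.nonces p M' ∧ ∀ t' ∈ ts, ∃ σ C, t' = .run σ C := by
  have hM' := hM.mono hs.used_mono.1
  cases hs with
  | act hh hs =>
    refine ⟨hs.memSafe hW hM fun e he => ?_, by simp⟩
    rcases ht with ⟨Γ, pc, hE, hT, -⟩ | hp
    · exact hT.tame hh e he
    · exact .inr hp
  | par => exact ⟨hM, by simp⟩
  | bang => exact ⟨hM, by simp⟩
  | letKey => exact ⟨⟨hM'.var, hM'.prin, hM'.fin.setKey _ _⟩, by simp⟩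
  | newPrin => exact ⟨hM.setPrin (hev _ _ rfl) _, by simp⟩
  | @sync _ _ G C _ _ _ _ hs he =>
    refine ⟨SStep.star_memSafe (C := C) hW hs hM ha (ht.imp_left ?_), by simp⟩
    rintro ⟨Γ, pc, hE, hT, hp⟩
    cases hT with | sync h => exact .run ⟨Γ, pc, hE, h, hp⟩
  | set =>
    obtain ⟨σ, C, h⟩ := hr
    cases h

end CloudTypes

namespace CloudTypes

/-! ### Invariants of the sequence of reductions -/

variable {W : Finset Key} {U U' : Finset ℕ} {I : Set ℕ} {lo : ℕ → ℕ → Prop} {loD loP : Chan → Prop}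
  {P P' : System} {σ σ' : Env} {M M' : Mem}

/-- The channel `c` is one of the established channels `A`. -/
def Chan.IsEst (A : Finset (ℕ × ℕ × ℕ)) : Chan → Prop
  | .est id i j => (id, i, j) ∈ A
  | .att _ => False

/-- Invariants of the device `i`, where `I` is the set of the devices that may own confidential keys.
The device `0` is not typed. -/
structure DevOk (W : Finset Key) (U : Finset ℕ) (I : Set ℕ) (i : ℕ) (lv : Lev) (D : Device) : Prop where
  mem : MemSafe W U (i ∈ I) D.mem
  run : ∀ t ∈ D.threads, ∃ σ C, t = .run σ C
  alloc : ∀ y, lv.lo y → (D.mem.var y).isSome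
  typed : i ≠ 0 → ∀ t ∈ D.threads, TOk W False lv D.mem t

/-- Invariants of a system. The levels of the locations of the device `i` are given by `lo i`, those of
channels by `loD`, with respect to the transmitted data, and by `loP`, with respect to the place where
they are used. The ends of a channel for confidential data are in `I`. -/
structure SysOk (W : Finset Key) (I : Set ℕ) (lo : ℕ → ℕ → Prop) (loD loP : Chan → Prop)
    (P : System) : Prop where
  devs : ∀ i D, P.devs i = some D →
    DevOk W P.used.nonces I i ⟨lo i, loD, loP, Chan.IsEst P.chans⟩ D
  ends : ∀ id i j, (id, i, j) ∈ P.chans → ¬ loD (.est id i j) → i ∈ I ∧ j ∈ I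
  le : ∀ c, loD c → loP c

theorem DevOk.cons {i lv T C} (hM : MemSafe W U (i ∈ I) M) (hr : ∀ t ∈ T, ∃ σ C, t = .run σ C)
    (ha : ∀ y, lv.lo y → (M.var y).isSome) (hC : i ≠ 0 → RunOk W False lv M σ C)
    (hT : i ≠ 0 → ∀ t ∈ T, TOk W False lv M t) : DevOk W U I i lv ⟨M, .run σ C ::ₘ T⟩ where
  mem := hM
  run t ht := (Multiset.mem_cons.1 ht).elim (fun e => ⟨_, _, e⟩) (hr t)
  alloc := ha
  typed h0 t ht := (Multiset.mem_cons.1 ht).elim (fun e => by subst e; exact hC h0) (hT h0 t)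

theorem devsOk_update {f : ℕ → Option Device} {a a' : Chan → Prop} {loD' loP' : Chan → Prop}
    (h : ∀ k D, f k = some D → DevOk W U I k ⟨lo k, loD, loP, a⟩ D) (hU : U ⊆ U')
    (hl : ∀ M l, LevLe M ⟨l, loD, loP, a⟩ ⟨l, loD', loP', a'⟩) {i l D}
    (hD : DevOk W U' I i ⟨l, loD', loP', a'⟩ D) (k E) (hk : Function.update f i (some D) k = some E) :
    DevOk W U' I k ⟨Function.update lo i l k, loD', loP', a'⟩ E := by
  by_cases hki : k = i
  · subst hki
    simp only [Function.update_self, Option.some.injEq] at hk ⊢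
    exact hk ▸ hD
  · rw [Function.update_of_ne hki] at hk ⊢
    have := h k E hk
    exact ⟨this.mem.mono hU, this.run, this.alloc, fun h0 t ht =>
      (this.typed h0 t ht).mono (.refl _) (hl _ _)⟩

/-- The device `0` is not typed, but it is not in `I` and has no principals with keys in `W`, so it too
creates safe values only. -/
theorem SysOk.loc (hW : ∀ j, Key.att j ∉ W) (h : SysOk W I lo loD loP P) (hI : 0 ∉ I) {i t T ev u' ts}
    (hi : P.devs i = some ⟨M, t ::ₘ T⟩) (hs : LStep P.used M t ev u' M' ts)
    (hev : ∀ k L, ev = some (k, L) → Key.hon k ∈ W → i ∈ I ∧ L ⊆ W) :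
    ∃ lo' loD' loP', SysOk W I lo' loD' loP' (({ P with used := u' } : System).setDev i ⟨M', ts + T⟩) := by
  obtain ⟨hM, hrun, halloc, htyped⟩ := h.devs i _ hi
  have htame : TOk W False ⟨lo i, loD, loP, Chan.IsEst P.chans⟩ M t ∨ ¬ i ∈ I := by
    by_cases h0 : i = 0
    · exact .inr (h0 ▸ hI)
    · exact .inl (htyped h0 t (Multiset.mem_cons_self _ _))
  obtain ⟨hM', hrun'⟩ := hs.memSafe hW hM (hrun t (Multiset.mem_cons_self _ _)) halloc htame hev
  have hrun₁ : ∀ t' ∈ ts + T, ∃ σ C, t' = .run σ C := fun t' ht' => (Multiset.mem_add.1 ht').elim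
    (hrun' t') fun ht' => hrun t' (Multiset.mem_cons_of_mem ht')
  by_cases h0 : i = 0
  · refine ⟨Function.update lo i (lo i), loD, loP, devsOk_update h.devs hs.used_mono.1
      (fun M l => .refl M _) ⟨hM', hrun₁, fun y hy => hs.memLe.var y (halloc y hy), fun h => (h h0).elim⟩,
      h.ends, h.le⟩
  · obtain ⟨⟨l, lD, lP, la⟩, g, h1, -⟩ := hs.tOk (htyped h0 t (Multiset.mem_cons_self _ _)) halloc
    obtain rfl : lD = loD := g.loD
    obtain rfl : lP = loP := g.loP
    obtain rfl : la = Chan.IsEst P.chans := g.act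
    refine ⟨Function.update lo i l, lD, lP, devsOk_update h.devs hs.used_mono.1
      (fun M l => .refl M _) ⟨hM', hrun₁, g.alloc, fun _ t' ht' => ?_⟩, h.ends, h.le⟩
    rcases Multiset.mem_add.1 ht' with ht' | ht'
    · exact h1 t' ht'
    · exact (htyped h0 t' (Multiset.mem_cons_of_mem ht')).mono g.mem g.lev

/-- The levels of channels when the channel `c` is established, with the level `q`. -/
def newLev (lo : Chan → Prop) (c : Chan) (q : Prop) (d : Chan) : Prop := (d = c ∧ q) ∨ (d ≠ c ∧ lo d)

theorem newLev_self (lo : Chan → Prop) (c : Chan) (q : Prop) : newLev lo c q c ↔ q := by simp [newLev]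

theorem newLev_of_ne (lo : Chan → Prop) {c d : Chan} (q : Prop) (h : d ≠ c) : newLev lo c q d ↔ lo d := by
  simp [newLev, h]

theorem levLe_newLev {A : Finset (ℕ × ℕ × ℕ)} {id i j : ℕ} (hid : (id, i, j) ∉ A) (q q' : Prop) (M : Mem)
    (l : ℕ → Prop) :
    LevLe M ⟨l, loD, loP, Chan.IsEst A⟩
      ⟨l, newLev loD (.est id i j) q, newLev loP (.est id i j) q', Chan.IsEst (insert (id, i, j) A)⟩ := by
  have hne : ∀ c, Chan.IsEst A c → c ≠ .est id i j := by
    rintro _ hc rfl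
    exact hid hc
  refine ⟨fun _ _ => .rfl, fun c hc => ?_, fun c hc => newLev_of_ne _ _ (hne c hc),
    fun c hc => newLev_of_ne _ _ (hne c hc)⟩
  cases c with
  | est => exact Finset.mem_insert_of_mem hc
  | att => exact hc

/-- Two devices establish a new channel, of the levels `q` and `q'`. -/
theorem SysOk.openChan (h : SysOk W I lo loD loP P) {i j M₁ M₂ T₁ T₂ t₁ t₂ id σ₁ σ₂ C₁ C₂} {q q' : Prop}
    (hi : P.devs i = some ⟨M₁, t₁ ::ₘ T₁⟩) (hj : P.devs j = some ⟨M₂, t₂ ::ₘ T₂⟩)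
    (hid : (id, i, j) ∉ P.chans)
    (h₁ : i ≠ 0 → RunOk W False ⟨lo i, newLev loD (.est id i j) q, newLev loP (.est id i j) q',
      Chan.IsEst (insert (id, i, j) P.chans)⟩ M₁ σ₁ C₁)
    (h₂ : j ≠ 0 → RunOk W False ⟨lo j, newLev loD (.est id i j) q, newLev loP (.est id i j) q',
      Chan.IsEst (insert (id, i, j) P.chans)⟩ M₂ σ₂ C₂)
    (hq : ¬ q → i ∈ I ∧ j ∈ I) (hqq : q → q') :
    ∃ lo' loD' loP', SysOk W I lo' loD' loP'
      ((({ P with chans := insert (id, i, j) P.chans } : System).setDev i ⟨M₁, .run σ₁ C₁ ::ₘ T₁⟩).setDev j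
        ⟨M₂, .run σ₂ C₂ ::ₘ T₂⟩) := by
  have hl := levLe_newLev (loD := loD) (loP := loP) hid q q'
  obtain ⟨m₁, r₁, a₁, y₁⟩ := h.devs i _ hi
  obtain ⟨m₂, r₂, a₂, y₂⟩ := h.devs j _ hj
  have d₁ : DevOk W P.used.nonces I i ⟨lo i, newLev loD (.est id i j) q, newLev loP (.est id i j) q',
      Chan.IsEst (insert (id, i, j) P.chans)⟩ ⟨M₁, .run σ₁ C₁ ::ₘ T₁⟩ :=
    .cons m₁ (fun t ht => r₁ t (Multiset.mem_cons_of_mem ht)) a₁ h₁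
      fun h0 t ht => (y₁ h0 t (Multiset.mem_cons_of_mem ht)).mono (.refl _) (hl _ _)
  have d₂ : DevOk W P.used.nonces I j ⟨lo j, newLev loD (.est id i j) q, newLev loP (.est id i j) q',
      Chan.IsEst (insert (id, i, j) P.chans)⟩ ⟨M₂, .run σ₂ C₂ ::ₘ T₂⟩ :=
    .cons m₂ (fun t ht => r₂ t (Multiset.mem_cons_of_mem ht)) a₂ h₂
      fun h0 t ht => (y₂ h0 t (Multiset.mem_cons_of_mem ht)).mono (.refl _) (hl _ _)
  refine ⟨Function.update (Function.update lo i (lo i)) j (lo j), newLev loD (.est id i j) q,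
    newLev loP (.est id i j) q',
    devsOk_update (devsOk_update h.devs subset_rfl hl d₁) subset_rfl (fun M l => .refl M _) d₂,
    fun id' a b hc hn => ?_, fun c hc => ?_⟩
  · by_cases he : Chan.est id' a b = .est id i j
    · cases he
      rw [newLev_self] at hn
      exact hq hn
    · rw [newLev_of_ne _ _ he] at hn
      rcases Finset.mem_insert.1 hc with hc | hc
      · cases hc
        exact (he rfl).elim
      · exact h.ends _ _ _ hc hn
  · exact hc.imp (And.imp_right hqq) (And.imp_right (h.le c))

theorem RunOk.openPub {h : Prop} {lv lv' : Lev} {r c S C ch}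
    (hr : RunOk W h lv M σ (.openPub r c S C)) (hlv : LevLe M lv lv') (ha : lv'.act ch) (hD : lv'.loD ch)
    (hP : lv'.loP ch) : RunOk W h lv' M (σ.setChan c ch) C := by
  obtain ⟨Γ, pc, hE, hT, hp⟩ := hr
  cases hT with
  | openPub e1 e2 =>
    exact ⟨_, _, hE.addChan (R₁ := none) (R₂ := none) trivial trivial hlv ha (iff_of_true hD trivial)
      (iff_of_true hP trivial), e2, fun hh _ => hp hh trivial⟩

/-- Both ends of a channel for confidential data use confidential keys. This follows from the typing of one
end; the other end may be the attacker. -/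
theorem keys_of_openPriv {lv : Lev} {h : Prop} {r c S R₁ R₂ k p C k' key L r₁ r₂}
    (hr : RunOk W h lv M σ (.openPriv r c S R₁ R₂ k p C)) (hp : σ.prinVal M p = some (k', L))
    (hk : σ.keyVal M k = some key) (h₁ : evalRights σ M R₁ = some r₁) (h₂ : evalRights σ M R₂ = some r₂) :
    (LowKeys W r₁ → LowKeys W r₂) ∧ (¬ LowKeys W r₁ → k' ∈ W ∧ key ∈ W) := by
  rw [← low_evalRights h₁, ← low_evalRights h₂]
  have hl := low_of_openPriv hr
  exact ⟨hl.1, fun hn => ⟨by_contra fun hW => hn (prin_low_of_openPriv hr hp hW),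
    by_contra fun hW => hn (hl.2.2 _ hk hW)⟩⟩

theorem SysOk.step (hW : ∀ j, Key.att j ∉ W) (h : SysOk W I lo loD loP P) (hI : 0 ∉ I) {ev}
    (hs : Step P ev P') (hev : ∀ i k L, ev = some (i, k, L) → Key.hon k ∈ W → i ∈ I ∧ L ⊆ W) :
    ∃ lo' loD' loP', SysOk W I lo' loD' loP' P' := by
  cases hs with
  | @loc i _ _ _ ev _ _ _ hi hs => exact h.loc hW hI hi hs fun k L he => hev i k L (by simp [he])
  | @openPub i j _ _ _ _ _ _ _ _ _ _ _ id hij hi hj hid =>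
    have hl := levLe_newLev (loD := loD) (loP := loP) hid True True
    exact h.openChan (q := True) (q' := True) hi hj hid
      (fun h0 => RunOk.openPub ((h.devs i _ hi).typed h0 _ (Multiset.mem_cons_self _ _)) (hl _ _)
        (Finset.mem_insert_self _ _) ((newLev_self _ _ _).2 trivial) ((newLev_self _ _ _).2 trivial))
      (fun h0 => RunOk.openPub ((h.devs j _ hj).typed h0 _ (Multiset.mem_cons_self _ _)) (hl _ _)
        (Finset.mem_insert_self _ _) ((newLev_self _ _ _).2 trivial) ((newLev_self _ _ _).2 trivial))
      (fun h => (h trivial).elim) (fun h => h)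
  | @openPriv i j M₁ M₂ T₁ T₂ σ₁ σ₂ c₁ c₂ S R₁ R₂ R₁' R₂' k₁ k₂ p₁ p₂ C₁ C₂ id key₁ L₁ key₂ L₂ r r' hij
      hi hj hp₁ hp₂ hk₁ hk₂ hR₁ hR₂ hR₁' hR₂' hid =>
    have hl := levLe_newLev (loD := loD) (loP := loP) hid (LowKeys W r) (LowKeys W r')
    have t₁ : i ≠ 0 → RunOk W False _ M₁ σ₁ _ := fun h0 =>
      (h.devs i _ hi).typed h0 _ (Multiset.mem_cons_self _ _)
    have t₂ : j ≠ 0 → RunOk W False _ M₂ σ₂ _ := fun h0 =>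
      (h.devs j _ hj).typed h0 _ (Multiset.mem_cons_self _ _)
    have hkeys : (LowKeys W r → LowKeys W r') ∧ (¬ LowKeys W r → key₁ ∈ W ∧ key₂ ∈ W) := by
      by_cases h0 : i = 0
      · have := keys_of_openPriv (t₂ fun h1 => hij (h0.trans h1.symm)) hp₂ hk₂ hR₂ hR₂'
        exact ⟨this.1, fun hn => (this.2 hn).symm⟩
      · exact keys_of_openPriv (t₁ h0) hp₁ hk₁ hR₁ hR₁'
    exact h.openChan hi hj hid
      (fun h0 => (t₁ h0).openPriv (hl _ _) hR₁ hR₁' (Finset.mem_insert_self _ _) (newLev_self _ _ _)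
        (newLev_self _ _ _))
      (fun h0 => (t₂ h0).openPriv (hl _ _) hR₂ hR₂' (Finset.mem_insert_self _ _) (newLev_self _ _ _)
        (newLev_self _ _ _))
      (fun hn => ⟨((h.devs i _ hi).mem.prinVal hp₁ (hkeys.2 hn).1).1,
        ((h.devs j _ hj).mem.prinVal hp₂ (hkeys.2 hn).2).1⟩) hkeys.1
  | @comm i j M₁ M₂ T₁ T₂ σ₁ σ₂ c₁ c₂ e x C₁ C₂ id a b v U' y hij hi hj hc₁ hc₂ hv hy =>
    obtain ⟨m₁, r₁, a₁, y₁⟩ := h.devs i _ hi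
    obtain ⟨m₂, r₂, a₂, y₂⟩ := h.devs j _ hj
    have hsafe : Safe W U' v := by
      refine hv.safe hW m₁ ?_
      by_cases h0 : i = 0
      · exact .inr (h0 ▸ hI)
      · obtain ⟨Γ, pc, hE, hT, -⟩ := y₁ h0 _ (Multiset.mem_cons_self _ _)
        cases hT with | output e1 => exact .inl ⟨_, _, _, e1⟩
    -- the level of the new location is that of the data which the channel carries
    have key : ∃ l, (∀ z, l z → ((M₂.setVar y v).var z).isSome) ∧ (j ≠ 0 →
        RunOk W False ⟨l, loD, loP, Chan.IsEst P.chans⟩ (M₂.setVar y v) (σ₂.setVar x y) C₂ ∧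
        LevLe M₂ ⟨lo j, loD, loP, Chan.IsEst P.chans⟩ ⟨l, loD, loP, Chan.IsEst P.chans⟩) := by
      by_cases h0 : j = 0
      · exact ⟨lo j, fun z hz => (MemLe.setVar M₂ y v).var z (a₂ z hz), fun h => (h h0).elim⟩
      · obtain ⟨Γ, pc, hE, hT, hp⟩ := y₂ h0 _ (Multiset.mem_cons_self _ _)
        cases hT with
        | @input _ _ _ _ _ S R f1 f2 f3 =>
          have g := Grow.addLoc (h := False) a₂ hy (p := Low W σ₂ M₂ R) False.elim v
          exact ⟨_, g.alloc, fun _ => ⟨⟨_, _, hE.addVar (hE.chan _ _ _ _ f2).1 g.lev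
            (Lev.addLoc_lo a₂ hy _), f3, False.elim⟩, g.lev⟩⟩
    obtain ⟨l, hl, hj0⟩ := key
    have d₁ : DevOk W U' I i ⟨lo i, loD, loP, Chan.IsEst P.chans⟩ ⟨M₁, .run σ₁ C₁ ::ₘ T₁⟩ := by
      refine .cons (m₁.mono hv.used_mono) (fun t ht => r₁ t (Multiset.mem_cons_of_mem ht)) a₁ (fun h0 => ?_)
        fun h0 t ht => y₁ h0 t (Multiset.mem_cons_of_mem ht)
      obtain ⟨Γ, pc, hE, hT, hp⟩ := y₁ h0 _ (Multiset.mem_cons_self _ _)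
      cases hT with | output e1 e2 e3 e4 => exact ⟨_, _, hE, e4, hp⟩
    have d₂ : DevOk W U' I j ⟨l, loD, loP, Chan.IsEst P.chans⟩
        ⟨M₂.setVar y v, .run (σ₂.setVar x y) C₂ ::ₘ T₂⟩ :=
      .cons ((m₂.mono hv.used_mono).setVar hsafe y) (fun t ht => r₂ t (Multiset.mem_cons_of_mem ht)) hl
        (fun h0 => (hj0 h0).1)
        fun h0 t ht => (y₂ h0 t (Multiset.mem_cons_of_mem ht)).mono (.setVar _ _ _) (hj0 h0).2
    exact ⟨Function.update (Function.update lo i (lo i)) j l, loD, loP,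
      devsOk_update (devsOk_update h.devs hv.used_mono (fun M l => .refl M _) d₁) subset_rfl
        (fun M l => .refl M _) d₂, h.ends, h.le⟩

theorem SysOk.trace (hW : ∀ j, Key.att j ∉ W) (hI : 0 ∉ I) {evs} (hT : Trace P evs P')
    (hev : ∀ i k L, some (i, k, L) ∈ evs → Key.hon k ∈ W → i ∈ I ∧ L ⊆ W)
    (h : ∃ lo loD loP, SysOk W I lo loD loP P) : ∃ lo loD loP, SysOk W I lo loD loP P' := by
  induction hT with
  | refl => exact h
  | cons hs _ ih =>
    obtain ⟨lo, loD, loP, h⟩ := h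
    refine ih (fun i k L hm => hev i k L (List.mem_cons_of_mem _ hm)) (h.step hW hI hs ?_)
    rintro i k L rfl
    exact hev i k L List.mem_cons_self

theorem envOk_start (W : Finset Key) (M : Mem) (lv : Lev) : EnvOk W (.start M) (.start M) M lv where
  prin_iff p := by simp [Ctx.start, Env.start]
  prin_mem p l hl := by
    obtain ⟨q, hq, rfl⟩ := Option.map_eq_some_iff.1 hl
    simp [hq]
  key_iff p := by simp [Ctx.start, Env.start]
  key_mem p l hl := by
    obtain ⟨q, hq, rfl⟩ := Option.map_eq_some_iff.1 hl
    simp [hq]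
  var x S R hx := by cases hx
  chan c S R₁ R₂ hc := by cases hc

theorem ValidInitial.sysOk {n} (hP : ValidInitial n P)
    (hI : ∀ i D, P.devs i = some D → ∀ l k L', D.mem.prin l = some (k, L') → k ∈ W → i ∈ I) :
    SysOk W I (fun _ _ => False) (fun _ => True) (fun _ => True) P where
  devs i D hD := by
    refine ⟨⟨fun y v hv => ?_, fun l k L hl hk => ⟨hI i D hD l k L hl hk, ?_⟩, hP.finite i D hD⟩, fun t ht => ?_,
      fun y => False.elim, fun h0 t ht => ?_⟩
    · obtain ⟨k, rfl⟩ := hP.vars i D hD y v hv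
      exact .pub k
    · rw [hP.prins i D hD l k L hl]
      exact Finset.empty_subset _
    · obtain ⟨C, hC⟩ := hP.single i D hD
      rw [hC, Multiset.mem_singleton] at ht
      exact ⟨_, _, ht⟩
    · obtain ⟨C, hC⟩ := hP.single i D hD
      have hT := hP.typed i D (Nat.pos_of_ne_zero h0) hD _ C (hC ▸ Multiset.mem_singleton_self _)
      rw [hC, Multiset.mem_singleton] at ht
      subst ht
      exact ⟨_, _, envOk_start W _ _, hT, False.elim⟩
  ends id i j hc := by simp [hP.noChans] at hc
  le _ := id

end CloudTypes

namespace CloudTypes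

/-! ### The system and its modification are related -/

variable {W : Finset Key} {U U' : Finset ℕ} {I : Set ℕ} {lo : ℕ → ℕ → Prop} {loD loP : Chan → Prop}
  {P Q : System} {σ σ' : Env} {M M' : Mem} {A : Finset (ℕ × ℕ × ℕ)}

/-- The established channels between devices of `I`. -/
noncomputable abbrev chansIn (I : Set ℕ) (A : Finset (ℕ × ℕ × ℕ)) : Finset (ℕ × ℕ × ℕ) :=
  open Classical in A.filter fun q => q.2.1 ∈ I ∧ q.2.2 ∈ I

theorem mem_chansIn {id i j : ℕ} (hA : (id, i, j) ∈ A) (h : i ∈ I ∧ j ∈ I) : (id, i, j) ∈ chansIn I A := by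
  classical
  exact Finset.mem_filter.2 ⟨hA, h⟩

/-- Attacker channels and the established channels of `chansIn I A` at the level `l`, each one related
to itself. -/
def sameChan (I : Set ℕ) (A : Finset (ℕ × ℕ × ℕ)) (l : Chan → Prop) (c d : Chan) : Prop :=
  c = d ∧ ((∃ a, c = .att a) ∨ ∃ id i j, c = .est id i j ∧ (id, i, j) ∈ chansIn I A ∧ l c)

/-- Every location that is not confidential corresponds to itself. -/
def sameLoc (l : ℕ → Prop) (y y' : ℕ) : Prop := y = y' ∧ l y

/-- The links between the restriction of a system to the devices of `I` and itself. -/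
noncomputable abbrev sameLinks (I : Set ℕ) (A : Finset (ℕ × ℕ × ℕ)) (loD loP : Chan → Prop) : Links :=
  ⟨sameChan I A loP, sameChan I A loD, chansIn I A, chansIn I A⟩

/-- The substitution of a thread after the replacement of channels. -/
noncomputable abbrev Env.restrict (σ : Env) (I : Set ℕ) : Env :=
  { σ with chan := fun c => (σ.chan c).map (Chan.restrict I) }

theorem low_restrict {R : Rights} : Low W (σ.restrict I) M R ↔ Low W σ M R := by
  refine SameNames.low ?_
  cases R with
  | none => trivial
  | some RS => intro r _; cases r <;> rfl

/-- The channels that become attacker channels are not confidential. -/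
theorem sameChan_restrict {l : Chan → Prop}
    (hl : ∀ id i j, (id, i, j) ∈ A → ¬ l (.est id i j) → i ∈ I ∧ j ∈ I) {c : Chan} (hc : c.IsEst A) :
    sameChan I A l (c.restrict I) (c.restrict I) ↔ l c := by
  cases c with
  | att a => exact hc.elim
  | est id i j =>
    by_cases h : i ∈ I ∧ j ∈ I
    · have hm := mem_chansIn hc h
      simp only [Chan.restrict, if_pos h, sameChan, true_and]
      constructor
      · rintro (⟨a, ha⟩ | ⟨_, _, _, -, -, h⟩)
        · cases ha
        · exact h
      · exact fun h => .inr ⟨id, i, j, rfl, hm, h⟩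
    · have hlc : l (.est id i j) := by_contra fun hn => h (hl _ _ _ hc hn)
      simp only [Chan.restrict, if_neg h]
      exact iff_of_true ⟨rfl, .inl ⟨_, rfl⟩⟩ hlc

theorem exists_sameChan {l : Chan → Prop} {c : Chan} : (∃ d, sameChan I A l c d) ↔ sameChan I A l c c :=
  ⟨fun ⟨_, h⟩ => ⟨rfl, h.2⟩, fun h => ⟨c, h⟩⟩

theorem exists_sameChan' {l : Chan → Prop} {c : Chan} : (∃ d, sameChan I A l d c) ↔ sameChan I A l c c :=
  ⟨fun ⟨_, h⟩ => ⟨rfl, h.1 ▸ h.2⟩, fun h => ⟨c, h⟩⟩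

theorem active_restrict {c : Chan} (hc : c.IsEst A) : Chan.Active (chansIn I A) (c.restrict I) := by
  cases c with
  | att a => trivial
  | est id i j =>
    by_cases h : i ∈ I ∧ j ∈ I
    · simp only [Chan.restrict, if_pos h]
      exact mem_chansIn hc h
    · simp only [Chan.restrict, if_neg h]
      trivial

theorem EnvOk.restrict {Γ : Ctx} {lv lv' : Lev} (h : EnvOk W Γ σ M lv) (hlo : ∀ y, lv'.lo y ↔ lv.lo y)
    (hch : ∀ c, lv.act c → lv'.act (c.restrict I) ∧ (lv'.loD (c.restrict I) ↔ lv.loD c) ∧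
      (lv'.loP (c.restrict I) ↔ lv.loP c)) : EnvOk W Γ (σ.restrict I) M lv' where
  prin_iff := h.prin_iff
  prin_mem := h.prin_mem
  key_iff := h.key_iff
  key_mem := h.key_mem
  var x S R hx := by
    obtain ⟨h1, y, h2, h3, h4⟩ := h.var x S R hx
    exact ⟨h1, y, h2, h3, (hlo y).trans (h4.trans low_restrict.symm)⟩
  chan c S R₁ R₂ hc := by
    obtain ⟨h1, h2, ch, h3, h4, h5, h6⟩ := h.chan c S R₁ R₂ hc
    obtain ⟨g1, g2, g3⟩ := hch ch h4
    exact ⟨h1, h2, ch.restrict I, by simp [h3], g1, g2.trans (h5.trans low_restrict.symm),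
      g3.trans (h6.trans low_restrict.symm)⟩

/-- After the replacement of channels, a well-typed substitution corresponds to itself. -/
theorem EnvOk.envPair {Γ : Ctx} {l : ℕ → Prop} (h : EnvOk W Γ σ M ⟨l, loD, loP, Chan.IsEst A⟩)
    (hD : ∀ id i j, (id, i, j) ∈ A → ¬ loD (.est id i j) → i ∈ I ∧ j ∈ I) (hle : ∀ c, loD c → loP c) :
    EnvPair W (sameLoc l) (sameLinks I A loD loP) Γ (σ.restrict I) (σ.restrict I) M M := by
  have hP : ∀ id i j, (id, i, j) ∈ A → ¬ loP (.est id i j) → i ∈ I ∧ j ∈ I := fun id i j hA hn =>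
    hD id i j hA fun h => hn (hle _ h)
  constructor
  · refine h.restrict (fun y => ⟨fun ⟨_, _, hy⟩ => hy, fun hy => ⟨y, rfl, hy⟩⟩) fun c hc =>
      ⟨active_restrict hc, exists_sameChan.trans (sameChan_restrict hD hc),
        exists_sameChan.trans (sameChan_restrict hP hc)⟩
  · refine h.restrict (fun y => ⟨fun ⟨_, e, hy⟩ => e ▸ hy, fun hy => ⟨y, rfl, hy⟩⟩) fun c hc =>
      ⟨active_restrict hc, exists_sameChan'.trans (sameChan_restrict hD hc),
        exists_sameChan'.trans (sameChan_restrict hP hc)⟩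
  · rfl
  · rfl
  · intro x S R y y' hx hy hy' hl
    obtain ⟨-, z, e1, -, e2⟩ := h.var x S R hx
    change σ.var x = _ at hy hy'
    rw [e1] at hy hy'
    cases hy
    cases hy'
    exact ⟨rfl, e2.2 (low_restrict.1 hl)⟩
  · intro c S R₁ R₂ ch ch' hc hy hy'
    obtain ⟨-, -, d, e1, e2, e3, e4⟩ := h.chan c S R₁ R₂ hc
    simp only [e1, Option.map_some, Option.some.injEq] at hy hy'
    subst hy hy'
    exact ⟨fun hl => (sameChan_restrict hD e2).2 (e3.2 (low_restrict.1 hl)),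
      fun hl => (sameChan_restrict hP e2).2 (e4.2 (low_restrict.1 hl))⟩

theorem threadsPair_restrict {l : ℕ → Prop}
    (hD : ∀ id i j, (id, i, j) ∈ A → ¬ loD (.est id i j) → i ∈ I ∧ j ∈ I) (hle : ∀ c, loD c → loP c)
    (T : Multiset Thread) (hr : ∀ t ∈ T, ∃ σ C, t = .run σ C)
    (hT : ∀ t ∈ T, TOk W False ⟨l, loD, loP, Chan.IsEst A⟩ M t) :
    ThreadsPair W (sameLoc l) (sameLinks I A loD loP) M M (T.map (Thread.restrict I))
      (T.map (Thread.restrict I)) := by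
  induction T using Multiset.induction with
  | empty => exact .of_left (by simp)
  | cons t T ih =>
    simp only [Multiset.mem_cons, forall_eq_or_imp] at hr hT
    obtain ⟨⟨σ, C, rfl⟩, hr⟩ := hr
    obtain ⟨⟨Γ, pc, hE, ht, -⟩, hT⟩ := hT
    simp only [Multiset.map_cons]
    exact .cons ⟨Γ, pc, hE.envPair hD hle, ht⟩ (ih hr hT)

theorem MemSafe.memPair {p : Prop} (h : MemSafe W U p M) {l : ℕ → Prop} (ha : ∀ y, l y → (M.var y).isSome) :
    MemPair W (SafeId W U) (sameLoc l) M M where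
  prin := rfl
  key := rfl
  safe l k L hl hk := (h.prin l k L hl hk).2
  fin := h.fin
  fin' := h.fin
  var := by
    rintro y _ ⟨rfl, hy⟩
    obtain ⟨v, hv⟩ := Option.isSome_iff_exists.1 (ha y hy)
    exact ⟨v, v, hv, hv, (h.var y v hv).rel⟩
  inj := by
    rintro y _ z _ ⟨rfl, -⟩ ⟨rfl, -⟩
    rfl

theorem linkOk_sameLinks (hle : ∀ c, loD c → loP c) : LinkOk (sameLinks I A loD loP) where
  att a := ⟨rfl, .inl ⟨a, rfl⟩⟩
  sub c d h := ⟨h.1, h.2.imp_right fun ⟨id, i, j, e, hm, hl⟩ => ⟨id, i, j, e, hm, hle c hl⟩⟩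
  shape := by
    rintro c _ ⟨rfl, ⟨a, rfl⟩ | ⟨id, i, j, rfl, hm, -⟩⟩
    · exact .inl ⟨a, rfl, rfl⟩
    · exact .inr ⟨id, id, i, j, rfl, rfl, hm, hm⟩
  inj := by
    rintro c _ c' _ ⟨rfl, -⟩ ⟨rfl, -⟩
    rfl

/-- The attacker cannot use confidential keys. -/
theorem SysOk.knowledge (h : SysOk W I lo loD loP P) (hU : P.used.nonces ⊆ U) (m : AttVar) :
    Option.Rel (TRel W (SafeId W U)) (P.knowledge I m) (P.knowledge I m) := by
  cases hm : P.knowledge I m with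
  | none => exact .none
  | some t =>
    refine .some ?_
    cases m with
    | ofVar i y =>
      simp only [System.knowledge] at hm
      split_ifs at hm with hi
      obtain ⟨D, hD, hm⟩ := Option.bind_eq_some_iff.1 hm
      obtain ⟨v, hv, rfl⟩ := Option.map_eq_some_iff.1 hm
      exact .val (((h.devs i D hD).mem.var y v hv).mono hU).rel
    | ofPrin i y =>
      simp only [System.knowledge] at hm
      split_ifs at hm with hi
      obtain ⟨D, hD, hm⟩ := Option.bind_eq_some_iff.1 hm
      obtain ⟨⟨k, L⟩, hv, rfl⟩ := Option.map_eq_some_iff.1 hm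
      exact .prin fun hk => hi ((h.devs i D hD).mem.prin y k L hv hk).1
    | ofKey i y =>
      simp only [System.knowledge] at hm
      split_ifs at hm with hi
      obtain ⟨D, hD, hm⟩ := Option.bind_eq_some_iff.1 hm
      obtain ⟨k, hv, rfl⟩ := Option.map_eq_some_iff.1 hm
      exact .val (.pub k)
    | recv n => cases hm

/-- The modification of a confidential variable of the device `i` leads to a related system. -/
theorem SysOk.bisim (h : SysOk W I lo loD loP Q) (hI : 0 ∉ I) (hkeys : ∀ m, Key.hon m ∈ W → m ∈ Q.used.keys)
    {K : Knowledge} (hK : ∀ m, Option.Rel (TRel W (SafeId W Q.used.nonces)) (K m) (K m))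
    {i y : ℕ} {D : Device} (hD : Q.devs i = some D) (hy : (D.mem.var y).isSome) (hlo : ¬ lo i y) (v : Val) :
    Bisim W ⟨K, Q.sub I⟩ ⟨K, (Q.reassign i y v).sub I⟩ := by
  refine ⟨SafeId W Q.used.nonces, fun k => sameLoc (lo k), sameChan I Q.chans loP, sameChan I Q.chans loD,
    pairing_safeId W _, rfl, hkeys, hK, linkOk_sameLinks h.le, fun k => ?_⟩
  by_cases hk : k ∈ I
  · have h0 : k ≠ 0 := fun e => hI (e ▸ hk)
    simp only [System.sub, System.reassign, if_pos hk]
    by_cases hki : k = i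
    · subst hki
      simp only [Function.update_self, hD, Option.map_some, Multiset.map_cons]
      obtain ⟨h1, h2, h3, h4⟩ := h.devs k D hD
      refine .some ⟨h1.memPair h3, .cons_right ⟨trivial, hy, ?_⟩
        (threadsPair_restrict h.ends h.le _ h2 (h4 h0))⟩
      rintro ⟨_, e, hl⟩
      exact hlo (e ▸ hl)
    · simp only [Function.update_of_ne hki]
      cases hE : Q.devs k with
      | none => exact .none
      | some E =>
        obtain ⟨h1, h2, h3, h4⟩ := h.devs k E hE
        exact .some ⟨h1.memPair h3, threadsPair_restrict h.ends h.le _ h2 (h4 h0)⟩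
  · simp only [System.sub, if_neg hk]
    exact .none

/-- The declaration of a confidential variable: it takes place on a device of `I`, and the new location
is confidential. -/
theorem SysOk.declare (hW : ∀ j, Key.att j ∉ W) (h : SysOk W I lo loD loP P) {i x S RS E C T L w y}
    (hi : i ≠ 0) (hdev : P.devs i = some ⟨M, .run σ (.new x S (some RS) E C) ::ₘ T⟩)
    (hL : evalRS σ M RS = some L) (hLW : L ⊆ W) (hE : Eval σ M P.used.nonces E w U') (hy : M.var y = none) :
    ¬ lo i y ∧ SysOk W I lo loD loP (({ P with used := { P.used with nonces := U' } } : System).setDev i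
      ⟨M.setVar y w, .run (σ.setVar x y) C ::ₘ T⟩) := by
  obtain ⟨m, r, a, t⟩ := h.devs i _ hdev
  have hlo : ¬ lo i y := fun hl => by
    have := a y hl
    simp [hy] at this
  obtain ⟨Γ, pc, hG, hT, -⟩ := t hi _ (Multiset.mem_cons_self _ _)
  cases hT with
  | new e1 e2 e3 e4 e5 e6 =>
    have hhigh : ¬ Low W σ M (some RS) := (low_evalRS hL).not.2 (not_not.2 hLW)
    have d : DevOk W U' I i ⟨lo i, loD, loP, Chan.IsEst P.chans⟩
        ⟨M.setVar y w, .run (σ.setVar x y) C ::ₘ T⟩ :=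
      .cons ((m.mono hE.used_mono).setVar (hE.safe hW m (.inl ⟨_, _, _, e3⟩)) y)
        (fun t ht => r t (Multiset.mem_cons_of_mem ht)) (fun z hz => (MemLe.setVar M y w).var z (a z hz))
        (fun _ => ⟨_, _, hG.addVar e2 (.refl _ _) (iff_of_false hlo hhigh), e6, False.elim⟩)
        fun h0 s hs => (t h0 s (Multiset.mem_cons_of_mem hs)).mono (.setVar _ _ _) (.refl _ _)
    have := devsOk_update h.devs hE.used_mono (fun M l => .refl M _) d
    rw [Function.update_eq_self] at this
    exact ⟨hlo, this, h.ends, h.le⟩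

end CloudTypes

open CloudTypes in
theorem mainTheorem1 (n : ℕ) (P P' : System) (evs : List (Option Event))
    (hP : ValidInitial n P) (hT : Trace P evs P')
    (i : ℕ) (hi : 1 ≤ i ∧ i ≤ n)
    (M : Mem) (σ : Env) (x : ℕ) (S : Ty) (RS : RSet) (E : Expr) (C : Cmd) (T : Multiset Thread)
    (hdev : P'.devs i = some ⟨M, .run σ (.new x S (some RS) E C) ::ₘ T⟩)
    (L : Finset Key) (hL : evalRS σ M RS = some L)
    (w : Val) (U' : Finset ℕ) (hE : Eval σ M P'.used.nonces E w U')
    (y : ℕ) (hy : M.var y = none)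
    (hsafe : SafeDevices P evs L) (v : Val) (Q : System)
    (hQ : Q = ({ P' with used := { P'.used with nonces := U' } } : System).setDev i
      ⟨M.setVar y w, .run (σ.setVar x y) C ::ₘ T⟩) :
    Bisimilar ⟨P'.knowledge (devicesFrom P evs L), Q.sub (devicesFrom P evs L)⟩
      ⟨P'.knowledge (devicesFrom P evs L),
        (Q.reassign i y v).sub (devicesFrom P evs L)⟩ := by
  obtain ⟨W, hLW, hatt, hkeys, hev, hinit⟩ := hP.exists_keys hT hsafe
  obtain ⟨lo, loD, loP, h⟩ := SysOk.trace hatt zero_notMem_devicesFrom hT hev ⟨_, _, _, hP.sysOk hinit⟩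
  obtain ⟨hlo, hS⟩ := h.declare hatt (Nat.one_le_iff_ne_zero.1 hi.1) hdev hL hLW hE hy
  subst hQ
  exact ⟨Bisim W, isBisimulation_bisim hatt, hS.bisim zero_notMem_devicesFrom hkeys
    (h.knowledge hE.used_mono) (Function.update_self ..) (by simp [Mem.setVar]) hlo v⟩
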